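/- **Conventions.** $\Omega$ is the set of countable limit ordinals. A *ladder system* on $\omega_1$ is a sequence $\bar C=\langle C_\eta:\eta\in\Omega\rangle$ where each $C_\eta$ is a cofinal subset of $\eta$ of order type $\omega$; $C_\eta(n)$ is the element of $C_\eta$ with exactly $n$ predecessors in $C_\eta$. A *dense function* is a partial function $F\colon 2^\omega\to 2$ such that for each $s\in 2^{<\omega}$ both values of $F$ are attained on $\{x\in\mathrm{dom}(F): s\triangleleft x\}$, where $\triangleleft$ means "is an initial segment of". For $g\colon\Omega\to2$, $Q_{\bar C,F,g}$ is the set of functions $r\colon\delta\to 2$, $\delta<\omega_1$, such that for all $\eta\in(\delta+1)\cap\Omega$ the sequence $\langle r(C_\eta(i)):i<\omega\rangle$ is in $\mathrm{dom}(F)$ and $F(\langle r(C_\eta(i)):i<\omega\rangle)=g(\eta)$, ordered by extension. $\mathbf Q_{\bar C,F}$ is the class of sequences $\mathbf q=\langle\mathbb P_\alpha,\dot Q_\beta,\dot g_\beta,\dot h_\beta:\alpha\le\alpha_*,\beta<\alpha_*\rangle$ such that $\langle\mathbb P_\alpha,\dot Q_\beta\rangle$ is a countable support iteration, $\dot g_\beta$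 is a $\mathbb P_\beta$-name for a function from $\Omega$ to $2$, $\dot Q_\beta$ is a $\mathbb P_\beta$-name for $Q_{\bar C,F,\dot g_\beta}$, and $\dot h_\beta$ is a $\mathbb P_{\beta+1}$-name for the $\dot Q_\beta$-generic function from $\omega_1$ to $2$. $|\mathbf q|$ denotes the cardinality of the transitive closure of $\mathbf q$, and $H(\chi)$ the set of all sets whose transitive closure has cardinality less than $\chi$. A *suitable data sequence* is a sequence $S=\langle\bar C,F,\mathbf q,p,X,\langle Y_k\rangle_{k\in\omega},\langle i_k\rangle_{k\in\omega},\langle D_k\rangle_{k\in\omega}\rangle$ such that - $\bar C$ is a ladder system on $\omega_1$, $F$ is a dense function, $\mathbf q\in\mathbf Q_{\bar C,F}$ has length $\alpha_*$, and $p\in\mathbb P_{\alpha_*}$; - $X\prec (H((2^{2^{|\mathbf q|}})^+),\in)$ is countable and $\bar C,F,\mathbf q,p\in X$; - each $Y_k$ is a countable elementary substructure of $(H((2^{|\mathbf q|})^+),\in)$, $Y_k\in Y_{k+1}$, $\bar C,F,p\in Y_0$, $X\cap H((2^{|\mathbf q|})^+)=\bigcup_k Y_k$, and $C_{X\cap\omega_1}\cap(Y_{k+1}\setminus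 Y_k)\ne\emptyset$ for all $k$; - with $\langle\alpha_i:i<i_*\rangle$ the increasing enumeration of $X\cap\alpha_*$, $\langle i_k:k\in\omega\rangle$ lists $i_*$ without repetition and $\alpha_{i_k}\in Y_k$ for all $k$; - $\langle D_k:k\in\omega\rangle$ lists the dense open subsets of $\mathbb P_{\alpha_*}$ that are in $X$, and $D_k\in Y_k$ for all $k$. Given such an $S$, let $\gamma=X\cap\omega_1$, $m_k=|C_\gamma\cap Y_k|$ and $u_k=\{i_n:n<k,\ \alpha_{i_n}\in Y_k\}$. A *condition tree* for $S$ is a pair $(T,\langle p_\rho:\rho\in T\rangle)$ such that 1. $T$ is a finitely branching tree of finite sequences with a unique node of length $1$; 2. each $\rho\in T$ has the form $\langle s^\rho_\ell:\ell<|\rho|\rangle$ with $s^\rho_\ell\colon u_\ell\to2^{m_\ell}$, and $s^\rho_\ell(i)\triangleleft s^\rho_{\ell+1}(i)$ whenever $\ell+1<|\rho|$ and $i\in u_\ell$; 3. whenever $\rho\in T$ has length $k+1$ and $s\colon u_k\to2^{m_{k+1}}$ satisfies $s^\rho_k(i)\triangleleft s(i)$ for all $i\in u_k$, there is exactly one $\rho'\in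 T$ of length $k+2$ with $\rho\triangleleft\rho'$ and $s^{\rho'}_{k+1}(i)=s(i)$ for all $i\in u_k$; 4. $p_{\langle\rangle}=p$; 5. $p_\rho\in D_{|\rho|-1}\cap Y_{|\rho|-1}$ for all $\rho\in T\setminus\{\langle\rangle\}$; 6. if $\rho_1\triangleleft\rho_2$ are in $T$, then $p_{\rho_2}\le p_{\rho_1}$ in $\mathbb P_{\alpha_*}$; 7. if $\rho\in T$ has length $k+1$, then for all $i\in u_k$, $p_\rho\restriction(\alpha_i+1)\Vdash_{\mathbb P_{\alpha_i+1}}\langle\dot h_{\alpha_i}(C_\gamma(n)):n<m_k\rangle=\check s^\rho_k(i)$; 8. if $j<i_*$ and $\rho_1,\rho_2\in T$ have the same length and $s^{\rho_1}_\ell(i)=s^{\rho_2}_\ell(i)$ for all $\ell<|\rho_1|$ and all $i\in u_\ell$ with $\alpha_i\le\alpha_j$, then $p_{\rho_1}\restriction\alpha_j=p_{\rho_2}\restriction\alpha_j$. **Lemma.** For every suitable data sequence $S$ there exists a condition tree for $S$. -/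

import Mathlib

universe u

noncomputable section

namespace CondTree

open ZFSet Ordinal Cardinal

/-! ### Sets, sequences, `H(κ)` and elementary submodels -/

/-- The transitive closure of `x` (all members, members of members, ...). -/
def trcl (x : ZFSet.{u}) : ZFSet.{u} :=
  (vonNeumann (rank x)).sep fun y => Relation.TransGen (fun a b : ZFSet.{u} => a ∈ b) y x

/-- `H(κ)`: the sets whose transitive closure has fewer than `κ` elements. -/
def HSet (κ : Cardinal.{u}) : Set ZFSet.{u} := {x | card (trcl x) < κ}

/-- The relation symbol of the language of set theory. -/
inductive SetRel : ℕ → Type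
  | mem : SetRel 2

/-- The first-order language of set theory, with one binary relation symbol. -/
def setLang : FirstOrder.Language.{0, 0} := ⟨fun _ => Empty, SetRel⟩

/-- `(H(κ), ∈)` as a first-order structure. -/
instance (κ : Cardinal.{u}) : setLang.Structure (HSet κ) where
  funMap := fun f => f.elim
  RelMap := fun
    | .mem => fun v => (v 0).val ∈ (v 1).val

/-- `X ≺ (H(κ), ∈)`. -/
def IsElemSub (X : ZFSet.{u}) (κ : Cardinal.{u}) : Prop :=
  ∃ S : setLang.ElementarySubstructure (HSet κ),
    ∀ x : ZFSet.{u}, x ∈ X ↔ ∃ h : x ∈ HSet κ, (⟨x, h⟩ : HSet κ) ∈ S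

/-- The sequence `⟨f β : β < α⟩` as a set, i.e. the function with domain `α` and values `f β`. -/
def seqCode (α : Ordinal.{u}) (f : Ordinal.{u} → ZFSet.{u}) : ZFSet.{u} :=
  range fun β : Set.Iio α => pair β.val.toZFSet (f β.val)

/-- The restriction `r ↾ β` of a function `r` defined on an ordinal. -/
def restrict (r : ZFSet.{u}) (β : Ordinal.{u}) : ZFSet.{u} :=
  r.sep fun z => ∃ ξ < β, ∃ b, z = pair ξ.toZFSet b

/-- The elements `0 = ∅` and `1 = {∅}` of `2`. -/
def bit (b : Bool) : ZFSet.{u} := if b then {∅} else ∅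

/-- The product `A × 2`. -/
def timesTwo (A : ZFSet.{u}) : ZFSet.{u} := prod A {∅, {∅}}

/-! ### Ladder systems and dense functions -/

/-- `Ω`, the set of countable limit ordinals. -/
def Lim : Set Ordinal.{u} := {η | η < ω₁ ∧ Order.IsSuccLimit η}

/-- `Ω` as a set of `ZFSet`. -/
def limCode : ZFSet.{u} := (toZFSet ω₁).sep fun x => ∃ η ∈ Lim, x = toZFSet η

/-- A ladder system on `ω₁`. The set `C_η`, cofinal in `η` and of order type `ω`, is given by its
increasing enumeration: `C η n` is the element `C_η(n)` with exactly `n` predecessors in `C_η`. -/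
def IsLadderSystem (C : Ordinal.{u} → ℕ → Ordinal.{u}) : Prop :=
  ∀ η ∈ Lim, StrictMono (C η) ∧ (∀ n, C η n < η) ∧ ∀ ξ < η, ∃ n, ξ < C η n

/-- The ladder system `⟨C_η : η ∈ Ω⟩` as a set. -/
def ladderCode (C : Ordinal.{u} → ℕ → Ordinal.{u}) : ZFSet.{u} :=
  range fun η : {η : Set.Iio (ω₁ : Ordinal.{u}) // η.val ∈ Lim} =>
    pair (toZFSet η.val.val) (range fun n : ℕ => toZFSet (C η.val.val n))

/-- A dense function: a partial function from `2^ω` to `2` that takes both values on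
each basic open set. -/
def IsDenseFunction (F : (ℕ → Bool) → Option Bool) : Prop :=
  ∀ (s : List Bool) (b : Bool), ∃ x : ℕ → Bool, (∀ i : Fin s.length, x i = s.get i) ∧ F x = some b

/-- An element of `2^ω` as a set. -/
def realCode (x : ℕ → Bool) : ZFSet.{u} :=
  range fun n : ℕ => pair (toZFSet (n : Ordinal.{u})) (bit (x n))

/-- The partial function `F` as a set. -/
def denseCode (F : (ℕ → Bool) → Option Bool) : ZFSet.{u} :=
  range fun z : {z : (ℕ → Bool) × Bool // F z.1 = some z.2} => pair (realCode z.val.1) (bit z.val.2)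

/-! ### Forcing -/

/-- A set of conditions, an order relation on it (a set of ordered pairs) and a largest element. -/
structure ForcingNotion where
  carrier : ZFSet.{u}
  rel : ZFSet.{u}
  one : ZFSet.{u}

namespace ForcingNotion

variable (P : ForcingNotion.{u})

def code : ZFSet.{u} := pair P.carrier (pair P.rel P.one)

/-- `p ≤ q`, that is, `p` is stronger than `q`. -/
def Le (p q : ZFSet.{u}) : Prop := pair p q ∈ P.rel

/-- The conditions satisfying `φ` are dense below `p`. -/
def DenseBelow (p : ZFSet.{u}) (φ : ZFSet.{u} → Prop) : Prop :=
  ∀ q ∈ P.carrier, P.Le q p → ∃ r ∈ P.carrier, P.Le r q ∧ φ r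

/-- `D` is a dense open subset of `P`. -/
def IsDenseOpen (D : ZFSet.{u}) : Prop :=
  D ⊆ P.carrier ∧ (∀ p ∈ P.carrier, ∃ d ∈ D, P.Le d p) ∧
    ∀ d ∈ D, ∀ q ∈ P.carrier, P.Le q d → q ∈ D

/-- `x` is a `P`-name: a set of pairs `(σ, s)` with `σ` a `P`-name and `s ∈ P`. -/
inductive IsName : ZFSet.{u} → Prop
  | mk (x : ZFSet.{u}) (h₁ : ∀ z ∈ x, ∃ σ s, s ∈ P.carrier ∧ z = pair σ s)
      (h₂ : ∀ σ s, pair σ s ∈ x → IsName σ) : IsName x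

theorem rank_lt_of_pair_mem {σ s a : ZFSet.{u}} (h : pair σ s ∈ a) : rank σ < rank a := by
  have h₁ : σ ∈ ({σ} : ZFSet.{u}) := by simp
  have h₂ : ({σ} : ZFSet.{u}) ∈ pair σ s := by simp [pair]
  exact (rank_lt_of_mem h₁).trans ((rank_lt_of_mem h₂).trans (rank_lt_of_mem h))

/-- `p ⊩ a = b` for names `a`, `b`. -/
def ForcesEq (a b p : ZFSet.{u}) : Prop :=
  (∀ σ s, (_h : pair σ s ∈ a) → ∀ q ∈ P.carrier, P.Le q p → P.Le q s →
    ∃ r ∈ P.carrier, P.Le r q ∧ ∃ τ t, pair τ t ∈ b ∧ P.Le r t ∧ ForcesEq σ τ r) ∧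
  (∀ τ t, pair τ t ∈ b → ∀ q ∈ P.carrier, P.Le q p → P.Le q t →
    ∃ r ∈ P.carrier, P.Le r q ∧ ∃ σ s, ∃ _h : pair σ s ∈ a, P.Le r s ∧ ForcesEq σ τ r)
termination_by rank a
decreasing_by all_goals exact rank_lt_of_pair_mem _h

/-- `p ⊩ a ∈ b` for names `a`, `b`. -/
def ForcesMem (a b p : ZFSet.{u}) : Prop :=
  P.DenseBelow p fun r => ∃ τ t, pair τ t ∈ b ∧ P.Le r t ∧ P.ForcesEq a τ r

/-- `p ⊩ a ⊆ b`, that is, `p ⊩ ∀ x (x ∈ a → x ∈ b)`. -/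
def ForcesSubset (a b p : ZFSet.{u}) : Prop :=
  ∀ x, P.IsName x → ∀ q ∈ P.carrier, P.Le q p → P.ForcesMem x a q → P.ForcesMem x b q

/-- The canonical name `x̌ = {(y̌, 1) : y ∈ x}` of `x`. -/
def check (x : ZFSet.{u}) : ZFSet.{u} :=
  range fun y : {y : ZFSet.{u} // y ∈ x} => pair (check y.val) P.one
termination_by rank x
decreasing_by exact rank_lt_of_mem y.property

/-- `p ⊩ f(x̌) = v`, that is, `p` forces the pair `(x, v)` to belong to `f`; here `v ∈ 2`. -/
def ForcesValue (f x : ZFSet.{u}) (v : Bool) (p : ZFSet.{u}) : Prop :=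
  P.ForcesMem (P.check (pair x (bit v))) f p

/-- `p ⊩ "f is a function from Ǎ to 2"`. -/
def ForcesFun (A f p : ZFSet.{u}) : Prop :=
  P.ForcesSubset f (P.check (timesTwo A)) p ∧
  (∀ x ∈ A, P.DenseBelow p fun r => ∃ v, P.ForcesValue f x v r) ∧
  (∀ x ∈ A, ∀ q ∈ P.carrier, P.Le q p → ¬ (P.ForcesValue f x false q ∧ P.ForcesValue f x true q))

/-- `p ⊩ "σ is a condition of Q_{C,F,g}"` for names `σ` and `g`: it is forced that `σ` is a
function from some `δ < ω₁` to `2` such that for all `η ∈ (δ + 1) ∩ Ω` the sequence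
`⟨σ(C_η(n)) : n < ω⟩` is an element `y` of `dom(F)` with `F(y) = g(η)`.
The parameters `C` and `F` are the ground model objects, so `δ`, `η` and `y` range over elements of
the ground model. -/
def ForcesCond (C : Ordinal.{u} → ℕ → Ordinal.{u}) (F : (ℕ → Bool) → Option Bool)
    (g σ p : ZFSet.{u}) : Prop :=
  P.DenseBelow p fun r => ∃ δ < ω₁, P.ForcesFun (toZFSet δ) σ r ∧
    ∀ η ∈ Lim, η ≤ δ → P.DenseBelow r fun r' => ∃ y v, F y = some v ∧
      (∀ n, P.ForcesValue σ (toZFSet (C η n)) (y n) r') ∧ P.ForcesValue g (toZFSet η) v r'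

end ForcingNotion

/-! ### The iterations -/

/-- A sequence `⟨P_α, Q_β, g_β, h_β : α ≤ len, β < len⟩`; other indices are irrelevant. -/
structure IterSeq where
  len : Ordinal.{u}
  P : Ordinal.{u} → ForcingNotion.{u}
  Q : Ordinal.{u} → ZFSet.{u}
  g : Ordinal.{u} → ZFSet.{u}
  h : Ordinal.{u} → ZFSet.{u}

/-- The sequence as a set. -/
def IterSeq.code (q : IterSeq.{u}) : ZFSet.{u} :=
  pair (seqCode (Order.succ q.len) fun α => (q.P α).code)
    (pair (seqCode q.len q.Q) (pair (seqCode q.len q.g) (seqCode q.len q.h)))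

/-- `|q|`, the cardinality of (the transitive closure of) `q`. -/
def IterSeq.size (q : IterSeq.{u}) : Cardinal.{u} := card (trcl q.code)

/-- `q` belongs to the class of countable support iterations of the forcing notions
`Q_{C,F,g_β}`. -/
structure IsIteration (C : Ordinal.{u} → ℕ → Ordinal.{u}) (F : (ℕ → Bool) → Option Bool)
    (q : IterSeq.{u}) : Prop where
  /-- The conditions of `P_α` are the functions `r` on `α` such that, for each `β < α`,
  `r ↾ β ∈ P_β`, `r(β)` is in the domain of the name `Q_β`, and `r ↾ β ⊩ r(β) ∈ Q_β`,
  and `r(β) = ∅` for all but countably many `β`; the empty set is a name for the empty function,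
  the largest condition of `Q_β`. -/
  carrier_iff : ∀ α ≤ q.len, ∀ r, r ∈ (q.P α).carrier ↔
    ∃ f, r = seqCode α f ∧
      (∀ β < α, seqCode β f ∈ (q.P β).carrier ∧ (∃ s, pair (f β) s ∈ q.Q β) ∧
        (q.P β).ForcesMem (f β) (q.Q β) (seqCode β f)) ∧
      {β | β < α ∧ f β ≠ ∅}.Countable
  /-- `r ≤ s` in `P_α` if, for each `β < α`, `r ↾ β` forces that `r(β)` extends `s(β)`. -/
  rel_iff : ∀ α ≤ q.len, ∀ z, z ∈ (q.P α).rel ↔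
    ∃ f f', z = pair (seqCode α f) (seqCode α f') ∧
      seqCode α f ∈ (q.P α).carrier ∧ seqCode α f' ∈ (q.P α).carrier ∧
      ∀ β < α, (q.P β).ForcesSubset (f' β) (f β) (seqCode β f)
  one_eq : ∀ α ≤ q.len, (q.P α).one = seqCode α fun _ => ∅
  /-- `g_β` is a `P_β`-name for a function from `Ω` to `2`. -/
  g_name : ∀ β < q.len, (q.P β).IsName (q.g β)
  g_fun : ∀ β < q.len, ∀ p ∈ (q.P β).carrier, (q.P β).ForcesFun limCode (q.g β) p
  /-- `Q_β` is a `P_β`-name for `Q_{C,F,g_β}`, whose largest element is the empty function. -/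
  Q_name : ∀ β < q.len, (q.P β).IsName (q.Q β)
  Q_one : ∀ β < q.len, pair ∅ (q.P β).one ∈ q.Q β
  Q_eq : ∀ β < q.len, ∀ σ, (q.P β).IsName σ → ∀ p ∈ (q.P β).carrier,
    ((q.P β).ForcesMem σ (q.Q β) p ↔ (q.P β).ForcesCond C F (q.g β) σ p)
  /-- `h_β` is a `P_{β+1}`-name for the generic function of `Q_β`, the union of the realizations of
  all `r(β)` with `r` in the generic filter. -/
  h_name : ∀ β < q.len, (q.P (Order.succ β)).IsName (q.h β)
  h_subset : ∀ β < q.len, ∀ p ∈ (q.P (Order.succ β)).carrier,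
    (q.P (Order.succ β)).ForcesSubset (q.h β)
      ((q.P (Order.succ β)).check (timesTwo (toZFSet ω₁))) p
  h_eq : ∀ β < q.len, ∀ ξ < ω₁, ∀ v, ∀ p ∈ (q.P (Order.succ β)).carrier,
    ((q.P (Order.succ β)).ForcesValue (q.h β) (toZFSet ξ) v p ↔
      (q.P (Order.succ β)).DenseBelow p fun r => ∃ f, r = seqCode (Order.succ β) f ∧
        (q.P β).ForcesValue (f β) (toZFSet ξ) v (seqCode β f))

/-! ### Suitable data sequences -/

/-- The objects `⟨C, F, q, p, X, ⟨Y_k⟩, ⟨i_k⟩, ⟨D_k⟩⟩`. -/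
structure DataSeq where
  C : Ordinal.{u} → ℕ → Ordinal.{u}
  F : (ℕ → Bool) → Option Bool
  q : IterSeq.{u}
  p : ZFSet.{u}
  X : ZFSet.{u}
  Y : ℕ → ZFSet.{u}
  i : ℕ → Ordinal.{u}
  D : ℕ → ZFSet.{u}

namespace DataSeq

variable (S : DataSeq.{u})

/-- The last forcing notion `P_{α_*}` of the iteration. -/
def poset : ForcingNotion.{u} := S.q.P S.q.len

/-- `(2^{|q|})⁺`. -/
def χ₁ : Cardinal.{u} := Order.succ (2 ^ S.q.size)

/-- `(2^{2^{|q|}})⁺`. -/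
def χ₂ : Cardinal.{u} := Order.succ (2 ^ ((2 : Cardinal.{u}) ^ S.q.size))

/-- `γ = X ∩ ω₁`: the least ordinal not in `X ∩ ω₁`, which is `X ∩ ω₁` since that set is an
ordinal. -/
def γ : Ordinal.{u} := sInf {ξ | ¬ (ξ < ω₁ ∧ toZFSet ξ ∈ S.X)}

/-- The increasing enumeration `⟨α_i : i < i_*⟩` of `X ∩ α_*`, continued past `i_*` by the ordinals
from `α_*` on. Thus `i < i_*` if and only if `α_i < α_*`. -/
def α (i : Ordinal.{u}) : Ordinal.{u} :=
  enumOrd {ξ | toZFSet ξ ∈ S.X ∨ S.q.len ≤ ξ} i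

/-- `m_k = |C_γ ∩ Y_k|`. -/
def m (k : ℕ) : ℕ := {n | toZFSet (S.C S.γ n) ∈ S.Y k}.ncard

/-- `u_k = {i_n : n < k, α_{i_n} ∈ Y_k}`. -/
def uSet (k : ℕ) : Set Ordinal.{u} := {j | ∃ n < k, j = S.i n ∧ toZFSet (S.α (S.i n)) ∈ S.Y k}

/-- `S` is a suitable data sequence. -/
structure IsSuitable : Prop where
  ladder : IsLadderSystem S.C
  dense : IsDenseFunction S.F
  iteration : IsIteration S.C S.F S.q
  p_mem : S.p ∈ S.poset.carrier
  X_elem : IsElemSub S.X S.χ₂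
  X_countable : (S.X : Set ZFSet.{u}).Countable
  C_mem_X : ladderCode S.C ∈ S.X
  F_mem_X : denseCode S.F ∈ S.X
  q_mem_X : S.q.code ∈ S.X
  p_mem_X : S.p ∈ S.X
  Y_chain : ∀ k, S.Y k ∈ S.Y (k + 1)
  Y_elem : ∀ k, IsElemSub (S.Y k) S.χ₁
  Y_countable : ∀ k, (S.Y k : Set ZFSet.{u}).Countable
  C_mem_Y : ladderCode S.C ∈ S.Y 0
  F_mem_Y : denseCode S.F ∈ S.Y 0
  p_mem_Y : S.p ∈ S.Y 0
  Y_union : ∀ x, (x ∈ S.X ∧ x ∈ HSet S.χ₁) ↔ ∃ k, x ∈ S.Y k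
  Y_ladder : ∀ k, ∃ n, toZFSet (S.C S.γ n) ∈ S.Y (k + 1) ∧ toZFSet (S.C S.γ n) ∉ S.Y k
  /-- `⟨i_k : k ∈ ω⟩` lists `i_*`, the order type of `X ∩ α_*`, without repetition. -/
  i_injective : Function.Injective S.i
  i_lists : ∀ j, (∃ k, S.i k = j) ↔ S.α j < S.q.len
  i_mem_Y : ∀ k, toZFSet (S.α (S.i k)) ∈ S.Y k
  /-- `⟨D_k : k ∈ ω⟩` lists the dense open subsets of `P_{α_*}` in `X`. -/
  D_lists : ∀ d, (∃ k, S.D k = d) ↔ (d ∈ S.X ∧ S.poset.IsDenseOpen d)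
  D_mem_Y : ∀ k, S.D k ∈ S.Y k

/-! ### Condition trees -/

/-- Finite sequences `ρ = ⟨s_ℓ : ℓ < |ρ|⟩` where `s_ℓ` is a function from `u_ℓ` to `2^{m_ℓ}`. -/
def Node : Type (u + 1) := Σ n : ℕ, ∀ ℓ : Fin n, S.uSet ℓ → Fin (S.m ℓ) → Bool

namespace Node

variable {S}

/-- The length `|ρ|`. -/
def length (ρ : S.Node) : ℕ := ρ.1

/-- The function `s^ρ_ℓ : u_ℓ → 2^{m_ℓ}`, for `ℓ < |ρ|`. -/
def s (ρ : S.Node) (ℓ : ℕ) (h : ℓ < ρ.length) : S.uSet ℓ → Fin (S.m ℓ) → Bool := ρ.2 ⟨ℓ, h⟩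

/-- `ρ₁` is an initial segment of `ρ₂`. -/
def IsInitial (ρ₁ ρ₂ : S.Node) : Prop :=
  ρ₁.length ≤ ρ₂.length ∧
    ∀ ℓ (h₁ : ℓ < ρ₁.length) (h₂ : ℓ < ρ₂.length), ρ₁.s ℓ h₁ = ρ₂.s ℓ h₂

end Node

/-- The finite sequence `s ∈ 2^a` is an initial segment of `t ∈ 2^b`. -/
def InitSeg {a b : ℕ} (s : Fin a → Bool) (t : Fin b → Bool) : Prop :=
  a ≤ b ∧ ∀ n (h : n < a) (h' : n < b), s ⟨n, h⟩ = t ⟨n, h'⟩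

/-- `(T, ⟨p_ρ : ρ ∈ T⟩)` is a condition tree for `S`; the values of `pc` outside `T` are
irrelevant. -/
structure IsConditionTree (T : Set S.Node) (pc : S.Node → ZFSet.{u}) : Prop where
  /-- `T` is a finitely branching tree of finite sequences with a unique node of length `1`. -/
  nonempty : T.Nonempty
  closed : ∀ ρ ∈ T, ∀ ρ' : S.Node, ρ'.IsInitial ρ → ρ' ∈ T
  branching : ∀ ρ ∈ T, {ρ' ∈ T | ρ.IsInitial ρ' ∧ ρ'.length = ρ.length + 1}.Finite
  root : ∃! ρ, ρ ∈ T ∧ ρ.length = 1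
  /-- `s^ρ_ℓ(j)` is an initial segment of `s^ρ_{ℓ+1}(j)` for `j ∈ u_ℓ`. -/
  coherent : ∀ ρ ∈ T, ∀ ℓ (h : ℓ + 1 < ρ.length) (j) (hj : j ∈ S.uSet ℓ),
    ∃ hj' : j ∈ S.uSet (ℓ + 1),
      InitSeg (ρ.s ℓ (Nat.lt_of_succ_lt h) ⟨j, hj⟩) (ρ.s (ℓ + 1) h ⟨j, hj'⟩)
  /-- Each `s : u_k → 2^{m_{k+1}}` that extends `s^ρ_k` pointwise is realized by exactly one
  successor of `ρ`. -/
  splitting : ∀ ρ ∈ T, ∀ k (hk : ρ.length = k + 1) (s : S.uSet k → Fin (S.m (k + 1)) → Bool),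
    (∀ j, InitSeg (ρ.s k (hk ▸ Nat.lt_succ_self k) j) (s j)) →
    ∃! ρ' : S.Node, ρ' ∈ T ∧ ρ.IsInitial ρ' ∧ ∃ hk' : ρ'.length = k + 2,
      ∀ (j) (hj : j ∈ S.uSet k), ∃ hj' : j ∈ S.uSet (k + 1),
        ρ'.s (k + 1) (hk' ▸ Nat.lt_succ_self (k + 1)) ⟨j, hj'⟩ = s ⟨j, hj⟩
  root_cond : ∀ ρ ∈ T, ρ.length = 0 → pc ρ = S.p
  cond_mem : ∀ ρ ∈ T, ∀ k, ρ.length = k + 1 → pc ρ ∈ S.D k ∧ pc ρ ∈ S.Y k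
  antitone : ∀ ρ₁ ∈ T, ∀ ρ₂ ∈ T, ρ₁.IsInitial ρ₂ → S.poset.Le (pc ρ₂) (pc ρ₁)
  /-- `p_ρ ↾ (α_j + 1)` forces `h_{α_j}(C_γ(n)) = s^ρ_k(j)(n)` for all `n < m_k`. -/
  decides : ∀ ρ ∈ T, ∀ k (hk : ρ.length = k + 1) (j) (hj : j ∈ S.uSet k) (n : Fin (S.m k)),
    (S.q.P (Order.succ (S.α j))).ForcesValue (S.q.h (S.α j)) (toZFSet (S.C S.γ n))
      (ρ.s k (hk ▸ Nat.lt_succ_self k) ⟨j, hj⟩ n) (restrict (pc ρ) (Order.succ (S.α j)))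
  /-- If `j < i_*` and `ρ₁`, `ρ₂` have the same length and agree at all `i` with `α_i ≤ α_j`, then
  `p_{ρ₁} ↾ α_j = p_{ρ₂} ↾ α_j`. -/
  agree : ∀ j, S.α j < S.q.len → ∀ ρ₁ ∈ T, ∀ ρ₂ ∈ T, ρ₁.length = ρ₂.length →
    (∀ ℓ (h₁ : ℓ < ρ₁.length) (h₂ : ℓ < ρ₂.length) (i) (hi : i ∈ S.uSet ℓ), S.α i ≤ S.α j →
      ρ₁.s ℓ h₁ ⟨i, hi⟩ = ρ₂.s ℓ h₂ ⟨i, hi⟩) →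
    restrict (pc ρ₁) (S.α j) = restrict (pc ρ₂) (S.α j)

end DataSeq

end CondTree

end

/-! The tree is built level by level, and the difficulty is the passage from level k to level k + 1.
A condition p_ρ ∈ Y_k has, at each coordinate α_j with j ∈ u_k, a domain bounded by a countable
ordinal, which by elementarity can be taken in Y_k. The points C_γ(n) with m_k ≤ n < m_{k+1} are
outside Y_k, hence at or above that bound, so p_ρ says nothing about them; at the points with n <
m_k it has already decided the values s^ρ_k. Therefore every s extending s^ρ_k is compatible with
p_ρ. Three ingredients turn this into a proof.

Extension at one coordinate (`exists_extension_name`): a condition of Q of length δ can be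
lengthened with finitely many values prescribed above δ. The ladders of the limits in (δ, δ'] meet
each other in finite sets, so they have pairwise disjoint tails, and density of F supplies a real to
be copied along each tail. The values of g are not known in the ground model, but each new value,
and even the whole new sequence along one ladder, depends on finitely many values of g and of the
old condition. So a name can be written down, and finitely many decisions put each new ladder
sequence into the ground model. `exists_val` lifts this to the iteration, and `exists_val_finset`
treats finitely many coordinates from the smallest to the largest.

Coherence (`exists_propagate`, `exists_family`): the finitely many conditions of a level must
satisfy clause 8. When one of them is extended, the extension is copied to each other one up to the
first coordinate at which the prescribed values of the two differ. The prescriptions agree at the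
copied coordinates, so nothing already achieved is lost, and the conditions can be treated one at a
time.

Reflection (`exists_reflect`): the new conditions must lie in Y_{k+1}. They form a finite tuple, but
the iteration q is not assumed to be in Y_0, so its forcing relation is not directly available as a
parameter. Instead the order and the forcing of equalities x̌ = τ are coded by sets satisfying a
recursion whose parameters are D_0, p, ω₁ × 2 and the length of q, all in Y_0. Such sets exist in
H(χ₁) (`exists_isCode`) and any such sets are correct (`codeAt`); elementarity gives some in Y_0,
and with their help all requirements on the tuple become first-order over Y_{k+1}. -/

namespace CondTree

open ZFSet Ordinal Cardinal

/-! ### The forcing relation over a preorder with a largest element -/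

namespace ForcingNotion

/-- The relation of `P` is a preorder on the carrier with largest element `P.one`. -/
structure IsPreorder (P : ForcingNotion.{u}) : Prop where
  refl : ∀ p ∈ P.carrier, P.Le p p
  trans : ∀ p q r, P.Le p q → P.Le q r → P.Le p r
  left : ∀ p q, P.Le p q → p ∈ P.carrier
  right : ∀ p q, P.Le p q → q ∈ P.carrier
  one_mem : P.one ∈ P.carrier
  le_one : ∀ p ∈ P.carrier, P.Le p P.one

variable {P : ForcingNotion.{u}}

theorem DenseBelow.mono {p q : ZFSet.{u}} {φ : ZFSet.{u} → Prop} (hP : P.IsPreorder)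
    (h : P.DenseBelow p φ) (hq : P.Le q p) : P.DenseBelow q φ :=
  fun r hr hrq => h r hr (hP.trans _ _ _ hrq hq)

theorem DenseBelow.imp {p : ZFSet.{u}} {φ ψ : ZFSet.{u} → Prop} (hP : P.IsPreorder)
    (h : P.DenseBelow p φ) (hi : ∀ q, P.Le q p → φ q → ψ q) : P.DenseBelow p ψ := by
  intro q hq hqp
  obtain ⟨r, hr, hrq, hφ⟩ := h q hq hqp
  exact ⟨r, hr, hrq, hi r (hP.trans _ _ _ hrq hqp) hφ⟩

theorem DenseBelow.of_forall {p : ZFSet.{u}} {φ : ZFSet.{u} → Prop} (hP : P.IsPreorder)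
    (h : ∀ q, P.Le q p → φ q) : P.DenseBelow p φ :=
  fun q hq hqp => ⟨q, hq, hP.refl q hq, h q hqp⟩

theorem DenseBelow.bind {p : ZFSet.{u}} {φ ψ : ZFSet.{u} → Prop} (hP : P.IsPreorder)
    (h : P.DenseBelow p φ) (hi : ∀ q, P.Le q p → φ q → P.DenseBelow q ψ) :
    P.DenseBelow p ψ := by
  intro q hq hqp
  obtain ⟨r, hr, hrq, hφ⟩ := h q hq hqp
  obtain ⟨s, hs, hsr, hψ⟩ := hi r (hP.trans _ _ _ hrq hqp) hφ r hr (hP.refl r hr)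
  exact ⟨s, hs, hP.trans _ _ _ hsr hrq, hψ⟩

theorem ForcesEq.mono {a b p q : ZFSet.{u}} (hP : P.IsPreorder) (h : P.ForcesEq a b p)
    (hq : P.Le q p) : P.ForcesEq a b q := by
  rw [ForcesEq] at h ⊢
  exact ⟨fun σ s hσ r hr hrq => h.1 σ s hσ r hr (hP.trans _ _ _ hrq hq),
    fun σ s hσ r hr hrq => h.2 σ s hσ r hr (hP.trans _ _ _ hrq hq)⟩

theorem ForcesEq.refl (hP : P.IsPreorder) (a p : ZFSet.{u}) : P.ForcesEq a a p := by
  induction hn : rank a using WellFoundedLT.induction generalizing a p with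
  | ind n ih =>
    subst hn
    rw [ForcesEq]
    refine ⟨fun σ s hσ q hq _ hqs => ⟨q, hq, hP.refl q hq, σ, s, hσ, hqs, ?_⟩,
      fun σ s hσ q hq _ hqs => ⟨q, hq, hP.refl q hq, σ, s, hσ, hqs, ?_⟩⟩ <;>
    exact ih _ (rank_lt_of_pair_mem hσ) _ _ rfl

theorem ForcesEq.symm {a b p : ZFSet.{u}} (h : P.ForcesEq a b p) : P.ForcesEq b a p := by
  induction hn : rank a using WellFoundedLT.induction generalizing a b p with
  | ind n ih =>
    subst hn
    rw [ForcesEq] at h ⊢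
    constructor
    · intro τ t ht q hq hqp hqt
      obtain ⟨r, hr, hrq, σ, s, hs, hrs, he⟩ := h.2 τ t ht q hq hqp hqt
      exact ⟨r, hr, hrq, σ, s, hs, hrs, ih _ (rank_lt_of_pair_mem hs) he rfl⟩
    · intro σ s hs q hq hqp hqs
      obtain ⟨r, hr, hrq, τ, t, ht, hrt, he⟩ := h.1 σ s hs q hq hqp hqs
      exact ⟨r, hr, hrq, τ, t, ht, hrt, ih _ (rank_lt_of_pair_mem hs) he rfl⟩

theorem ForcesEq.trans (hP : P.IsPreorder) {a b c p : ZFSet.{u}} (h₁ : P.ForcesEq a b p)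
    (h₂ : P.ForcesEq b c p) : P.ForcesEq a c p := by
  induction hn : rank a using WellFoundedLT.induction generalizing a b c p with
  | ind n ih =>
    subst hn
    rw [ForcesEq] at h₁ h₂ ⊢
    constructor
    · intro σ s hs q hq hqp hqs
      obtain ⟨r, hr, hrq, τ, t, ht, hrt, he⟩ := h₁.1 σ s hs q hq hqp hqs
      obtain ⟨r', hr', hrr, τ', t', ht', hrt', he'⟩ :=
        h₂.1 τ t ht r hr (hP.trans _ _ _ hrq hqp) hrt
      exact ⟨r', hr', hP.trans _ _ _ hrr hrq, τ', t', ht', hrt',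
        ih _ (rank_lt_of_pair_mem hs) (he.mono hP hrr) he' rfl⟩
    · intro τ t ht q hq hqp hqt
      obtain ⟨r, hr, hrq, σ, s, hs, hrs, he⟩ := h₂.2 τ t ht q hq hqp hqt
      obtain ⟨r', hr', hrr, σ', s', hs', hrs', he'⟩ :=
        h₁.2 σ s hs r hr (hP.trans _ _ _ hrq hqp) hrs
      exact ⟨r', hr', hP.trans _ _ _ hrr hrq, σ', s', hs', hrs',
        ih _ (rank_lt_of_pair_mem hs') he' (he.mono hP hrr) rfl⟩

theorem ForcesMem.mono {a b p q : ZFSet.{u}} (hP : P.IsPreorder) (h : P.ForcesMem a b p)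
    (hq : P.Le q p) : P.ForcesMem a b q :=
  DenseBelow.mono hP h hq

theorem ForcesMem.of_dense {a b p : ZFSet.{u}} (hP : P.IsPreorder)
    (h : P.DenseBelow p (P.ForcesMem a b)) : P.ForcesMem a b p :=
  DenseBelow.bind hP h fun _ _ h => h

theorem ForcesMem.of_mem {a b t p : ZFSet.{u}} (hP : P.IsPreorder) (h : pair a t ∈ b)
    (hp : P.Le p t) : P.ForcesMem a b p :=
  DenseBelow.of_forall hP fun _ hq => ⟨a, t, h, hP.trans _ _ _ hq hp, ForcesEq.refl hP _ _⟩

theorem ForcesMem.congr_left {a a' b p : ZFSet.{u}} (hP : P.IsPreorder) (h : P.ForcesMem a b p)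
    (he : P.ForcesEq a a' p) : P.ForcesMem a' b p :=
  DenseBelow.imp hP h fun _ hq ⟨τ, t, ht, hqt, hτ⟩ =>
    ⟨τ, t, ht, hqt, (he.mono hP hq).symm.trans hP hτ⟩

theorem ForcesMem.congr_right {a b b' p : ZFSet.{u}} (hP : P.IsPreorder) (h : P.ForcesMem a b p)
    (he : P.ForcesEq b b' p) : P.ForcesMem a b' p := by
  refine DenseBelow.bind hP h fun q hq ⟨τ, t, ht, hqt, hτ⟩ => ?_
  intro r hr hrq
  rw [ForcesEq] at he
  obtain ⟨r', hr', hrr, τ', t', ht', hrt, he'⟩ :=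
    he.1 τ t ht r hr (hP.trans _ _ _ hrq hq) (hP.trans _ _ _ hrq hqt)
  exact ⟨r', hr', hrr, τ', t', ht', hrt, (hτ.mono hP (hP.trans _ _ _ hrr hrq)).trans hP he'⟩

theorem ForcesSubset.mono {a b p q : ZFSet.{u}} (hP : P.IsPreorder) (h : P.ForcesSubset a b p)
    (hq : P.Le q p) : P.ForcesSubset a b q :=
  fun x hx r hr hrq => h x hx r hr (hP.trans _ _ _ hrq hq)

theorem ForcesSubset.refl (a p : ZFSet.{u}) : P.ForcesSubset a a p :=
  fun _ _ _ _ _ h => h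

theorem ForcesSubset.trans {a b c p : ZFSet.{u}} (h₁ : P.ForcesSubset a b p)
    (h₂ : P.ForcesSubset b c p) : P.ForcesSubset a c p :=
  fun x hx q hq hqp h => h₂ x hx q hq hqp (h₁ x hx q hq hqp h)

theorem ForcesEq.subset {a b p : ZFSet.{u}} (hP : P.IsPreorder) (h : P.ForcesEq a b p) :
    P.ForcesSubset a b p :=
  fun _ _ _ _ hqp hx => hx.congr_right hP (h.mono hP hqp)

theorem forcesSubset_empty (hP : P.IsPreorder) (a p : ZFSet.{u}) : P.ForcesSubset ∅ a p := by
  intro x _ q hq _ h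
  obtain ⟨r, _, _, τ, t, ht, _⟩ := h q hq (hP.refl q hq)
  exact absurd ht (notMem_empty _)

theorem mem_check {x z : ZFSet.{u}} : z ∈ P.check x ↔ ∃ y ∈ x, z = pair (P.check y) P.one := by
  rw [check]
  simp only [mem_range, Subtype.exists, exists_prop, eq_comm]

theorem isName_check (hP : P.IsPreorder) (x : ZFSet.{u}) : P.IsName (P.check x) := by
  induction x using ZFSet.inductionOn with
  | h x ih =>
    refine .mk _ (fun z hz => ?_) fun σ s h => ?_
    · obtain ⟨y, _, rfl⟩ := mem_check.1 hz
      exact ⟨_, _, hP.one_mem, rfl⟩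
    · obtain ⟨y, hy, h⟩ := mem_check.1 h
      rw [(pair_inj.1 h).1]
      exact ih y hy

theorem IsName.of_pair_mem {x σ s : ZFSet.{u}} (h : P.IsName x) (hs : pair σ s ∈ x) :
    P.IsName σ ∧ s ∈ P.carrier := by
  cases h with
  | mk _ h₁ h₂ =>
    refine ⟨h₂ _ _ hs, ?_⟩
    obtain ⟨σ', s', hs', he⟩ := h₁ _ hs
    rw [(pair_inj.1 he).2]
    exact hs'

/-- Both inclusions follow by ∈-induction. The induction runs over all conditions at once, since
matching elements are found only below an extension of `p`. -/
theorem check_inj (hP : P.IsPreorder) {x y p : ZFSet.{u}} (hp : p ∈ P.carrier)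
    (h : P.ForcesEq (P.check x) (P.check y) p) : x = y := by
  induction x using ZFSet.inductionOn generalizing y p with
  | h x ih =>
    rw [ForcesEq] at h
    ext z
    constructor
    · intro hz
      obtain ⟨r, hr, _, τ, t, ht, _, he⟩ :=
        h.1 _ _ (mem_check.2 ⟨z, hz, rfl⟩) p hp (hP.refl p hp) (hP.le_one p hp)
      obtain ⟨w, hw, hwe⟩ := mem_check.1 ht
      rw [(pair_inj.1 hwe).1] at he
      rwa [ih z hz hr he]
    · intro hz
      obtain ⟨r, hr, _, σ, s, hs, _, he⟩ :=
        h.2 _ _ (mem_check.2 ⟨z, hz, rfl⟩) p hp (hP.refl p hp) (hP.le_one p hp)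
      obtain ⟨w, hw, hwe⟩ := mem_check.1 hs
      rw [(pair_inj.1 hwe).1] at he
      rwa [← ih w hw hr he]

theorem forcesMem_check_iff (hP : P.IsPreorder) {x y p : ZFSet.{u}} :
    P.ForcesMem x (P.check y) p ↔ P.DenseBelow p fun r => ∃ z ∈ y, P.ForcesEq x (P.check z) r := by
  constructor
  · intro h
    refine DenseBelow.imp hP h fun q _ ⟨τ, t, ht, _, he⟩ => ?_
    obtain ⟨z, hz, hze⟩ := mem_check.1 ht
    rw [(pair_inj.1 hze).1] at he
    exact ⟨z, hz, he⟩
  · intro h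
    exact DenseBelow.imp hP h fun q hq ⟨z, hz, he⟩ =>
      ⟨_, _, mem_check.2 ⟨z, hz, rfl⟩, hP.le_one q (hP.left _ _ hq), he⟩

theorem check_mem_check (hP : P.IsPreorder) {x y p : ZFSet.{u}} (hp : p ∈ P.carrier)
    (h : P.ForcesMem (P.check x) (P.check y) p) : x ∈ y := by
  obtain ⟨r, hr, _, z, hz, he⟩ := (forcesMem_check_iff hP).1 h p hp (hP.refl p hp)
  rwa [check_inj hP hr he]

theorem ForcesValue.mono {f x p q : ZFSet.{u}} {v : Bool} (hP : P.IsPreorder)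
    (h : P.ForcesValue f x v p) (hq : P.Le q p) : P.ForcesValue f x v q :=
  ForcesMem.mono hP h hq

theorem ForcesValue.of_subset {f f' x p : ZFSet.{u}} {v : Bool} (hP : P.IsPreorder)
    (hp : p ∈ P.carrier) (h : P.ForcesValue f x v p) (hs : P.ForcesSubset f f' p) :
    P.ForcesValue f' x v p :=
  hs _ (isName_check hP _) p hp (hP.refl p hp) h

theorem ForcesFun.mono {A f p q : ZFSet.{u}} (hP : P.IsPreorder)
    (h : P.ForcesFun A f p) (hq : P.Le q p) : P.ForcesFun A f q :=
  ⟨h.1.mono hP hq, fun x hx => (h.2.1 x hx).mono hP hq,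
    fun x hx r hr hrq => h.2.2 x hx r hr (hP.trans _ _ _ hrq hq)⟩

theorem ForcesCond.mono {C : Ordinal.{u} → ℕ → Ordinal.{u}} {F : (ℕ → Bool) → Option Bool}
    {g σ p q : ZFSet.{u}} (hP : P.IsPreorder)
    (h : P.ForcesCond C F g σ p) (hq : P.Le q p) : P.ForcesCond C F g σ q :=
  DenseBelow.mono hP h hq

theorem bit_injective : Function.Injective bit.{u} := by
  have h : (∅ : ZFSet.{u}) ≠ {∅} := fun h => by
    have : (∅ : ZFSet.{u}) ∈ ({∅} : ZFSet.{u}) := by simp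
    rw [← h] at this
    exact notMem_empty _ this
  intro a b hab
  cases a <;> cases b <;> simp_all [bit, h.symm]

theorem mem_timesTwo {A z : ZFSet.{u}} : z ∈ timesTwo A ↔ ∃ x ∈ A, ∃ v, z = pair x (bit v) := by
  simp only [timesTwo, mem_prod, mem_pair, Bool.exists_bool, bit]
  simp

theorem ForcesFun.mem_of_forcesValue {A f p x : ZFSet.{u}} {v : Bool} (hP : P.IsPreorder)
    (hp : p ∈ P.carrier) (h : P.ForcesFun A f p) (hv : P.ForcesValue f x v p) : x ∈ A := by
  have := check_mem_check hP hp (h.1 _ (isName_check hP _) p hp (hP.refl p hp) hv)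
  obtain ⟨y, hy, w, he⟩ := mem_timesTwo.1 this
  rw [(pair_inj.1 he).1]
  exact hy

theorem ForcesFun.value_unique {A f p x : ZFSet.{u}} {v w : Bool} (hP : P.IsPreorder)
    (hp : p ∈ P.carrier) (h : P.ForcesFun A f p) (hv : P.ForcesValue f x v p)
    (hw : P.ForcesValue f x w p) : v = w := by
  have := h.2.2 x (h.mem_of_forcesValue hP hp hv) p hp (hP.refl p hp)
  cases v <;> cases w <;> simp_all

/-- Below a condition forcing `f` to be a function on `A`, inclusion is tested on values. -/
theorem ForcesFun.subset_of_values {A f f' p : ZFSet.{u}} (hP : P.IsPreorder)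
    (h : P.DenseBelow p fun r => ∃ B, B ⊆ A ∧ P.ForcesFun B f r)
    (hv : ∀ x ∈ A, ∀ v, ∀ q, P.Le q p → P.ForcesValue f x v q → P.ForcesValue f' x v q) :
    P.ForcesSubset f f' p := by
  intro x hx q hq hqp hxf
  refine .of_dense hP ?_
  refine (h.mono hP hqp).bind hP fun r hr ⟨B, hB, hf⟩ => ?_
  have hrc := hP.left _ _ hr
  have hxr := hxf.mono hP hr
  refine ((forcesMem_check_iff hP).1 (hf.1 x hx r hrc (hP.refl r hrc) hxr)).imp hP ?_
  rintro s hs ⟨z, hz, he⟩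
  obtain ⟨y, hy, v, rfl⟩ := mem_timesTwo.1 hz
  have h1 : P.ForcesValue f y v s := (hxr.mono hP hs).congr_left hP he
  exact ForcesMem.congr_left hP
    (hv y (hB hy) v s (hP.trans _ _ _ hs (hP.trans _ _ _ hr hqp)) h1) he.symm

end ForcingNotion

/-! ### Filling in values along the ladders -/

/-- Ladders have order type ω and are cofinal, so the ladder of the larger limit has only finitely
many points below the smaller limit. -/
theorem IsLadderSystem.finite_meet {C : Ordinal.{u} → ℕ → Ordinal.{u}} (hC : IsLadderSystem C)
    {η η' : Ordinal.{u}} (hη : η ∈ Lim) (hη' : η' ∈ Lim) (hne : η ≠ η') :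
    {n | C η n ∈ Set.range (C η')}.Finite := by
  obtain ⟨hmono, hlt, hcof⟩ := hC η hη
  obtain ⟨hmono', hlt', hcof'⟩ := hC η' hη'
  rcases lt_or_gt_of_ne hne with h | h
  · obtain ⟨N, hN⟩ := hcof' η h
    refine Set.Finite.subset
      (((Set.finite_Iio N).image (C η')).preimage hmono.injective.injOn) ?_
    rintro n ⟨k, hk⟩
    refine ⟨k, ?_, hk⟩
    by_contra hkN
    have h1 := hmono'.monotone (not_lt.1 hkN)
    rw [hk] at h1
    exact absurd (hlt n) (not_lt.2 (hN.le.trans h1))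
  · obtain ⟨N, hN⟩ := hcof η' h
    refine Set.Finite.subset (Set.finite_Iio N) ?_
    rintro n ⟨k, hk⟩
    by_contra hnN
    have h1 := hmono.monotone (not_lt.1 hnN)
    rw [← hk] at h1
    exact absurd (hlt' k) (not_lt.2 (hN.le.trans h1))

theorem countable_Iic_of_lt_omega_one {δ : Ordinal.{u}} (h : δ < ω₁) : (Set.Iic δ).Countable := by
  rw [← Order.Iio_succ, ← Cardinal.le_aleph0_iff_set_countable, Cardinal.mk_Iio_ordinal]
  have h1 : Order.succ δ < ω₁ := (isSuccLimit_omega 1).succ_lt h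
  rw [← Cardinal.ord_aleph, Cardinal.lt_ord, lt_aleph_one_iff] at h1
  exact Cardinal.lift_le_aleph0.2 h1

/-- There are tails of the ladders of the limit ordinals in `(δ, δ']` that are pairwise disjoint, lie
above `δ`, and avoid a given finite set. -/
theorem IsLadderSystem.exists_disjoint_tails {C : Ordinal.{u} → ℕ → Ordinal.{u}}
    (hC : IsLadderSystem C) (δ δ' : Ordinal.{u}) (hδ' : δ' < ω₁) (A : Finset Ordinal.{u}) :
    ∃ N : Ordinal.{u} → ℕ, ∀ η ∈ Lim, δ < η → η ≤ δ' → ∀ n ≥ N η, δ ≤ C η n ∧ C η n ∉ A ∧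
      ∀ η' ∈ Lim, δ < η' → η' ≤ δ' → ∀ n' ≥ N η', C η n = C η' n' → η = η' := by
  -- With the limits up to `δ'` numbered by ℕ, each ladder has to avoid only the finitely many
  -- ladders of smaller number, and it meets each of them in a finite set.
  obtain ⟨code, hcode⟩ := Set.countable_iff_exists_injOn.1 (countable_Iic_of_lt_omega_one hδ')
  have key : ∀ η : Ordinal.{u}, ∃ N : ℕ, η ∈ Lim → δ < η → η ≤ δ' → ∀ n ≥ N, δ ≤ C η n ∧
      C η n ∉ A ∧ ∀ η' ∈ Lim, η' ≤ δ' → code η' < code η → C η n ∉ Set.range (C η') := by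
    intro η
    by_cases hη : η ∈ Lim ∧ δ < η ∧ η ≤ δ'
    · obtain ⟨hη, h1, h2⟩ := hη
      obtain ⟨hmono, hlt, hcof⟩ := hC η hη
      have fin1 : {n | C η n < δ}.Finite := by
        obtain ⟨N, hN⟩ := hcof δ h1
        refine (Set.finite_Iio N).subset fun n hn => ?_
        by_contra hnN
        exact absurd hn (not_lt.2 (hN.le.trans (hmono.monotone (not_lt.1 hnN))))
      have fin2 : {n | C η n ∈ A}.Finite := A.finite_toSet.preimage hmono.injective.injOn
      have fin3 : (⋃ η' ∈ {η' | η' ∈ Lim ∧ η' ≤ δ' ∧ code η' < code η},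
          {n | C η n ∈ Set.range (C η')}).Finite := by
        refine Set.Finite.biUnion ?_ ?_
        · refine Set.Finite.of_finite_image (f := code) ((Set.finite_Iio (code η)).subset ?_) ?_
          · rintro _ ⟨η', ⟨_, _, h⟩, rfl⟩
            exact h
          · exact hcode.mono fun η' h => h.2.1
        · rintro η' ⟨h, _, hc⟩
          exact hC.finite_meet hη h fun he => by simp [he] at hc
      obtain ⟨N, hN⟩ := ((fin1.union fin2).union fin3).bddAbove
      refine ⟨N + 1, fun _ _ _ n hn => ?_⟩
      have hnot : n ∉ ({n | C η n < δ} ∪ {n | C η n ∈ A}) ∪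
          (⋃ η' ∈ {η' | η' ∈ Lim ∧ η' ≤ δ' ∧ code η' < code η},
            {n | C η n ∈ Set.range (C η')}) := fun h => by
        have := hN h
        omega
      refine ⟨not_lt.1 fun h => hnot (.inl (.inl h)), fun h => hnot (.inl (.inr h)), ?_⟩
      intro η' h h' hc hr
      exact hnot (.inr (Set.mem_biUnion (x := η') ⟨h, h', hc⟩ hr))
    · exact ⟨0, fun h h1 h2 => absurd ⟨h, h1, h2⟩ hη⟩
  choose N hN using key
  refine ⟨N, fun η hη h1 h2 n hn => ?_⟩
  obtain ⟨ha, hb, hc⟩ := hN η hη h1 h2 n hn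
  refine ⟨ha, hb, fun η' hη' h1' h2' n' hn' he => ?_⟩
  rcases lt_trichotomy (code η) (code η') with h | h | h
  · exact absurd ⟨n, he⟩ ((hN η' hη' h1' h2' n' hn').2.2 η hη h2 h)
  · exact hcode h2 h2' h
  · exact absurd ⟨n', he.symm⟩ (hc η' hη' h2' h)

/-- The points of the `η`-th ladder from the `N η`-th on are handled by a real `X s (G η)` whose
initial segment `s` is read off from the values at the earlier points of the ladder. -/
noncomputable def ladderFill (C : Ordinal.{u} → ℕ → Ordinal.{u}) (δ δ' : Ordinal.{u})
    (A : Finset Ordinal.{u}) (a : Ordinal.{u} → Bool) (N : Ordinal.{u} → ℕ)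
    (X : List Bool → Bool → ℕ → Bool) (G R : Ordinal.{u} → Bool) (ξ : Ordinal.{u}) : Bool :=
  open Classical in
  if ξ < δ then R ξ else if ξ ∈ A then a ξ else
    -- That earlier ladder points lie below `ξ` is automatic for a ladder system; it is included
    -- because termination of the recursive calls needs it.
    if h : ∃ z : Ordinal.{u} × ℕ, z.1 ∈ Lim ∧ δ < z.1 ∧ z.1 ≤ δ' ∧ N z.1 ≤ z.2 ∧ C z.1 z.2 = ξ ∧
        ∀ i < z.2, C z.1 i < ξ then
      X (List.ofFn fun i : Fin (N h.choose.1) =>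
        ladderFill C δ δ' A a N X G R (C h.choose.1 i)) (G h.choose.1) h.choose.2
    else false
termination_by ξ
decreasing_by
  exact h.choose_spec.2.2.2.2.2 i (i.2.trans_le h.choose_spec.2.2.2.1)

/-- `(G, R)` and `(G', R')` agree on `S`. -/
def AgreeOn (δ : Ordinal.{u}) (S : Finset Ordinal.{u}) (G R G' R' : Ordinal.{u} → Bool) : Prop :=
  (∀ η ∈ S, η ∈ Lim → G η = G' η) ∧ ∀ ζ ∈ S, ζ < δ → R ζ = R' ζ

theorem AgreeOn.mono {δ : Ordinal.{u}} {S T : Finset Ordinal.{u}} {G R G' R' : Ordinal.{u} → Bool}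
    (h : AgreeOn δ S G R G' R') (hT : T ⊆ S) : AgreeOn δ T G R G' R' :=
  ⟨fun η hη => h.1 η (hT hη), fun η hη => h.2 η (hT hη)⟩

/-- Values on an ordinal `δ'` can be found, each depending on finitely many values of `G` and `R`,
that extend `R` on `δ`, have prescribed values at finitely many places above `δ`, and are mapped by
`F` along the ladders to the values of `G`. -/
theorem exists_ladder_fill {C : Ordinal.{u} → ℕ → Ordinal.{u}} {F : (ℕ → Bool) → Option Bool}
    (hC : IsLadderSystem C) (hF : IsDenseFunction F) (δ δ' : Ordinal.{u}) (hδ' : δ' < ω₁)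
    (A : Finset Ordinal.{u}) (a : Ordinal.{u} → Bool) :
    ∃ e : (Ordinal.{u} → Bool) → (Ordinal.{u} → Bool) → Ordinal.{u} → Bool,
      (∀ G R, ∀ ξ < δ, e G R ξ = R ξ) ∧ (∀ G R, ∀ ξ ∈ A, δ ≤ ξ → e G R ξ = a ξ) ∧
      (∀ G R, ∀ η ∈ Lim, δ < η → η ≤ δ' → F (fun n => e G R (C η n)) = some (G η)) ∧
      (∀ ξ, ∃ S, ∀ G R G' R', AgreeOn δ S G R G' R' → e G R ξ = e G' R' ξ) ∧
      (∀ η ∈ Lim, δ < η → η ≤ δ' → ∃ S, ∀ G R G' R', AgreeOn δ S G R G' R' →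
        ∀ n, e G R (C η n) = e G' R' (C η n)) := by
  classical
  obtain ⟨N, hN⟩ := hC.exists_disjoint_tails δ δ' hδ' A
  -- `X s b` is a real that extends `s` and is mapped to `b` by `F`.
  choose X hX hXF using hF
  set e := ladderFill C δ δ' A a N X with he
  -- Disjointness of the tails forces the pair chosen in `ladderFill` at `C η n` to be `(η, n)`
  -- itself.
  have tail : ∀ G R, ∀ η ∈ Lim, δ < η → η ≤ δ' → ∀ n ≥ N η,
      e G R (C η n) = X (List.ofFn fun i : Fin (N η) => e G R (C η i)) (G η) n := by
    intro G R η hη h1 h2 n hn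
    obtain ⟨ha, hb, hc⟩ := hN η hη h1 h2 n hn
    have hex : ∃ z : Ordinal.{u} × ℕ, z.1 ∈ Lim ∧ δ < z.1 ∧ z.1 ≤ δ' ∧ N z.1 ≤ z.2 ∧
        C z.1 z.2 = C η n ∧ ∀ i < z.2, C z.1 i < C η n :=
      ⟨(η, n), hη, h1, h2, hn, rfl, fun i hi => (hC η hη).1 hi⟩
    rw [he, ladderFill, if_neg (not_lt.2 ha), if_neg hb, dif_pos hex]
    obtain ⟨s1, s2, s3, s4, s5, s6⟩ := hex.choose_spec
    generalize hex.choose = z at *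
    obtain ⟨η', n'⟩ := z
    obtain rfl : η = η' := hc η' s1 s2 s3 n' s4 s5.symm
    obtain rfl : n' = n := (hC η hη).1.injective s5
    rfl
  have supp : ∀ ξ, ∃ S, ∀ G R G' R', AgreeOn δ S G R G' R' → e G R ξ = e G' R' ξ := by
    intro ξ
    induction ξ using WellFoundedLT.induction with
    | ind ξ ih =>
      by_cases h1 : ξ < δ
      · refine ⟨{ξ}, fun G R G' R' h => ?_⟩
        rw [he, ladderFill, ladderFill, if_pos h1, if_pos h1]
        exact h.2 ξ (Finset.mem_singleton_self _) h1
      by_cases h2 : ξ ∈ A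
      · refine ⟨∅, fun G R G' R' h => ?_⟩
        rw [he, ladderFill, ladderFill, if_neg h1, if_neg h1, if_pos h2, if_pos h2]
      by_cases h3 : ∃ z : Ordinal.{u} × ℕ, z.1 ∈ Lim ∧ δ < z.1 ∧ z.1 ≤ δ' ∧ N z.1 ≤ z.2 ∧
          C z.1 z.2 = ξ ∧ ∀ i < z.2, C z.1 i < ξ
      · obtain ⟨⟨η, n⟩, s1, s2, s3, s4, rfl, s6⟩ := h3
        have : ∀ i : Fin (N η), ∃ S, ∀ G R G' R', AgreeOn δ S G R G' R' →
            e G R (C η i) = e G' R' (C η i) := fun i => ih _ (s6 i (i.2.trans_le s4))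
        choose S hS using this
        refine ⟨insert η (Finset.univ.biUnion S), fun G R G' R' h => ?_⟩
        rw [tail G R η s1 s2 s3 n s4, tail G' R' η s1 s2 s3 n s4,
          h.1 η (Finset.mem_insert_self _ _) s1]
        congr 2
        funext i
        refine hS i _ _ _ _ (h.mono fun x hx => Finset.mem_insert_of_mem ?_)
        exact Finset.mem_biUnion.2 ⟨i, Finset.mem_univ _, hx⟩
      · refine ⟨∅, fun G R G' R' h => ?_⟩
        rw [he, ladderFill, ladderFill, if_neg h1, if_neg h1, if_neg h2, if_neg h2, dif_neg h3,
          dif_neg h3]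
  refine ⟨e, ?_, ?_, ?_, supp, ?_⟩
  · intro G R ξ hξ
    rw [he, ladderFill, if_pos hξ]
  · intro G R ξ hξ hδξ
    rw [he, ladderFill, if_neg (not_lt.2 hδξ), if_pos hξ]
  · intro G R η hη h1 h2
    have : (fun n => e G R (C η n)) = X (List.ofFn fun i : Fin (N η) => e G R (C η i)) (G η) := by
      funext n
      by_cases hn : N η ≤ n
      · exact tail G R η hη h1 h2 n hn
      · have := hX (List.ofFn fun i : Fin (N η) => e G R (C η i)) (G η)
          ⟨n, by simpa using hn⟩
        simpa using this.symm
    rw [this, hXF]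
  · intro η hη h1 h2
    choose S hS using supp
    -- One finite set serves the whole ladder: the first `N η` values and `G η` determine the real
    -- that is copied along the tail.
    refine ⟨insert η ((Finset.range (N η)).biUnion fun i => S (C η i)), fun G R G' R' h n => ?_⟩
    have hlow : ∀ i < N η, e G R (C η i) = e G' R' (C η i) := fun i hi =>
      hS _ _ _ _ _ (h.mono fun x hx => Finset.mem_insert_of_mem
        (Finset.mem_biUnion.2 ⟨i, Finset.mem_range.2 hi, hx⟩))
    by_cases hn : N η ≤ n
    · rw [tail G R η hη h1 h2 n hn, tail G' R' η hη h1 h2 n hn,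
        h.1 η (Finset.mem_insert_self _ _) hη]
      congr 2
      funext i
      exact hlow i i.2
    · exact hlow n (not_le.1 hn)

/-! ### Extending a condition of `Q_{C,F,g}` -/

namespace ForcingNotion

variable {P : ForcingNotion.{u}}

/-- The condition `s` forces the values of `g` and `r` on `S` to be given by `G` and `R`. -/
def Decides (P : ForcingNotion.{u}) (g r : ZFSet.{u}) (δ : Ordinal.{u}) (S : Finset Ordinal.{u})
    (G R : Ordinal.{u} → Bool) (s : ZFSet.{u}) : Prop :=
  (∀ η ∈ S, η ∈ Lim → P.ForcesValue g (toZFSet η) (G η) s) ∧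
    ∀ ζ ∈ S, ζ < δ → P.ForcesValue r (toZFSet ζ) (R ζ) s

theorem Decides.mono {g r s s' : ZFSet.{u}} {δ : Ordinal.{u}} {S : Finset Ordinal.{u}}
    {G R : Ordinal.{u} → Bool} (hP : P.IsPreorder) (h : P.Decides g r δ S G R s)
    (hs : P.Le s' s) : P.Decides g r δ S G R s' :=
  ⟨fun η hη hl => (h.1 η hη hl).mono hP hs, fun ζ hζ hl => (h.2 ζ hζ hl).mono hP hs⟩

theorem Decides.subset {g r s : ZFSet.{u}} {δ : Ordinal.{u}} {S T : Finset Ordinal.{u}}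
    {G R : Ordinal.{u} → Bool} (h : P.Decides g r δ S G R s) (hT : T ⊆ S) :
    P.Decides g r δ T G R s :=
  ⟨fun η hη => h.1 η (hT hη), fun ζ hζ => h.2 ζ (hT hζ)⟩

/-- Finitely many facts, each of which can be decided densely often and persists, can be decided
simultaneously. -/
theorem exists_le_forall_finset {ι : Type*} (hP : P.IsPreorder) (S : Finset ι)
    (φ : ι → ZFSet.{u} → Prop) (hmono : ∀ i s s', φ i s → P.Le s' s → φ i s') {p : ZFSet.{u}}
    (hp : p ∈ P.carrier) (h : ∀ i ∈ S, P.DenseBelow p (φ i)) :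
    ∃ s, P.Le s p ∧ ∀ i ∈ S, φ i s := by
  classical
  induction S using Finset.induction_on with
  | empty => exact ⟨p, hP.refl p hp, by simp⟩
  | insert i S _ ih =>
    obtain ⟨s, hs, hφ⟩ := ih fun j hj => h j (Finset.mem_insert_of_mem hj)
    obtain ⟨s', _, hs', hi⟩ := h i (Finset.mem_insert_self _ _) s (hP.left _ _ hs) hs
    refine ⟨s', hP.trans _ _ _ hs' hs, fun j hj => ?_⟩
    rcases Finset.mem_insert.1 hj with rfl | hj
    · exact hi
    · exact hmono _ _ _ (hφ j hj) hs'

theorem toZFSet_mem_limCode {η : Ordinal.{u}} (h : η ∈ Lim) : toZFSet η ∈ limCode.{u} := by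
  rw [limCode, mem_sep]
  exact ⟨toZFSet_mem_toZFSet_iff.2 h.1, η, h, rfl⟩

section Extension

variable {g r t : ZFSet.{u}} {δ : Ordinal.{u}}

/-- Finiteness of `S` is what allows one extension to decide everything. The tables `G` and `R` are
ground model functions that matter only on `S`; elsewhere they get the default value `false`. -/
theorem exists_decides (hP : P.IsPreorder) (hg : ∀ p ∈ P.carrier, P.ForcesFun limCode g p)
    (hr : P.ForcesFun (toZFSet δ) r t) (S : Finset Ordinal.{u}) {q : ZFSet.{u}} (hq : P.Le q t) :
    ∃ s, P.Le s q ∧ ∃ G R, P.Decides g r δ S G R s := by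
  have hqc := hP.left _ _ hq
  obtain ⟨s, hs, h1⟩ := exists_le_forall_finset hP S
    (fun η s => η ∈ Lim → ∃ v, P.ForcesValue g (toZFSet η) v s)
    (fun η s s' h hs hη => (h hη).imp fun v hv => hv.mono hP hs) hqc
    (fun η _ => by
      by_cases hη : η ∈ Lim
      · exact ((hg q hqc).2.1 _ (toZFSet_mem_limCode hη)).imp hP fun _ _ h _ => h
      · exact .of_forall hP fun _ _ h => absurd h hη)
  obtain ⟨s', hs', h2⟩ := exists_le_forall_finset hP S
    (fun ζ s => ζ < δ → ∃ v, P.ForcesValue r (toZFSet ζ) v s)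
    (fun ζ s s' h hs hζ => (h hζ).imp fun v hv => hv.mono hP hs) (hP.left _ _ hs)
    (fun ζ _ => by
      by_cases hζ : ζ < δ
      · exact ((hr.2.1 _ (toZFSet_mem_toZFSet_iff.2 hζ)).mono hP (hP.trans _ _ _ hs hq)).imp hP
          fun _ _ h _ => h
      · exact .of_forall hP fun _ _ h => absurd h hζ)
  have hG : ∀ η : Ordinal.{u}, ∃ v, η ∈ S → η ∈ Lim → P.ForcesValue g (toZFSet η) v s' := by
    intro η
    by_cases h : η ∈ S ∧ η ∈ Lim
    · obtain ⟨v, hv⟩ := h1 η h.1 h.2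
      exact ⟨v, fun _ _ => hv.mono hP hs'⟩
    · exact ⟨false, fun h1 h2 => absurd ⟨h1, h2⟩ h⟩
  have hR : ∀ ζ : Ordinal.{u}, ∃ v, ζ ∈ S → ζ < δ → P.ForcesValue r (toZFSet ζ) v s' := by
    intro ζ
    by_cases h : ζ ∈ S ∧ ζ < δ
    · obtain ⟨v, hv⟩ := h2 ζ h.1 h.2
      exact ⟨v, fun _ _ => hv⟩
    · exact ⟨false, fun h1 h2 => absurd ⟨h1, h2⟩ h⟩
  choose G hG using hG
  choose R hR using hR
  exact ⟨s', hP.trans _ _ _ hs' hs, G, R, fun η => hG η, fun ζ => hR ζ⟩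

theorem Decides.agreeOn (hP : P.IsPreorder) (hg : ∀ p ∈ P.carrier, P.ForcesFun limCode g p)
    (hr : P.ForcesFun (toZFSet δ) r t) {S : Finset Ordinal.{u}} {G R G' R' : Ordinal.{u} → Bool}
    {s : ZFSet.{u}} (hs : P.Le s t) (h : P.Decides g r δ S G R s)
    (h' : P.Decides g r δ S G' R' s) : AgreeOn δ S G R G' R' := by
  have hsc := hP.left _ _ hs
  exact ⟨fun η hη hl => (hg s hsc).value_unique hP hsc (h.1 η hη hl) (h'.1 η hη hl),
    fun ζ hζ hl => (hr.mono hP hs).value_unique hP hsc (h.2 ζ hζ hl) (h'.2 ζ hζ hl)⟩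

/-- The name for the function on `δ'` whose value at `ξ` is `e G R ξ`, for the values `G` and `R`
of `g` and `r` on the finite set `S ξ`. -/
noncomputable def fillName (P : ForcingNotion.{u}) (g r : ZFSet.{u}) (δ δ' : Ordinal.{u})
    (S : Ordinal.{u} → Finset Ordinal.{u})
    (e : (Ordinal.{u} → Bool) → (Ordinal.{u} → Bool) → Ordinal.{u} → Bool) : ZFSet.{u} :=
  (prod (range fun x : {x // x ∈ timesTwo (toZFSet δ')} => P.check x.val) P.carrier).sep fun z =>
    ∃ ξ v s, z = pair (P.check (pair (toZFSet ξ) (bit v))) s ∧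
      ∃ G R, P.Decides g r δ (S ξ) G R s ∧ e G R ξ = v

theorem mem_fillName {δ' : Ordinal.{u}} {S : Ordinal.{u} → Finset Ordinal.{u}}
    {e : (Ordinal.{u} → Bool) → (Ordinal.{u} → Bool) → Ordinal.{u} → Bool} (hP : P.IsPreorder)
    {z : ZFSet.{u}} : z ∈ P.fillName g r δ δ' S e ↔
    ∃ ξ < δ', ∃ v, ∃ s ∈ P.carrier, z = pair (P.check (pair (toZFSet ξ) (bit v))) s ∧
      ∃ G R, P.Decides g r δ (S ξ) G R s ∧ e G R ξ = v := by
  rw [fillName, mem_sep, mem_prod]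
  constructor
  · rintro ⟨⟨x, hx, s, hs, rfl⟩, ξ, v, s', he, h⟩
    obtain ⟨⟨y, hy⟩, rfl⟩ := mem_range.1 hx
    obtain ⟨he1, rfl⟩ := pair_inj.1 he
    have hye : y = pair (toZFSet ξ) (bit v) := by
      refine check_inj hP hP.one_mem (P := P) ?_
      rw [← he1]
      exact ForcesEq.refl hP _ _
    subst hye
    obtain ⟨w, hw, v', hwe⟩ := mem_timesTwo.1 hy
    rw [← (pair_inj.1 hwe).1] at hw
    exact ⟨ξ, toZFSet_mem_toZFSet_iff.1 hw, v, s, hs, rfl, h⟩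
  · rintro ⟨ξ, hξ, v, s, hs, rfl, h⟩
    refine ⟨⟨_, mem_range.2 ⟨⟨pair (toZFSet ξ) (bit v), ?_⟩, rfl⟩, s, hs, rfl⟩, ξ, v, s, rfl, h⟩
    exact mem_timesTwo.2 ⟨_, toZFSet_mem_toZFSet_iff.2 hξ, v, rfl⟩

/-- The name has a pair for each condition deciding `S ξ`, and check names of distinct sets are
never forced equal, so the tables responsible for a forced value can be read off. -/
theorem forcesValue_fillName_iff {δ' : Ordinal.{u}} {S : Ordinal.{u} → Finset Ordinal.{u}}
    {e : (Ordinal.{u} → Bool) → (Ordinal.{u} → Bool) → Ordinal.{u} → Bool} (hP : P.IsPreorder)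
    {q : ZFSet.{u}} {ξ : Ordinal.{u}} (hξ : ξ < δ') {v : Bool} :
    P.ForcesValue (P.fillName g r δ δ' S e) (toZFSet ξ) v q ↔
      P.DenseBelow q fun s => ∃ G R, P.Decides g r δ (S ξ) G R s ∧ e G R ξ = v := by
  constructor
  · intro h
    refine DenseBelow.imp hP h fun s hs ⟨τ, s', hmem, hss, he⟩ => ?_
    obtain ⟨ξ', _, v', s'', _, heq, G, R, hd, hv⟩ := (mem_fillName hP).1 hmem
    obtain ⟨rfl, rfl⟩ := pair_inj.1 heq
    obtain ⟨h1, h2⟩ := pair_inj.1 (check_inj hP (hP.left _ _ hs) he)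
    obtain rfl := toZFSet_injective h1
    obtain rfl := bit_injective h2
    exact ⟨G, R, hd.mono hP hss, hv⟩
  · intro h
    refine DenseBelow.imp hP h fun s hs ⟨G, R, hd, hv⟩ => ?_
    have hsc := hP.left _ _ hs
    exact ⟨_, s, (mem_fillName hP).2 ⟨ξ, hξ, v, s, hsc, rfl, G, R, hd, hv⟩, hP.refl s hsc,
      ForcesEq.refl hP _ _⟩

/-- A condition of `Q_{C,F,g}` of length `δ` can be extended to one that has prescribed values at
finitely many places above `δ`. -/
theorem exists_extension_name {C : Ordinal.{u} → ℕ → Ordinal.{u}}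
    {F : (ℕ → Bool) → Option Bool} (hP : P.IsPreorder) (hC : IsLadderSystem C)
    (hF : IsDenseFunction F) (hg : ∀ p ∈ P.carrier, P.ForcesFun limCode g p)
    (hδ : δ < ω₁) (hr : P.ForcesFun (toZFSet δ) r t)
    (hcond : ∀ η ∈ Lim, η ≤ δ → P.DenseBelow t fun r' => ∃ y v, F y = some v ∧
      (∀ n, P.ForcesValue r (toZFSet (C η n)) (y n) r') ∧ P.ForcesValue g (toZFSet η) v r')
    (A : Finset Ordinal.{u}) (hA : ∀ ξ ∈ A, ξ < ω₁) (a : Ordinal.{u} → Bool) :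
    ∃ σ, P.IsName σ ∧ P.ForcesCond C F g σ t ∧ P.ForcesSubset r σ t ∧
      ∀ ξ ∈ A, δ ≤ ξ → P.ForcesValue σ (toZFSet ξ) (a ξ) t := by
  classical
  obtain ⟨δ', hδ', hle, hAδ⟩ : ∃ δ' < (ω₁ : Ordinal.{u}), δ ≤ δ' ∧ ∀ ξ ∈ A, ξ < δ' := by
    refine ⟨Order.succ ((insert δ A).sup id), (isSuccLimit_omega 1).succ_lt ?_, ?_, ?_⟩
    · rw [Finset.sup_lt_iff (bot_le.trans_lt hδ)]
      intro ξ hξ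
      rcases Finset.mem_insert.1 hξ with rfl | hξ
      · exact hδ
      · exact hA ξ hξ
    · exact (Finset.le_sup (f := id) (Finset.mem_insert_self δ A)).trans (Order.le_succ _)
    · intro ξ hξ
      exact Order.lt_succ_of_le (Finset.le_sup (f := id) (Finset.mem_insert_of_mem hξ))
  obtain ⟨e, he1, he2, he3, he4, he5⟩ := exists_ladder_fill hC hF δ δ' hδ' A a
  choose S₀ hS₀ using he4
  -- The point `ξ` is added to its own support so that, for `ξ < δ`, a condition deciding `S ξ` also
  -- decides the old function at `ξ`.
  set S : Ordinal.{u} → Finset Ordinal.{u} := fun ξ => insert ξ (S₀ ξ) with hSdef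
  have hS : ∀ ξ G R G' R', AgreeOn δ (S ξ) G R G' R' → e G R ξ = e G' R' ξ :=
    fun ξ G R G' R' h => hS₀ ξ G R G' R' (h.mono (Finset.subset_insert _ _))
  set σ := P.fillName g r δ δ' S e with hσ
  have hsub : P.ForcesSubset r σ t := by
    refine ForcesFun.subset_of_values (A := toZFSet δ) hP
      (.of_forall hP fun q hq => ⟨_, fun _ h => h, hr.mono hP hq⟩) ?_
    intro x hx v q hq hv
    obtain ⟨ζ, hζ, rfl⟩ := mem_toZFSet_iff.1 hx
    refine (forcesValue_fillName_iff hP (hζ.trans_le hle)).2 fun q' _ hqq => ?_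
    have hq' := hP.trans _ _ _ hqq hq
    obtain ⟨s, hs, G, R, hd⟩ := exists_decides hP hg hr (S ζ) hq'
    have hsc := hP.left _ _ hs
    refine ⟨s, hsc, hs, G, R, hd, ?_⟩
    rw [he1 G R ζ hζ]
    exact (hr.mono hP (hP.trans _ _ _ hs hq')).value_unique hP hsc
      (hd.2 ζ (Finset.mem_insert_self _ _) hζ) (hv.mono hP (hP.trans _ _ _ hs hqq))
  have hfun : P.ForcesFun (toZFSet δ') σ t := by
    refine ⟨?_, ?_, ?_⟩
    · intro x _ q _ _ hx
      refine (forcesMem_check_iff hP).2 (DenseBelow.imp hP hx fun s hs ⟨τ, t', hmem, _, he⟩ => ?_)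
      obtain ⟨ξ, hξ, v, s', _, heq, _⟩ := (mem_fillName hP).1 hmem
      obtain ⟨rfl, rfl⟩ := pair_inj.1 heq
      exact ⟨_, mem_timesTwo.2 ⟨_, toZFSet_mem_toZFSet_iff.2 hξ, v, rfl⟩, he⟩
    · intro x hx q hq hqt
      obtain ⟨ξ, hξ, rfl⟩ := mem_toZFSet_iff.1 hx
      obtain ⟨s, hs, G, R, hd⟩ := exists_decides hP hg hr (S ξ) hqt
      refine ⟨s, hP.left _ _ hs, hs, e G R ξ, (forcesValue_fillName_iff hP hξ).2 ?_⟩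
      exact .of_forall hP fun s' hs' => ⟨G, R, hd.mono hP hs', rfl⟩
    · rintro x hx q hq hqt ⟨hf, ht⟩
      obtain ⟨ξ, hξ, rfl⟩ := mem_toZFSet_iff.1 hx
      rw [forcesValue_fillName_iff hP hξ] at hf ht
      obtain ⟨s, hs, hsq, G, R, hd, hv⟩ := hf q hq (hP.refl q hq)
      obtain ⟨s', hs', hsq', G', R', hd', hv'⟩ := ht s hs hsq
      have := hS ξ _ _ _ _ (Decides.agreeOn hP hg hr
        (hP.trans _ _ _ hsq' (hP.trans _ _ _ hsq hqt)) (hd.mono hP hsq') hd')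
      rw [hv, hv'] at this
      cases this
  refine ⟨σ, ?_, ?_, hsub, ?_⟩
  · refine .mk _ (fun z hz => ?_) fun τ s h => ?_
    · obtain ⟨ξ, _, v, s, hs, rfl, _⟩ := (mem_fillName hP).1 hz
      exact ⟨_, s, hs, rfl⟩
    · obtain ⟨ξ, _, v, s, _, he, _⟩ := (mem_fillName hP).1 h
      rw [(pair_inj.1 he).1]
      exact isName_check hP _
  · refine .of_forall hP fun q hq => ⟨δ', hδ', hfun.mono hP hq, fun η hη hηδ => ?_⟩
    rcases le_or_gt η δ with hle | hgt
    · refine ((hcond η hη hle).mono hP hq).imp hP fun s hs ⟨y, v, hy, hval, hgv⟩ =>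
        ⟨y, v, hy, fun n => ?_, hgv⟩
      exact (hval n).of_subset hP (hP.left _ _ hs) (hsub.mono hP (hP.trans _ _ _ hs hq))
    · intro q' _ hqq
      -- Deciding the finite set `Sη` fixes the entire sequence along the ladder of `η`, which is
      -- thereby a real of the ground model; deciding `g` at `η` as well gives its required image
      -- under `F`.
      obtain ⟨Sη, hSη⟩ := he5 η hη hgt hηδ
      have hq' := hP.trans _ _ _ hqq hq
      obtain ⟨s, hs, G, R, hd⟩ := exists_decides hP hg hr (insert η Sη) hq'
      refine ⟨s, hP.left _ _ hs, hs, fun n => e G R (C η n), G η, he3 G R η hη hgt hηδ,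
        fun n => ?_, hd.1 η (Finset.mem_insert_self _ _) hη⟩
      refine (forcesValue_fillName_iff hP (((hC η hη).2.1 n).trans_le hηδ)).2 ?_
      intro s' hs' hss
      have hst := hP.trans _ _ _ hss (hP.trans _ _ _ hs hq')
      obtain ⟨s'', hs'', G', R', hd'⟩ := exists_decides hP hg hr (Sη ∪ S (C η n)) hst
      refine ⟨s'', hP.left _ _ hs'', hs'', G', R', hd'.subset Finset.subset_union_right, ?_⟩
      refine hSη _ _ _ _ (Decides.agreeOn hP hg hr (hP.trans _ _ _ hs'' hst)
        (hd'.subset Finset.subset_union_left) ?_) n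
      exact (hd.subset (Finset.subset_insert _ _)).mono hP (hP.trans _ _ _ hs'' hss)
  · intro ξ hξ hδξ
    refine (forcesValue_fillName_iff hP (hAδ ξ hξ)).2 fun q hq hqt => ?_
    obtain ⟨s, hs, G, R, hd⟩ := exists_decides hP hg hr (S ξ) hqt
    exact ⟨s, hP.left _ _ hs, hs, G, R, hd, he2 G R ξ hξ hδξ⟩

end Extension

end ForcingNotion

/-! ### Sequences indexed by ordinals -/

theorem mem_seqCode {α : Ordinal.{u}} {f : Ordinal.{u} → ZFSet.{u}} {z : ZFSet.{u}} :
    z ∈ seqCode α f ↔ ∃ β < α, z = pair β.toZFSet (f β) := by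
  rw [seqCode, mem_range]
  constructor
  · rintro ⟨⟨β, hβ⟩, rfl⟩
    exact ⟨β, hβ, rfl⟩
  · rintro ⟨β, hβ, rfl⟩
    exact ⟨⟨β, hβ⟩, rfl⟩

theorem pair_mem_seqCode {α β : Ordinal.{u}} {f : Ordinal.{u} → ZFSet.{u}} {b : ZFSet.{u}} :
    pair β.toZFSet b ∈ seqCode α f ↔ β < α ∧ b = f β := by
  rw [mem_seqCode]
  constructor
  · rintro ⟨γ, hγ, h⟩
    obtain ⟨h1, h2⟩ := pair_inj.1 h
    obtain rfl := toZFSet_injective h1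
    exact ⟨hγ, h2⟩
  · rintro ⟨h, rfl⟩
    exact ⟨β, h, rfl⟩

theorem seqCode_congr {α : Ordinal.{u}} {f f' : Ordinal.{u} → ZFSet.{u}}
    (h : ∀ β < α, f β = f' β) : seqCode α f = seqCode α f' := by
  ext z
  simp only [mem_seqCode]
  refine exists_congr fun β => and_congr_right fun hβ => ?_
  rw [h β hβ]

theorem eq_of_seqCode_eq {α : Ordinal.{u}} {f f' : Ordinal.{u} → ZFSet.{u}}
    (h : seqCode α f = seqCode α f') {β : Ordinal.{u}} (hβ : β < α) : f β = f' β := by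
  have : pair β.toZFSet (f β) ∈ seqCode α f := pair_mem_seqCode.2 ⟨hβ, rfl⟩
  rw [h] at this
  exact (pair_mem_seqCode.1 this).2

theorem restrict_seqCode {α β : Ordinal.{u}} (f : Ordinal.{u} → ZFSet.{u}) (h : β ≤ α) :
    restrict (seqCode α f) β = seqCode β f := by
  ext z
  rw [restrict, mem_sep, mem_seqCode, mem_seqCode]
  constructor
  · rintro ⟨⟨γ, _, rfl⟩, ξ, hξ, b, he⟩
    obtain rfl := toZFSet_injective (pair_inj.1 he).1
    exact ⟨γ, hξ, rfl⟩
  · rintro ⟨γ, hγ, rfl⟩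
    exact ⟨⟨γ, hγ.trans_le h, rfl⟩, γ, hγ, _, rfl⟩

open Classical in
/-- The value at `β` of a function on an ordinal. -/
noncomputable def fn (p : ZFSet.{u}) (β : Ordinal.{u}) : ZFSet.{u} :=
  if h : ∃ b, pair β.toZFSet b ∈ p then h.choose else ∅

theorem fn_seqCode {α β : Ordinal.{u}} (f : Ordinal.{u} → ZFSet.{u}) (h : β < α) :
    fn (seqCode α f) β = f β := by
  have hex : ∃ b, pair β.toZFSet b ∈ seqCode α f := ⟨_, pair_mem_seqCode.2 ⟨h, rfl⟩⟩
  rw [fn, dif_pos hex]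
  exact (pair_mem_seqCode.1 hex.choose_spec).2

/-! ### Countable support iterations -/

namespace IsIteration

variable {C : Ordinal.{u} → ℕ → Ordinal.{u}} {F : (ℕ → Bool) → Option Bool} {q : IterSeq.{u}}

theorem eq_seqCode (hq : IsIteration C F q) {α : Ordinal.{u}} (hα : α ≤ q.len) {p : ZFSet.{u}}
    (hp : p ∈ (q.P α).carrier) : p = seqCode α (fn p) := by
  obtain ⟨f, rfl, -⟩ := (hq.carrier_iff α hα p).1 hp
  exact seqCode_congr fun β hβ => (fn_seqCode f hβ).symm

theorem seqCode_mem_iff (hq : IsIteration C F q) {α : Ordinal.{u}} (hα : α ≤ q.len)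
    {f : Ordinal.{u} → ZFSet.{u}} : seqCode α f ∈ (q.P α).carrier ↔
      (∀ β < α, seqCode β f ∈ (q.P β).carrier ∧ (∃ s, pair (f β) s ∈ q.Q β) ∧
        (q.P β).ForcesMem (f β) (q.Q β) (seqCode β f)) ∧
      {β | β < α ∧ f β ≠ ∅}.Countable := by
  rw [hq.carrier_iff α hα]
  constructor
  · rintro ⟨f', he, h1, h2⟩
    have hf : ∀ β < α, f β = f' β := fun β => eq_of_seqCode_eq he
    refine ⟨fun β hβ => ?_, ?_⟩
    · rw [hf β hβ, seqCode_congr fun γ hγ => hf γ (hγ.trans hβ)]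
      exact h1 β hβ
    · convert h2 using 3 with β
      refine and_congr_right fun hβ => ?_
      rw [hf β hβ]
  · rintro ⟨h1, h2⟩
    exact ⟨f, rfl, h1, h2⟩

theorem le_iff (hq : IsIteration C F q) {α : Ordinal.{u}} (hα : α ≤ q.len)
    {f f' : Ordinal.{u} → ZFSet.{u}} : (q.P α).Le (seqCode α f) (seqCode α f') ↔
      seqCode α f ∈ (q.P α).carrier ∧ seqCode α f' ∈ (q.P α).carrier ∧
        ∀ β < α, (q.P β).ForcesSubset (f' β) (f β) (seqCode β f) := by
  rw [ForcingNotion.Le, hq.rel_iff α hα]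
  constructor
  · rintro ⟨f₁, f₁', he, h1, h2, h3⟩
    obtain ⟨e1, e2⟩ := pair_inj.1 he
    refine ⟨e1 ▸ h1, e2 ▸ h2, fun β hβ => ?_⟩
    rw [eq_of_seqCode_eq e1 hβ, eq_of_seqCode_eq e2 hβ,
      seqCode_congr fun γ hγ => eq_of_seqCode_eq e1 (hγ.trans hβ)]
    exact h3 β hβ
  · rintro ⟨h1, h2, h3⟩
    exact ⟨f, f', rfl, h1, h2, h3⟩

theorem left_mem (hq : IsIteration C F q) {α : Ordinal.{u}} (hα : α ≤ q.len) {p p' : ZFSet.{u}}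
    (h : (q.P α).Le p p') : p ∈ (q.P α).carrier ∧ p' ∈ (q.P α).carrier := by
  obtain ⟨f, f', he, h1, h2, -⟩ := (hq.rel_iff α hα _).1 h
  obtain ⟨rfl, rfl⟩ := pair_inj.1 he
  exact ⟨h1, h2⟩

theorem restrict_eq (hq : IsIteration C F q) {α β : Ordinal.{u}} (hα : α ≤ q.len) (hβ : β ≤ α)
    {p : ZFSet.{u}} (hp : p ∈ (q.P α).carrier) : restrict p β = seqCode β (fn p) := by
  conv_lhs => rw [hq.eq_seqCode hα hp]
  exact restrict_seqCode _ hβ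

theorem restrict_self (hq : IsIteration C F q) {α : Ordinal.{u}} (hα : α ≤ q.len)
    {p : ZFSet.{u}} (hp : p ∈ (q.P α).carrier) : restrict p α = p := by
  rw [hq.restrict_eq hα le_rfl hp, ← hq.eq_seqCode hα hp]

theorem restrict_mem (hq : IsIteration C F q) {α β : Ordinal.{u}} (hα : α ≤ q.len) (hβ : β ≤ α)
    {p : ZFSet.{u}} (hp : p ∈ (q.P α).carrier) : restrict p β ∈ (q.P β).carrier := by
  rcases hβ.eq_or_lt with rfl | hβ
  · rwa [hq.restrict_self hα hp]
  · rw [hq.restrict_eq hα hβ.le hp]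
    rw [hq.eq_seqCode hα hp] at hp
    exact (((hq.seqCode_mem_iff hα).1 hp).1 β hβ).1

theorem le_iff' (hq : IsIteration C F q) {α : Ordinal.{u}} (hα : α ≤ q.len)
    {p p' : ZFSet.{u}} : (q.P α).Le p p' ↔ p ∈ (q.P α).carrier ∧ p' ∈ (q.P α).carrier ∧
        ∀ β < α, (q.P β).ForcesSubset (fn p' β) (fn p β) (restrict p β) := by
  constructor
  · intro h
    obtain ⟨h1, h2⟩ := hq.left_mem hα h
    refine ⟨h1, h2, fun β hβ => ?_⟩
    rw [hq.eq_seqCode hα h1, hq.eq_seqCode hα h2] at h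
    rw [hq.restrict_eq hα hβ.le h1]
    exact ((hq.le_iff hα).1 h).2.2 β hβ
  · rintro ⟨h1, h2, h3⟩
    rw [hq.eq_seqCode hα h1, hq.eq_seqCode hα h2, hq.le_iff hα, ← hq.eq_seqCode hα h1,
      ← hq.eq_seqCode hα h2]
    refine ⟨h1, h2, fun β hβ => ?_⟩
    rw [← hq.restrict_eq hα hβ.le h1]
    exact h3 β hβ

theorem le_restrict (hq : IsIteration C F q) {α β : Ordinal.{u}} (hα : α ≤ q.len) (hβ : β ≤ α)
    {p p' : ZFSet.{u}} (h : (q.P α).Le p p') : (q.P β).Le (restrict p β) (restrict p' β) := by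
  obtain ⟨h1, h2, h3⟩ := (hq.le_iff' hα).1 h
  have h1' := hq.restrict_mem hα hβ h1
  have h2' := hq.restrict_mem hα hβ h2
  rw [hq.restrict_eq hα hβ h1] at h1' ⊢
  rw [hq.restrict_eq hα hβ h2] at h2' ⊢
  refine (hq.le_iff (hβ.trans hα)).2 ⟨h1', h2', fun γ hγ => ?_⟩
  rw [← hq.restrict_eq hα (hγ.le.trans hβ) h1]
  exact h3 γ (hγ.trans_le hβ)

/-- Induction on `α`: transitivity at `α` moves a forced inclusion to a stronger condition of `P_β`,
and the largest element is a condition because the empty name is in every `Q_β`. -/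
theorem isPreorder (hq : IsIteration C F q) {α : Ordinal.{u}} (hα : α ≤ q.len) :
    (q.P α).IsPreorder := by
  induction α using WellFoundedLT.induction with
  | ind α ih =>
    have one_mem : (q.P α).one ∈ (q.P α).carrier := by
      rw [hq.one_eq α hα, hq.seqCode_mem_iff hα]
      refine ⟨fun β hβ => ?_, by simp⟩
      have hβ' := hβ.le.trans hα
      have hP := ih β hβ hβ'
      rw [← hq.one_eq β hβ']
      exact ⟨hP.one_mem, ⟨_, hq.Q_one β (hβ.trans_le hα)⟩,
        .of_mem hP (hq.Q_one β (hβ.trans_le hα)) (hP.refl _ hP.one_mem)⟩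
    refine ⟨fun p hp => (hq.le_iff' hα).2 ⟨hp, hp, fun β _ => .refl _ _⟩, ?_,
      fun p p' h => (hq.left_mem hα h).1, fun p p' h => (hq.left_mem hα h).2, one_mem, ?_⟩
    · intro p p' p'' h h'
      obtain ⟨h1, -, h2⟩ := (hq.le_iff' hα).1 h
      obtain ⟨-, h1', h2'⟩ := (hq.le_iff' hα).1 h'
      refine (hq.le_iff' hα).2 ⟨h1, h1', fun β hβ => ?_⟩
      exact ((h2' β hβ).mono (ih β hβ (hβ.le.trans hα)) (hq.le_restrict hα hβ.le h)).trans
        (h2 β hβ)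
    · intro p hp
      refine (hq.le_iff' hα).2 ⟨hp, one_mem, fun β hβ => ?_⟩
      rw [hq.one_eq α hα, fn_seqCode _ hβ]
      exact ForcingNotion.forcesSubset_empty (ih β hβ (hβ.le.trans hα)) _ _

/-- The condition that agrees with `t` below `β` and with `p` from `β` on. -/
noncomputable def _root_.CondTree.glue (α β : Ordinal.{u}) (t p : ZFSet.{u}) : ZFSet.{u} :=
  open Classical in seqCode α fun ξ => if ξ < β then fn t ξ else fn p ξ

/-- Being a condition and lying below `p` are proved together by induction on the length: from `β`
on, `p(ξ)` is still forced into `Q_ξ` because the part already glued is below `p ↾ ξ`. -/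
theorem glue_le (hq : IsIteration C F q) {α β : Ordinal.{u}} (hα : α ≤ q.len) (hβ : β ≤ α)
    {t p : ZFSet.{u}} (hp : p ∈ (q.P α).carrier) (ht : t ∈ (q.P β).carrier)
    (h : (q.P β).Le t (restrict p β)) : (q.P α).Le (glue α β t p) p := by
  classical
  set f : Ordinal.{u} → ZFSet.{u} := fun ξ => if ξ < β then fn t ξ else fn p ξ
  have flt : ∀ ξ < β, f ξ = fn t ξ := fun ξ hξ => if_pos hξ
  have fge : ∀ ξ, ¬ ξ < β → f ξ = fn p ξ := fun ξ hξ => if_neg hξ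
  have hβ' := hβ.trans hα
  have low : ∀ ξ ≤ β, seqCode ξ f = seqCode ξ (fn t) := fun ξ hξ =>
    seqCode_congr fun γ hγ => if_pos (hγ.trans_le hξ)
  suffices H : ∀ α' ≤ α, (q.P α').Le (seqCode α' f) (seqCode α' (fn p)) by
    have := H α le_rfl
    rwa [← hq.eq_seqCode hα hp] at this
  intro α' hα'
  induction α' using WellFoundedLT.induction with
  | ind α' ih =>
    have hα'' := hα'.trans hα
    have hpm := hq.restrict_mem hα hα' hp
    rw [hq.restrict_eq hα hα' hp] at hpm
    have hpc := (hq.seqCode_mem_iff hα'').1 hpm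
    have ht' := ht
    rw [hq.eq_seqCode hβ' ht] at ht'
    have htc := (hq.seqCode_mem_iff hβ').1 ht'
    refine (hq.le_iff hα'').2 ⟨(hq.seqCode_mem_iff hα'').2 ⟨fun ξ hξ => ?_, ?_⟩, hpm,
      fun ξ hξ => ?_⟩
    · have hle := ih ξ hξ (hξ.le.trans hα')
      refine ⟨(hq.left_mem (hξ.le.trans hα'') hle).1, ?_⟩
      by_cases hξβ : ξ < β
      · rw [low ξ hξβ.le, flt ξ hξβ]
        exact (htc.1 ξ hξβ).2
      · rw [fge ξ hξβ]
        exact ⟨(hpc.1 ξ hξ).2.1, (hpc.1 ξ hξ).2.2.mono (hq.isPreorder (hξ.le.trans hα'')) hle⟩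
    · refine (htc.2.union hpc.2).mono ?_
      rintro ξ ⟨hξ, hne⟩
      by_cases hξβ : ξ < β
      · rw [flt ξ hξβ] at hne
        exact .inl ⟨hξβ, hne⟩
      · rw [fge ξ hξβ] at hne
        exact .inr ⟨hξ, hne⟩
    · by_cases hξβ : ξ < β
      · rw [low ξ hξβ.le, flt ξ hξβ, ← hq.restrict_eq hβ' hξβ.le ht]
        have := ((hq.le_iff' hβ').1 h).2.2 ξ hξβ
        rwa [hq.restrict_eq hα hβ hp, fn_seqCode _ hξβ] at this
      · rw [fge ξ hξβ]
        exact .refl _ _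

theorem _root_.CondTree.fn_glue_of_lt {α β ξ : Ordinal.{u}} {t p : ZFSet.{u}} (hβ : β ≤ α)
    (hξ : ξ < β) : fn (glue α β t p) ξ = fn t ξ := by
  rw [glue, fn_seqCode _ (hξ.trans_le hβ), if_pos hξ]

theorem _root_.CondTree.fn_glue_of_le {α β ξ : Ordinal.{u}} {t p : ZFSet.{u}} (hβ : β ≤ ξ)
    (hξ : ξ < α) : fn (glue α β t p) ξ = fn p ξ := by
  rw [glue, fn_seqCode _ hξ, if_neg (not_lt.2 hβ)]

theorem restrict_glue (hq : IsIteration C F q) {α β ξ : Ordinal.{u}} (hα : α ≤ q.len)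
    (hβ : β ≤ α) {t p : ZFSet.{u}} (ht : t ∈ (q.P β).carrier) (hξ : ξ ≤ β) :
    restrict (glue α β t p) ξ = restrict t ξ := by
  rw [glue, restrict_seqCode _ (hξ.trans hβ), hq.restrict_eq (hβ.trans hα) hξ ht]
  exact seqCode_congr fun γ hγ => if_pos (hγ.trans_le hξ)

end IsIteration

/-! ### Deciding values of the generic functions -/

/-- `p ↾ β` forces the value of `p(β)` at `ξ` to be `v`. -/
def IterSeq.Val (q : IterSeq.{u}) (p : ZFSet.{u}) (β ξ : Ordinal.{u}) (v : Bool) : Prop :=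
  (q.P β).ForcesValue (fn p β) (toZFSet ξ) v (restrict p β)

/-- `p ↾ β` forces the domain of `p(β)` to be contained in `δ`. -/
def IterSeq.Bd (q : IterSeq.{u}) (p : ZFSet.{u}) (β δ : Ordinal.{u}) : Prop :=
  ∀ ξ < ω₁, ∀ v t, (q.P β).Le t (restrict p β) →
    (q.P β).ForcesValue (fn p β) (toZFSet ξ) v t → ξ < δ

/-- The domain of `p(β)` is bounded by some `δ`, and `p ↾ β` forces `p(β)` to agree with `a` on the
elements of `A` below `δ`. -/
def IterSeq.Ready (q : IterSeq.{u}) (A : Finset Ordinal.{u}) (p : ZFSet.{u}) (β : Ordinal.{u})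
    (a : Ordinal.{u} → Bool) : Prop :=
  ∃ δ, q.Bd p β δ ∧ ∀ ξ ∈ A, ξ < δ → q.Val p β ξ (a ξ)

/-! ### Strengthening conditions on finitely many coordinates -/

namespace IsIteration

variable {C : Ordinal.{u} → ℕ → Ordinal.{u}} {F : (ℕ → Bool) → Option Bool} {q : IterSeq.{u}}
  {p p' : ZFSet.{u}} {β : Ordinal.{u}}

theorem coord (hq : IsIteration C F q) {α : Ordinal.{u}} (hα : α ≤ q.len)
    (hp : p ∈ (q.P α).carrier) (hβ : β < α) :
    (q.P β).IsName (fn p β) ∧ (q.P β).ForcesCond C F (q.g β) (fn p β) (restrict p β) := by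
  have hr := hq.restrict_mem hα hβ.le hp
  rw [hq.restrict_eq hα hβ.le hp] at hr ⊢
  rw [hq.eq_seqCode hα hp] at hp
  obtain ⟨-, ⟨s, hs⟩, hm⟩ := ((hq.seqCode_mem_iff hα).1 hp).1 β hβ
  have hβl := hβ.trans_le hα
  have hn := ((hq.Q_name β hβl).of_pair_mem hs).1
  exact ⟨hn, (hq.Q_eq β hβl _ hn _ hr).1 hm⟩

theorem val_mono (hq : IsIteration C F q) (hβ : β < q.len) (h : (q.P q.len).Le p' p)
    {ξ : Ordinal.{u}} {v : Bool} (hv : q.Val p β ξ v) : q.Val p' β ξ v := by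
  have hP := hq.isPreorder hβ.le
  have hle := hq.le_restrict le_rfl hβ.le h
  exact (hv.mono hP hle).of_subset hP (hP.left _ _ hle) (((hq.le_iff' le_rfl).1 h).2.2 β hβ)

/-- A stronger condition may have a longer function at `β`, so a bound is inherited only if the name
at `β` is unchanged. -/
theorem bd_mono (hq : IsIteration C F q) (hβ : β < q.len) (h : (q.P q.len).Le p' p)
    (he : fn p' β = fn p β) {δ : Ordinal.{u}} (hb : q.Bd p β δ) : q.Bd p' β δ := by
  intro ξ hξ v t ht hv
  rw [he] at hv
  exact hb ξ hξ v t ((hq.isPreorder hβ.le).trans _ _ _ ht (hq.le_restrict le_rfl hβ.le h)) hv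

theorem ready_mono (hq : IsIteration C F q) (hβ : β < q.len) (h : (q.P q.len).Le p' p)
    (he : fn p' β = fn p β) {A : Finset Ordinal.{u}} {a : Ordinal.{u} → Bool}
    (hr : q.Ready A p β a) : q.Ready A p' β a := by
  obtain ⟨δ, h1, h2⟩ := hr
  exact ⟨δ, hq.bd_mono hβ h he h1, fun ξ hξ hδ => hq.val_mono hβ h (h2 ξ hξ hδ)⟩

theorem bd_of_forcesFun (hq : IsIteration C F q) (hβ : β < q.len) {δ : Ordinal.{u}}
    (h : (q.P β).ForcesFun (toZFSet δ) (fn p β) (restrict p β)) : q.Bd p β δ := by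
  intro ξ _ v t ht hv
  have hP := hq.isPreorder hβ.le
  exact toZFSet_mem_toZFSet_iff.1 ((h.mono hP ht).mem_of_forcesValue hP (hP.left _ _ ht) hv)

/-- Extending `p ↾ β` to `t`. -/
theorem exists_le_of_le_restrict (hq : IsIteration C F q) (hp : p ∈ (q.P q.len).carrier)
    (hβ : β ≤ q.len) {t : ZFSet.{u}} (ht : (q.P β).Le t (restrict p β)) :
    ∃ p', (q.P q.len).Le p' p ∧ restrict p' β = t ∧ (∀ ξ < β, fn p' ξ = fn t ξ) ∧
      ∀ ξ, β ≤ ξ → ξ < q.len → fn p' ξ = fn p ξ := by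
  have htc := (hq.isPreorder hβ).left _ _ ht
  refine ⟨glue q.len β t p, hq.glue_le le_rfl hβ hp htc ht, ?_, fun ξ hξ => fn_glue_of_lt hβ hξ,
    fun ξ h1 h2 => fn_glue_of_le h1 h2⟩
  rw [hq.restrict_glue le_rfl hβ htc le_rfl, hq.restrict_self hβ htc]

/-- The length of `p(β)` is decided by an extension of `p ↾ β`; gluing it to `p` changes no
coordinate from `β` on. -/
theorem exists_length (hq : IsIteration C F q) (hp : p ∈ (q.P q.len).carrier) (hβ : β < q.len) :
    ∃ p', (q.P q.len).Le p' p ∧ (∀ ξ, β ≤ ξ → ξ < q.len → fn p' ξ = fn p ξ) ∧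
      ∃ δ < ω₁, (q.P β).ForcesFun (toZFSet δ) (fn p' β) (restrict p' β) := by
  have hP := hq.isPreorder hβ.le
  have hr := hq.restrict_mem le_rfl hβ.le hp
  obtain ⟨t, -, ht, δ, hδ, hf, -⟩ := (hq.coord le_rfl hp hβ).2 _ hr (hP.refl _ hr)
  obtain ⟨p', h1, h2, -, h3⟩ := hq.exists_le_of_le_restrict hp hβ.le ht
  refine ⟨p', h1, h3, δ, hδ, ?_⟩
  rwa [h2, h3 β le_rfl hβ]

/-- The coordinates are treated from the largest down: bounding the one at `b` alters only
coordinates below `b`, so the bounds already found survive. -/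
theorem exists_bd_finset (hq : IsIteration C F q) (u : Finset Ordinal.{u})
    (hu : ∀ b ∈ u, b < q.len) (hp : p ∈ (q.P q.len).carrier) :
    ∃ p', (q.P q.len).Le p' p ∧ ∀ b ∈ u, ∃ δ < ω₁, q.Bd p' b δ := by
  induction u using Finset.induction_on_min with
  | empty => exact ⟨p, (hq.isPreorder le_rfl).refl p hp, by simp⟩
  | insert b u hb ih =>
    obtain ⟨p₁, h1, hbd⟩ := ih fun c hc => hu c (Finset.mem_insert_of_mem hc)
    have hP := hq.isPreorder (le_refl q.len)
    have hbl := hu b (Finset.mem_insert_self _ _)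
    obtain ⟨p₂, h2, heq, δ, hδ, hf⟩ := hq.exists_length (hP.left _ _ h1) hbl
    refine ⟨p₂, hP.trans _ _ _ h2 h1, fun c hc => ?_⟩
    rcases Finset.mem_insert.1 hc with rfl | hc'
    · exact ⟨δ, hδ, hq.bd_of_forcesFun hbl hf⟩
    · obtain ⟨δ', hδ', hd⟩ := hbd c hc'
      exact ⟨δ', hδ', hq.bd_mono (hu c hc) h2 (heq c (hb c hc').le (hu c hc)) hd⟩

/-- The values at the places in `A` of the `β`-th generic function can be prescribed if this is
compatible with what is already decided. -/
theorem exists_val (hq : IsIteration C F q) (hC : IsLadderSystem C) (hF : IsDenseFunction F)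
    (hp : p ∈ (q.P q.len).carrier) (hβ : β < q.len) (A : Finset Ordinal.{u})
    (hA : ∀ ξ ∈ A, ξ < ω₁) (a : Ordinal.{u} → Bool) (hr : q.Ready A p β a) :
    ∃ p', (q.P q.len).Le p' p ∧ (∀ ξ ∈ A, q.Val p' β ξ (a ξ)) ∧
      ∀ ξ, β < ξ → ξ < q.len → fn p' ξ = fn p ξ := by
  classical
  have hP := hq.isPreorder hβ.le
  have hrm := hq.restrict_mem le_rfl hβ.le hp
  have hβs : Order.succ β ≤ q.len := Order.succ_le_of_lt hβ
  obtain ⟨r, hrc, hrp, δ₁, hδ₁, hfun, hcond⟩ := (hq.coord le_rfl hp hβ).2 _ hrm (hP.refl _ hrm)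
  obtain ⟨σ, hσ, hσc, hsub, hval⟩ := ForcingNotion.exists_extension_name hP hC hF
    (hq.g_fun β hβ) hδ₁ hfun hcond A hA a
  -- A condition may only use names in the domain of `Q_β`, and `σ` need not be one; `τ` is one, and
  -- `r'` forces it to equal `σ`.
  obtain ⟨r', hrc', hrr, τ, s, hs, hrs, he⟩ := (hq.Q_eq β hβ σ hσ r hrc).2 hσc r hrc (hP.refl r hrc)
  set f : Ordinal.{u} → ZFSet.{u} := fun ξ => if ξ < β then fn r' ξ else τ
  have flt : ∀ ξ < β, f ξ = fn r' ξ := fun ξ hξ => if_pos hξ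
  have fβ : f β = τ := if_neg (lt_irrefl β)
  have low : ∀ ξ ≤ β, seqCode ξ f = restrict r' ξ := fun ξ hξ => by
    rw [hq.restrict_eq hβ.le hξ hrc']
    exact seqCode_congr fun γ hγ => flt γ (hγ.trans_le hξ)
  have hseq : seqCode β f = r' := by rw [low β le_rfl, hq.restrict_self hβ.le hrc']
  have hrp' := hP.trans _ _ _ hrr hrp
  have hsub' : (q.P β).ForcesSubset (fn p β) τ r' := (hsub.mono hP hrr).trans (he.subset hP)
  have htc : seqCode (Order.succ β) f ∈ (q.P (Order.succ β)).carrier := by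
    have h0 := hrc'
    rw [hq.eq_seqCode hβ.le hrc', hq.seqCode_mem_iff hβ.le] at h0
    refine (hq.seqCode_mem_iff hβs).2 ⟨fun ξ hξ => ?_, ?_⟩
    · rcases (Order.lt_succ_iff.1 hξ).eq_or_lt with rfl | hξ'
      · rw [hseq, fβ]
        exact ⟨hrc', ⟨s, hs⟩, .of_mem hP hs hrs⟩
      · have := h0.1 ξ hξ'
        rwa [low ξ hξ'.le, flt ξ hξ', hq.restrict_eq hβ.le hξ'.le hrc']
    · refine (h0.2.union (Set.countable_singleton β)).mono ?_
      rintro ξ ⟨hξ, hne⟩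
      rcases (Order.lt_succ_iff.1 hξ).eq_or_lt with rfl | hξ'
      · exact .inr rfl
      · exact .inl ⟨hξ', by rwa [flt ξ hξ'] at hne⟩
  have htp : (q.P (Order.succ β)).Le (seqCode (Order.succ β) f) (restrict p (Order.succ β)) := by
    have h1 := hq.restrict_mem le_rfl hβs hp
    rw [hq.restrict_eq le_rfl hβs hp] at h1 ⊢
    refine (hq.le_iff hβs).2 ⟨htc, h1, fun ξ hξ => ?_⟩
    rcases (Order.lt_succ_iff.1 hξ).eq_or_lt with rfl | hξ'
    · rwa [hseq, fβ]
    · have := ((hq.le_iff' hβ.le).1 hrp').2.2 ξ hξ'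
      rwa [hq.restrict_eq le_rfl hβ.le hp, fn_seqCode _ hξ', ← flt ξ hξ', ← low ξ hξ'.le] at this
  obtain ⟨p', h1, h2, h3, h4⟩ := hq.exists_le_of_le_restrict hp hβs htp
  refine ⟨p', h1, fun ξ hξ => ?_, fun ξ hξ => h4 ξ (Order.succ_le_of_lt hξ)⟩
  have e1 : fn p' β = τ := by
    rw [h3 β (Order.lt_succ β), fn_seqCode _ (Order.lt_succ β), fβ]
  have e2 : restrict p' β = r' := by
    rw [hq.restrict_eq le_rfl hβ.le (hq.left_mem le_rfl h1).1, ← hseq]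
    exact seqCode_congr fun γ hγ => by
      rw [h3 γ (hγ.trans (Order.lt_succ β)), fn_seqCode _ (hγ.trans (Order.lt_succ β))]
  rw [IterSeq.Val, e1, e2]
  rcases le_or_gt δ₁ ξ with hξδ | hξδ
  · exact ForcingNotion.ForcesMem.congr_right hP ((hval ξ hξ hξδ).mono hP hrr) he
  · obtain ⟨δ, hbd, hv⟩ := hr
    -- Otherwise the old function would be defined at `δ`, and an extension deciding its value there
    -- would violate the bound.
    have hδ : δ₁ ≤ δ := by
      by_contra hlt
      rw [not_le] at hlt
      obtain ⟨r₁, -, hr₁, v, hv⟩ := hfun.2.1 _ (toZFSet_mem_toZFSet_iff.2 hlt) r hrc (hP.refl r hrc)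
      exact lt_irrefl _ (hbd δ (hlt.trans hδ₁) v r₁ (hP.trans _ _ _ hr₁ hrp) hv)
    exact ((hv ξ hξ (hξδ.trans_le hδ)).mono hP hrp').of_subset hP hrc' hsub'

/-- The coordinates are treated from the smallest up: a step at `b` leaves the names above `b`
unchanged, so later coordinates stay ready, while values already forced persist under extension. -/
theorem exists_val_finset (hq : IsIteration C F q) (hC : IsLadderSystem C)
    (hF : IsDenseFunction F) (A : Finset Ordinal.{u}) (hA : ∀ ξ ∈ A, ξ < ω₁)
    (a : Ordinal.{u} → Ordinal.{u} → Bool) (u : Finset Ordinal.{u}) (hu : ∀ b ∈ u, b < q.len)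
    (hp : p ∈ (q.P q.len).carrier) (hr : ∀ b ∈ u, q.Ready A p b (a b)) :
    ∃ p', (q.P q.len).Le p' p ∧ (∀ b ∈ u, ∀ ξ ∈ A, q.Val p' b ξ (a b ξ)) ∧
      ∀ ξ < q.len, (∀ b ∈ u, b < ξ) → fn p' ξ = fn p ξ := by
  induction u using Finset.induction_on_max with
  | empty => exact ⟨p, (hq.isPreorder le_rfl).refl p hp, by simp⟩
  | insert b u hb ih =>
    obtain ⟨p₁, h1, hv, heq⟩ := ih (fun c hc => hu c (Finset.mem_insert_of_mem hc))
      fun c hc => hr c (Finset.mem_insert_of_mem hc)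
    have hP := hq.isPreorder (le_refl q.len)
    have hbu := Finset.mem_insert_self b u
    have hbl := hu b hbu
    obtain ⟨p₂, h2, hv', heq'⟩ := hq.exists_val hC hF (hP.left _ _ h1) hbl A hA (a b)
      (hq.ready_mono hbl h1 (heq b hbl hb) (hr b hbu))
    refine ⟨p₂, hP.trans _ _ _ h2 h1, fun c hc ξ hξ => ?_, fun ξ hξ h => ?_⟩
    · rcases Finset.mem_insert.1 hc with rfl | hc'
      · exact hv' ξ hξ
      · exact hq.val_mono (hu c hc) h2 (hv c hc' ξ hξ)
    · rw [heq' ξ (h b hbu) hξ, heq ξ hξ fun c hc => h c (Finset.mem_insert_of_mem hc)]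

/-- Once the length of `p(β)` and its values on `A` below the length are decided, these values serve
as a prescription for `exists_val`; above the length the default `false` is as good as any. -/
theorem exists_some_val (hq : IsIteration C F q) (hC : IsLadderSystem C)
    (hF : IsDenseFunction F) (A : Finset Ordinal.{u}) (hA : ∀ ξ ∈ A, ξ < ω₁) (hβ : β < q.len)
    (hp : p ∈ (q.P q.len).carrier) :
    ∃ p', (q.P q.len).Le p' p ∧ ∀ ξ ∈ A, ∃ v, q.Val p' β ξ v := by
  have hPl := hq.isPreorder (le_refl q.len)
  have hP := hq.isPreorder hβ.le
  obtain ⟨p₁, h1, -, δ, hδ, hf⟩ := hq.exists_length hp hβ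
  have hp₁ := hPl.left _ _ h1
  have hr₁ := hq.restrict_mem le_rfl hβ.le hp₁
  obtain ⟨t, ht, hv⟩ := ForcingNotion.exists_le_forall_finset hP A
    (fun ξ s => ξ < δ → ∃ v, (q.P β).ForcesValue (fn p₁ β) (toZFSet ξ) v s)
    (fun ξ s s' h hs hξ => (h hξ).imp fun v hv => hv.mono hP hs) hr₁
    (fun ξ _ => by
      by_cases hξ : ξ < δ
      · exact (hf.2.1 _ (toZFSet_mem_toZFSet_iff.2 hξ)).imp hP fun _ _ h _ => h
      · exact .of_forall hP fun _ _ h => absurd h hξ)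
  obtain ⟨p₂, h2, e1, -, e2⟩ := hq.exists_le_of_le_restrict hp₁ hβ.le ht
  have ha : ∀ ξ : Ordinal.{u}, ∃ v, ξ ∈ A → ξ < δ → q.Val p₂ β ξ v := by
    intro ξ
    by_cases h : ξ ∈ A ∧ ξ < δ
    · obtain ⟨v, hv⟩ := hv ξ h.1 h.2
      refine ⟨v, fun _ _ => ?_⟩
      rwa [IterSeq.Val, e1, e2 β le_rfl hβ]
    · exact ⟨false, fun h1 h2 => absurd ⟨h1, h2⟩ h⟩
  choose a ha using ha
  have hbd : q.Bd p₂ β δ := hq.bd_mono hβ h2 (e2 β le_rfl hβ) (hq.bd_of_forcesFun hβ hf)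
  obtain ⟨p₃, h3, hv3, -⟩ := hq.exists_val hC hF (hPl.left _ _ h2) hβ A hA a ⟨δ, hbd, ha⟩
  exact ⟨p₃, hPl.trans _ _ _ h3 (hPl.trans _ _ _ h2 h1), fun ξ hξ => ⟨a ξ, hv3 ξ hξ⟩⟩

/-- What is required of the conditions at the next level of the tree. -/
structure _root_.CondTree.IterSeq.Done (q : IterSeq.{u}) (D : ZFSet.{u})
    (A u : Finset Ordinal.{u}) (b' : Ordinal.{u}) (a : Ordinal.{u} → Ordinal.{u} → Bool)
    (p : ZFSet.{u}) : Prop where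
  mem : p ∈ D
  val : ∀ b ∈ u, ∀ ξ ∈ A, q.Val p b ξ (a b ξ)
  some_val : ∀ ξ ∈ A, ∃ v, q.Val p b' ξ v
  bd : ∀ b, b ∈ u ∨ b = b' → ∃ δ < ω₁, q.Bd p b δ

/-- The order of the four extensions matters: forced values and membership in the open set `D`
persist, bounds on domains do not, so the bounds come last. -/
theorem exists_done (hq : IsIteration C F q) (hC : IsLadderSystem C) (hF : IsDenseFunction F)
    {D : ZFSet.{u}} (hD : (q.P q.len).IsDenseOpen D) (A : Finset Ordinal.{u})
    (hA : ∀ ξ ∈ A, ξ < ω₁) (u : Finset Ordinal.{u}) (hu : ∀ b ∈ u, b < q.len) (hβ : β < q.len)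
    (a : Ordinal.{u} → Ordinal.{u} → Bool) (hp : p ∈ (q.P q.len).carrier)
    (hr : ∀ b ∈ u, q.Ready A p b (a b)) :
    ∃ p', (q.P q.len).Le p' p ∧ q.Done D A u β a p' := by
  classical
  have hP := hq.isPreorder (le_refl q.len)
  obtain ⟨p₁, h1, hv1, -⟩ := hq.exists_val_finset hC hF A hA a u hu hp hr
  obtain ⟨p₂, h2, hv2⟩ := hq.exists_some_val hC hF A hA hβ (hP.left _ _ h1)
  obtain ⟨p₃, hp₃, h3⟩ := hD.2.1 p₂ (hP.left _ _ h2)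
  have hu' : ∀ b ∈ insert β u, b < q.len := by
    intro b hb
    rcases Finset.mem_insert.1 hb with rfl | hb
    · exact hβ
    · exact hu b hb
  obtain ⟨p₄, h4, hbd⟩ := hq.exists_bd_finset (insert β u) hu' (hP.left _ _ h3)
  have h42 := hP.trans _ _ _ h4 h3
  refine ⟨p₄, hP.trans _ _ _ h42 (hP.trans _ _ _ h2 h1),
    hD.2.2 p₃ hp₃ p₄ (hP.left _ _ h4) h4, fun b hb ξ hξ => ?_, fun ξ hξ => ?_, fun b hb => ?_⟩
  · exact hq.val_mono (hu b hb) (hP.trans _ _ _ h42 h2) (hv1 b hb ξ hξ)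
  · exact (hv2 ξ hξ).imp fun v hv => hq.val_mono hβ h42 hv
  · exact hbd b (Finset.mem_insert.2 hb.symm)

/-- Conditions whose values `a` agree on the elements of `u` below `β` agree below `β`. -/
def _root_.CondTree.Coherent {ι : Type*} (l : Ordinal.{u}) (u : Finset Ordinal.{u})
    (a : ι → Ordinal.{u} → Ordinal.{u} → Bool) (p : ι → ZFSet.{u}) : Prop :=
  ∀ i j, ∀ β ≤ l, (∀ b ∈ u, b < β → a i b = a j b) → restrict (p i) β = restrict (p j) β

/-- Extending one condition of a coherent family and changing the others accordingly. -/
theorem exists_propagate (hq : IsIteration C F q) {ι : Type*} {u : Finset Ordinal.{u}}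
    (hu : ∀ b ∈ u, b < q.len) {a : ι → Ordinal.{u} → Ordinal.{u} → Bool} {p : ι → ZFSet.{u}}
    (hp : ∀ i, p i ∈ (q.P q.len).carrier) (hc : Coherent q.len u a p) (i₀ : ι) {r : ZFSet.{u}}
    (hr : (q.P q.len).Le r (p i₀)) :
    ∃ p' : ι → ZFSet.{u}, (∀ i, (q.P q.len).Le (p' i) (p i)) ∧ Coherent q.len u a p' ∧
      p' i₀ = r ∧ ∀ i, ∀ β < q.len,
        (fn (p' i) β = fn r β ∧ restrict (p' i) β = restrict r β ∧ (β ∈ u → a i₀ β = a i β)) ∨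
        fn (p' i) β = fn (p i) β := by
  classical
  have hP := hq.isPreorder (le_refl q.len)
  have hrc := hP.left _ _ hr
  -- `B i` is the least coordinate in `u` at which the prescriptions of `i₀` and `i` differ, or the
  -- length of the iteration if there is none. Below it the old conditions agree, so `r` can be
  -- copied there.
  set B : ι → Ordinal.{u} := fun i => sInf ({b | b ∈ u ∧ a i₀ b ≠ a i b} ∪ {q.len}) with hB
  have hBl : ∀ i, B i ≤ q.len := fun i => csInf_le' (.inr rfl)
  have hBlt : ∀ i ξ, ξ < q.len → (ξ < B i ↔ ∀ b ∈ u, b ≤ ξ → a i₀ b = a i b) := by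
    intro i ξ hξ
    constructor
    · intro h b hb hbξ
      by_contra hne
      exact absurd (hbξ.trans_lt h) (not_lt.2 (csInf_le' (.inl ⟨hb, hne⟩)))
    · intro h
      have hmem : B i ∈ {b | b ∈ u ∧ a i₀ b ≠ a i b} ∪ {q.len} := csInf_mem ⟨q.len, .inr rfl⟩
      rcases hmem with ⟨h1, h2⟩ | h1
      · by_contra hle
        exact h2 (h _ h1 (not_lt.1 hle))
      · rw [h1]
        exact hξ
  have hag : ∀ i, restrict (p i₀) (B i) = restrict (p i) (B i) := fun i =>
    hc i₀ i (B i) (hBl i) fun b hb hbB => (hBlt i b (hu b hb)).1 hbB b hb le_rfl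
  have hrB : ∀ i, (q.P (B i)).Le (restrict r (B i)) (restrict (p i) (B i)) := fun i => by
    rw [← hag i]
    exact hq.le_restrict le_rfl (hBl i) hr
  choose p' h1 h2 h3 h4 using fun i => hq.exists_le_of_le_restrict (hp i) (hBl i) (hrB i)
  have hp' : ∀ i, p' i ∈ (q.P q.len).carrier := fun i => hP.left _ _ (h1 i)
  have h3' : ∀ i, ∀ ξ < B i, fn (p' i) ξ = fn r ξ := fun i ξ hξ => by
    rw [h3 i ξ hξ, hq.restrict_eq le_rfl (hBl i) hrc, fn_seqCode _ hξ]
  refine ⟨p', h1, ?_, ?_, ?_⟩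
  · intro i j β hβ hab
    rw [hq.restrict_eq le_rfl hβ (hp' i), hq.restrict_eq le_rfl hβ (hp' j)]
    refine seqCode_congr fun ξ hξ => ?_
    have hξl := hξ.trans_le hβ
    have hiff : ξ < B i ↔ ξ < B j := by
      rw [hBlt i ξ hξl, hBlt j ξ hξl]
      refine forall₃_congr fun b hb hbξ => ?_
      rw [hab b hb (hbξ.trans_lt hξ)]
    by_cases h : ξ < B i
    · rw [h3' i ξ h, h3' j ξ (hiff.1 h)]
    · rw [h4 i ξ (not_lt.1 h) hξl, h4 j ξ (not_lt.1 (hiff.not.1 h)) hξl]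
      have := hc i j β hβ hab
      rw [hq.restrict_eq le_rfl hβ (hp i), hq.restrict_eq le_rfl hβ (hp j)] at this
      exact eq_of_seqCode_eq this hξ
  · have hB0 : B i₀ = q.len := by simp [hB]
    have := h2 i₀
    rwa [hB0, hq.restrict_self le_rfl (hp' i₀), hq.restrict_self le_rfl hrc] at this
  · intro i β hβ
    by_cases h : β < B i
    · refine .inl ⟨h3' i β h, ?_, fun hβu => (hBlt i β hβ).1 h β hβu le_rfl⟩
      rw [hq.restrict_eq le_rfl hβ.le (hp' i), hq.restrict_eq le_rfl hβ.le hrc]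
      exact seqCode_congr fun ξ hξ => h3' i ξ (hξ.trans h)
    · exact .inr (h4 i β (not_lt.1 h) hβ)

/-- The indices are treated one after another: one condition is brought to its goal by
`exists_done`, and `exists_propagate` adjusts all the others. The induction carries coherence and
readiness for every index, including those not yet treated. -/
theorem exists_family (hq : IsIteration C F q) (hC : IsLadderSystem C) (hF : IsDenseFunction F)
    {D : ZFSet.{u}} (hD : (q.P q.len).IsDenseOpen D) (A : Finset Ordinal.{u})
    (hA : ∀ ξ ∈ A, ξ < ω₁) (u : Finset Ordinal.{u}) (hu : ∀ b ∈ u, b < q.len) (hβ : β < q.len)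
    {ι : Type*} [Finite ι] {a : ι → Ordinal.{u} → Ordinal.{u} → Bool} {p : ι → ZFSet.{u}}
    (hp : ∀ i, p i ∈ (q.P q.len).carrier) (hc : Coherent q.len u a p)
    (hr : ∀ i, ∀ b ∈ u, q.Ready A (p i) b (a i b)) :
    ∃ p' : ι → ZFSet.{u}, (∀ i, (q.P q.len).Le (p' i) (p i) ∧ q.Done D A u β (a i) (p' i)) ∧
      Coherent q.len u a p' := by
  classical
  have := Fintype.ofFinite ι
  have hP := hq.isPreorder (le_refl q.len)
  suffices H : ∀ s : Finset ι, ∃ p' : ι → ZFSet.{u}, (∀ i, (q.P q.len).Le (p' i) (p i)) ∧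
      Coherent q.len u a p' ∧ (∀ i, ∀ b ∈ u, q.Ready A (p' i) b (a i b)) ∧
      ∀ i ∈ s, q.Done D A u β (a i) (p' i) by
    obtain ⟨p', h1, h2, -, h3⟩ := H Finset.univ
    exact ⟨p', fun i => ⟨h1 i, h3 i (Finset.mem_univ i)⟩, h2⟩
  intro s
  induction s using Finset.induction_on with
  | empty => exact ⟨p, fun i => hP.refl _ (hp i), hc, hr, by simp⟩
  | insert i₀ s _ ih =>
    obtain ⟨p₁, h1, hc1, hr1, hd1⟩ := ih
    have hp₁ : ∀ i, p₁ i ∈ (q.P q.len).carrier := fun i => hP.left _ _ (h1 i)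
    obtain ⟨r, hrle, hrd⟩ := hq.exists_done hC hF hD A hA u hu hβ (a i₀) (hp₁ i₀) (hr1 i₀)
    obtain ⟨p₂, h2, hc2, he, hpr⟩ := hq.exists_propagate hu hp₁ hc1 i₀ hrle
    refine ⟨p₂, fun i => hP.trans _ _ _ (h2 i) (h1 i), hc2, fun i b hb => ?_, fun i hi => ?_⟩
    -- A coordinate copied from `r` has its values on `A` decided, and as prescribed for `i`, since
    -- the two prescriptions agree at `b`; an uncopied coordinate keeps its name and hence stays
    -- ready.
    · rcases hpr i b (hu b hb) with ⟨e1, e2, e3⟩ | e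
      · obtain ⟨δ, -, hδ⟩ := hrd.bd b (.inl hb)
        refine ⟨δ, ?_, fun ξ hξ _ => ?_⟩
        · rwa [IterSeq.Bd, e1, e2]
        · rw [IterSeq.Val, e1, e2, ← e3 hb]
          exact hrd.val b hb ξ hξ
      · exact hq.ready_mono (hu b hb) (h2 i) e (hr1 i b hb)
    · rcases Finset.mem_insert.1 hi with rfl | hi
      · rw [he]
        exact hrd
      · have hd := hd1 i hi
        refine ⟨hD.2.2 _ hd.mem _ (hP.left _ _ (h2 i)) (h2 i),
          fun b hb ξ hξ => hq.val_mono (hu b hb) (h2 i) (hd.val b hb ξ hξ),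
          fun ξ hξ => (hd.some_val ξ hξ).imp fun v hv => hq.val_mono hβ (h2 i) hv, fun b hb => ?_⟩
        have hbl : b < q.len := by
          rcases hb with hb | rfl
          · exact hu b hb
          · exact hβ
        rcases hpr i b hbl with ⟨e1, e2, -⟩ | e
        · obtain ⟨δ, hδ, hbd⟩ := hrd.bd b hb
          refine ⟨δ, hδ, ?_⟩
          rwa [IterSeq.Bd, e1, e2]
        · obtain ⟨δ, hδ, hbd⟩ := hd.bd b hb
          exact ⟨δ, hδ, hq.bd_mono hbl (h2 i) e hbd⟩

end IsIteration

/-! ### Closure properties of `H(μ⁺)` -/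

theorem mem_trcl {x y : ZFSet.{u}} :
    y ∈ trcl x ↔ Relation.TransGen (fun a b : ZFSet.{u} => a ∈ b) y x := by
  rw [trcl, mem_sep, mem_vonNeumann]
  refine and_iff_right_of_imp fun h => ?_
  induction h with
  | single h => exact rank_lt_of_mem h
  | tail _ h ih => exact ih.trans (rank_lt_of_mem h)

theorem subset_trcl (x : ZFSet.{u}) : x ⊆ trcl x := fun _ h => mem_trcl.2 (.single h)

theorem mem_trcl_of_mem {x y z : ZFSet.{u}} (h : z ∈ y) (hy : y ∈ trcl x) : z ∈ trcl x :=
  mem_trcl.2 (.head h (mem_trcl.1 hy))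

theorem trcl_subset {x T : ZFSet.{u}} (hx : x ⊆ T) (hT : ∀ y ∈ T, y ⊆ T) : trcl x ⊆ T := by
  intro y hy
  rw [mem_trcl] at hy
  induction hy using Relation.TransGen.head_induction_on with
  | single h => exact hx h
  | head h _ ih => exact hT _ ih h

theorem trcl_mono_of_subset {x y : ZFSet.{u}} (h : y ⊆ x) : trcl y ⊆ trcl x :=
  trcl_subset (fun _ hz => subset_trcl x (h hz)) fun _ hy _ hz => mem_trcl_of_mem hz hy

theorem trcl_mono_of_mem {x y : ZFSet.{u}} (h : y ∈ x) : trcl y ⊆ trcl x :=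
  trcl_subset (fun _ hz => mem_trcl_of_mem hz (subset_trcl x h))
    fun _ hy _ hz => mem_trcl_of_mem hz hy

theorem HSet.of_mem {κ : Cardinal.{u}} {x y : ZFSet.{u}} (hx : x ∈ HSet κ) (h : y ∈ x) :
    y ∈ HSet κ :=
  (card_mono (trcl_mono_of_mem h)).trans_lt hx

theorem HSet.of_subset {κ : Cardinal.{u}} {x y : ZFSet.{u}} (hx : x ∈ HSet κ) (h : y ⊆ x) :
    y ∈ HSet κ :=
  (card_mono (trcl_mono_of_subset h)).trans_lt hx

theorem HSet.trcl_mem {κ : Cardinal.{u}} {x : ZFSet.{u}} (hx : x ∈ HSet κ) : trcl x ∈ HSet κ :=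
  (card_mono (trcl_subset (fun _ h => h) fun _ hy _ hz => mem_trcl_of_mem hz hy)).trans_lt hx

section Succ

variable {μ : Cardinal.{u}}

theorem mem_HSet_succ {x : ZFSet.{u}} : x ∈ HSet (Order.succ μ) ↔ card (trcl x) ≤ μ := by
  rw [HSet, Set.mem_ofPred_eq, Order.lt_succ_iff]

theorem HSet.card_le {x : ZFSet.{u}} (hx : x ∈ HSet (Order.succ μ)) : card x ≤ μ :=
  (card_mono (subset_trcl x)).trans (mem_HSet_succ.1 hx)

/-- The transitive closure of `x` is covered by `x` and at most μ sets of size at most μ. -/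
theorem HSet.of_forall_mem (hμ : ℵ₀ ≤ μ) {x : ZFSet.{u}}
    (h : ∀ y ∈ x, y ∈ HSet (Order.succ μ)) (hx : card x ≤ μ) : x ∈ HSet (Order.succ μ) := by
  rw [mem_HSet_succ]
  have hsub : trcl x ⊆ x ∪ ⋃ y : {y // y ∈ x}, trcl y.val := by
    refine trcl_subset (fun y hy => mem_union.2 (.inl hy)) fun y hy z hz => ?_
    refine mem_union.2 (.inr (mem_iUnion.2 ?_))
    rcases mem_union.1 hy with hy | hy
    · exact ⟨⟨y, hy⟩, subset_trcl y hz⟩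
    · obtain ⟨w, hw⟩ := mem_iUnion.1 hy
      exact ⟨w, mem_trcl_of_mem hz hw⟩
  refine (card_mono hsub).trans (card_union_le.trans ?_)
  have h2 : card (⋃ y : {y // y ∈ x}, trcl y.val) ≤ μ := by
    rw [← Cardinal.lift_le.{u + 1}]
    refine lift_card_iUnion_le_sum_card.trans ?_
    have h4 : ∀ y : {y // y ∈ x}, card (trcl y.val) ≤ μ := fun y =>
      mem_HSet_succ.1 (h y.val y.property)
    refine (Cardinal.sum_le_sum _ (fun _ : {y // y ∈ x} => μ) h4).trans ?_
    have h3 : #{y // y ∈ x} = Cardinal.lift.{u + 1} (card x) := cardinalMk_coe_sort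
    rw [Cardinal.sum_const, h3, Cardinal.lift_lift, ← Cardinal.lift_mul, Cardinal.lift_le]
    exact (mul_le_mul' hx le_rfl).trans (Cardinal.mul_eq_self hμ).le
  exact (add_le_add hx h2).trans (Cardinal.add_eq_self hμ).le

theorem HSet.pair_set (hμ : ℵ₀ ≤ μ) {x y : ZFSet.{u}} (hx : x ∈ HSet (Order.succ μ))
    (hy : y ∈ HSet (Order.succ μ)) : ({x, y} : ZFSet.{u}) ∈ HSet (Order.succ μ) := by
  refine HSet.of_forall_mem hμ (fun z hz => ?_) ?_
  · rcases mem_pair.1 hz with rfl | rfl <;> assumption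
  · refine card_insert_le.trans ?_
    rw [card_singleton, one_add_one_eq_two]
    exact (Cardinal.natCast_lt_aleph0 (n := 2)).le.trans hμ

theorem HSet.singleton (hμ : ℵ₀ ≤ μ) {x : ZFSet.{u}} (hx : x ∈ HSet (Order.succ μ)) :
    ({x} : ZFSet.{u}) ∈ HSet (Order.succ μ) := by
  have := HSet.pair_set hμ hx hx
  rwa [pair_eq_singleton] at this

theorem HSet.pair (hμ : ℵ₀ ≤ μ) {x y : ZFSet.{u}} (hx : x ∈ HSet (Order.succ μ))
    (hy : y ∈ HSet (Order.succ μ)) : pair x y ∈ HSet (Order.succ μ) :=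
  HSet.pair_set hμ (HSet.singleton hμ hx) (HSet.pair_set hμ hx hy)

theorem HSet.prod (hμ : ℵ₀ ≤ μ) {x y : ZFSet.{u}} (hx : x ∈ HSet (Order.succ μ))
    (hy : y ∈ HSet (Order.succ μ)) : prod x y ∈ HSet (Order.succ μ) := by
  refine HSet.of_forall_mem hμ (fun z hz => ?_) ?_
  · obtain ⟨a, ha, b, hb, rfl⟩ := mem_prod.1 hz
    exact HSet.pair hμ (HSet.of_mem hx ha) (HSet.of_mem hy hb)
  · have hsub : ZFSet.prod x y ⊆
        range fun z : {a // a ∈ x} × {b // b ∈ y} => ZFSet.pair z.1.val z.2.val := by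
      intro z hz
      obtain ⟨a, ha, b, hb, rfl⟩ := mem_prod.1 hz
      exact mem_range.2 ⟨(⟨a, ha⟩, ⟨b, hb⟩), rfl⟩
    refine (card_mono hsub).trans ?_
    rw [← Cardinal.lift_le.{u + 1}]
    refine lift_card_range_le.trans ?_
    have h3 : ∀ x : ZFSet.{u}, #{y // y ∈ x} = Cardinal.lift.{u + 1} (card x) :=
      fun _ => cardinalMk_coe_sort
    rw [Cardinal.mk_prod, h3, h3, ← Cardinal.lift_mul, ← Cardinal.lift_mul, Cardinal.lift_id,
      Cardinal.lift_id'.{u, u + 1}, Cardinal.lift_le]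
    exact (mul_le_mul' (HSet.card_le hx) (HSet.card_le hy)).trans (Cardinal.mul_eq_self hμ).le

theorem HSet.union (hμ : ℵ₀ ≤ μ) {x y : ZFSet.{u}} (hx : x ∈ HSet (Order.succ μ))
    (hy : y ∈ HSet (Order.succ μ)) : x ∪ y ∈ HSet (Order.succ μ) := by
  refine HSet.of_forall_mem hμ (fun z hz => ?_) ?_
  · exact (mem_union.1 hz).elim (HSet.of_mem hx) (HSet.of_mem hy)
  · exact card_union_le.trans ((add_le_add (HSet.card_le hx) (HSet.card_le hy)).trans
      (Cardinal.add_eq_self hμ).le)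

end Succ

/-! ### Definability in `H(κ)` -/

section Definability

variable {κ : Cardinal.{u}}

/-- The relation `R` is definable in `H(κ)` with parameters in `A`. -/
def Dfn (A : Set (HSet κ)) {ι : Type*} (R : (ι → HSet κ) → Prop) : Prop :=
  A.Definable setLang {v | R v}

/-- `f` is a variable or a parameter in `A`. -/
def Tm (A : Set (HSet κ)) {ι : Type*} (f : (ι → HSet κ) → HSet κ) : Prop :=
  (∃ i, f = fun v => v i) ∨ ∃ a ∈ A, f = fun _ => a

variable {A : Set (HSet κ)} {ι : Type*}

theorem Tm.var (i : ι) : Tm A fun v => v i := .inl ⟨i, rfl⟩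

theorem Tm.const {a : HSet κ} (ha : a ∈ A) : Tm A fun _ : ι → HSet κ => a := .inr ⟨a, ha, rfl⟩

theorem Tm.lift {f : (ι → HSet κ) → HSet κ} (h : Tm A f) :
    Tm A fun w : ι ⊕ Unit → HSet κ => f fun i => w (.inl i) := by
  rcases h with ⟨i, rfl⟩ | ⟨a, ha, rfl⟩
  · exact .inl ⟨_, rfl⟩
  · exact .inr ⟨a, ha, rfl⟩

theorem Dfn.congr {R R' : (ι → HSet κ) → Prop} (h : Dfn A R) (he : ∀ v, R' v ↔ R v) :
    Dfn A R' := by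
  rwa [show R' = R from funext fun v => propext (he v)]

theorem Tm.exists_term {f : (ι → HSet κ) → HSet κ} (h : Tm A f) :
    ∃ t : setLang.Term (A ⊕ ι), ∀ v : ι → HSet κ, t.realize (Sum.elim (↑) v) = f v := by
  rcases h with ⟨i, rfl⟩ | ⟨a, ha, rfl⟩
  · exact ⟨.var (.inr i), fun v => rfl⟩
  · exact ⟨.var (.inl ⟨a, ha⟩), fun v => rfl⟩

/-- The membership symbol. -/
def memRel : setLang.Relations 2 := SetRel.mem

theorem Dfn.mem {f g : (ι → HSet κ) → HSet κ} (hf : Tm A f) (hg : Tm A g) :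
    Dfn A fun v => (f v).1 ∈ (g v).1 := by
  obtain ⟨s, hs⟩ := hf.exists_term
  obtain ⟨t, ht⟩ := hg.exists_term
  rw [Dfn, Set.definable_iff_exists_formula_sum]
  refine ⟨FirstOrder.Language.Relations.formula₂ memRel s t, ?_⟩
  ext v
  rw [Set.mem_ofPred_eq, Set.mem_ofPred_eq, FirstOrder.Language.Formula.realize_rel₂, hs, ht]
  rfl

theorem Dfn.eq {f g : (ι → HSet κ) → HSet κ} (hf : Tm A f) (hg : Tm A g) :
    Dfn A fun v => (f v).1 = (g v).1 := by
  obtain ⟨s, hs⟩ := hf.exists_term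
  obtain ⟨t, ht⟩ := hg.exists_term
  rw [Dfn, Set.definable_iff_exists_formula_sum]
  refine ⟨s.equal t, ?_⟩
  ext v
  rw [Set.mem_ofPred_eq, Set.mem_ofPred_eq, FirstOrder.Language.Formula.realize_equal, hs, ht,
    Subtype.ext_iff]

theorem Dfn.and {R R' : (ι → HSet κ) → Prop} (h : Dfn A R) (h' : Dfn A R') :
    Dfn A fun v => R v ∧ R' v :=
  Set.Definable.inter h h'

theorem Dfn.or {R R' : (ι → HSet κ) → Prop} (h : Dfn A R) (h' : Dfn A R') :
    Dfn A fun v => R v ∨ R' v :=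
  Set.Definable.union h h'

theorem Dfn.not {R : (ι → HSet κ) → Prop} (h : Dfn A R) : Dfn A fun v => ¬ R v :=
  Set.Definable.compl h

theorem Dfn.imp {R R' : (ι → HSet κ) → Prop} (h : Dfn A R) (h' : Dfn A R') :
    Dfn A fun v => R v → R' v :=
  (h.not.or h').congr fun _ => imp_iff_not_or

theorem Dfn.iff {R R' : (ι → HSet κ) → Prop} (h : Dfn A R) (h' : Dfn A R') :
    Dfn A fun v => (R v ↔ R' v) :=
  ((h.imp h').and (h'.imp h)).congr fun _ => iff_iff_implies_and_implies

theorem Dfn.ex {R : (ι → HSet κ) → HSet κ → Prop}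
    (h : Dfn A fun w : ι ⊕ Unit → HSet κ => R (fun i => w (.inl i)) (w (.inr ()))) :
    Dfn A fun v => ∃ x, R v x := by
  refine Dfn.congr (Set.Definable.exists_of_finite h) fun v => ?_
  exact ⟨fun ⟨x, hx⟩ => ⟨fun _ => x, hx⟩, fun ⟨x, hx⟩ => ⟨x (), hx⟩⟩

theorem Dfn.all {R : (ι → HSet κ) → HSet κ → Prop}
    (h : Dfn A fun w : ι ⊕ Unit → HSet κ => R (fun i => w (.inl i)) (w (.inr ()))) :
    Dfn A fun v => ∀ x, R v x :=
  (Dfn.not (Dfn.ex (R := fun v x => ¬ R v x) (Dfn.not h))).congr fun v => by simp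

theorem Dfn.forall_finite {J : Type*} [Finite J] {R : J → (ι → HSet κ) → Prop}
    (h : ∀ j, Dfn A (R j)) : Dfn A fun v => ∀ j, R j v :=
  Dfn.congr (R := fun v => v ∈ ⋂ j, {v | R j v}) (Set.definable_iInter_of_finite h)
    fun v => by simp

theorem Dfn.of_prop (P : Prop) : Dfn A fun _ : ι → HSet κ => P := by
  by_cases h : P
  · exact Dfn.congr (R := fun v => v ∈ Set.univ) Set.definable_univ fun v => by simp [h]
  · exact Dfn.congr (R := fun v => v ∈ (∅ : Set _)) Set.definable_empty fun v => by simp [h]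

/-- An elementary substructure meets every nonempty relation definable with parameters from it. -/
theorem exists_mem_of_dfn [Finite ι] (S : setLang.ElementarySubstructure (HSet κ))
    {R : (ι → HSet κ) → Prop} (h : Dfn (S : Set (HSet κ)) R) (hex : ∃ v, R v) :
    ∃ v, R v ∧ ∀ i, v i ∈ S := by
  rw [Dfn, Set.definable_iff_exists_formula_sum] at h
  obtain ⟨φ, hφ⟩ := h
  have hR : ∀ v, R v ↔ φ.Realize (Sum.elim (↑) v) := fun v => by
    have := Set.ext_iff.1 hφ v
    exact this
  have h1 : (φ.iExs ι).Realize (fun s : (S : Set (HSet κ)) => (s : HSet κ)) := by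
    rw [FirstOrder.Language.Formula.realize_iExs]
    obtain ⟨v, hv⟩ := hex
    exact ⟨v, (hR v).1 hv⟩
  have h2 : (φ.iExs ι).Realize (fun s : (S : Set (HSet κ)) => (⟨s.1, s.2⟩ : S)) := by
    rw [← S.subtype.map_formula]
    exact h1
  rw [FirstOrder.Language.Formula.realize_iExs] at h2
  obtain ⟨v, hv⟩ := h2
  refine ⟨fun i => v i, (hR _).2 ?_, fun i => (v i).2⟩
  rw [← S.subtype.map_formula] at hv
  convert hv using 1
  funext z
  cases z <;> rfl

/-! ### Definability of pairs and tuples -/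

section Succ

variable {μ : Cardinal.{u}} {A : Set (HSet (Order.succ μ))}
  {f g h k l : (ι → HSet (Order.succ μ)) → HSet (Order.succ μ)}

/-- Since `H(μ⁺)` is transitive, an unordered pair is recognised by quantifying over elements of
`H(μ⁺)` only. -/
theorem Dfn.eq_pairSet (hf : Tm A f) (hg : Tm A g) (hh : Tm A h) :
    Dfn A fun v => (h v).1 = {(f v).1, (g v).1} := by
  refine Dfn.congr (R := fun v => ∀ x : HSet (Order.succ μ), x.1 ∈ (h v).1 ↔
    (x.1 = (f v).1 ∨ x.1 = (g v).1)) (Dfn.all (Dfn.iff (Dfn.mem (Tm.var _) hh.lift)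
      (Dfn.or (Dfn.eq (Tm.var _) hf.lift) (Dfn.eq (Tm.var _) hg.lift)))) fun v => ?_
  constructor
  · intro he x
    rw [he, mem_pair]
  · intro he
    ext x
    rw [mem_pair]
    constructor
    · intro hx
      exact (he ⟨x, HSet.of_mem (h v).2 hx⟩).1 hx
    · intro hx
      refine (he ⟨x, ?_⟩).2 hx
      rcases hx with rfl | rfl
      exacts [(f v).2, (g v).2]

theorem Dfn.eq_pair (hμ : ℵ₀ ≤ μ) (hf : Tm A f) (hg : Tm A g) (hh : Tm A h) :
    Dfn A fun v => (h v).1 = pair (f v).1 (g v).1 := by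
  refine Dfn.congr (R := fun v => ∃ x y : HSet (Order.succ μ), x.1 = {(f v).1, (f v).1} ∧
    y.1 = {(f v).1, (g v).1} ∧ (h v).1 = {x.1, y.1})
    (Dfn.ex (Dfn.ex ((Dfn.eq_pairSet hf.lift.lift hf.lift.lift (Tm.var _)).and
      ((Dfn.eq_pairSet hf.lift.lift hg.lift.lift (Tm.var _)).and
        (Dfn.eq_pairSet (Tm.var _) (Tm.var _) hh.lift.lift))))) fun v => ?_
  constructor
  · intro he
    exact ⟨⟨_, HSet.pair_set hμ (f v).2 (f v).2⟩, ⟨_, HSet.pair_set hμ (f v).2 (g v).2⟩, rfl, rfl,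
      by simp only [he, pair_eq_singleton, pair]⟩
  · rintro ⟨x, y, hx, hy, he⟩
    rw [he, hx, hy, pair_eq_singleton, pair]

theorem Dfn.pair_mem (hμ : ℵ₀ ≤ μ) (hf : Tm A f) (hg : Tm A g) (hh : Tm A h) :
    Dfn A fun v => pair (f v).1 (g v).1 ∈ (h v).1 := by
  refine Dfn.congr (R := fun v => ∃ x : HSet (Order.succ μ), x.1 = pair (f v).1 (g v).1 ∧
    x.1 ∈ (h v).1) (Dfn.ex ((Dfn.eq_pair hμ hf.lift hg.lift (Tm.var _)).and
      (Dfn.mem (Tm.var _) hh.lift))) fun v => ?_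
  constructor
  · intro he
    exact ⟨⟨_, HSet.pair hμ (f v).2 (g v).2⟩, rfl, he⟩
  · rintro ⟨x, hx, he⟩
    rwa [← hx]

theorem Dfn.triple_mem (hμ : ℵ₀ ≤ μ) (hf : Tm A f) (hg : Tm A g) (hk : Tm A k) (hh : Tm A h) :
    Dfn A fun v => pair (f v).1 (pair (g v).1 (k v).1) ∈ (h v).1 := by
  refine Dfn.congr (R := fun v => ∃ x : HSet (Order.succ μ), x.1 = pair (g v).1 (k v).1 ∧
    pair (f v).1 x.1 ∈ (h v).1) (Dfn.ex ((Dfn.eq_pair hμ hg.lift hk.lift (Tm.var _)).and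
      (Dfn.pair_mem hμ hf.lift (Tm.var _) hh.lift))) fun v => ?_
  constructor
  · intro he
    exact ⟨⟨_, HSet.pair hμ (g v).2 (k v).2⟩, rfl, he⟩
  · rintro ⟨x, hx, he⟩
    rwa [← hx]

theorem Dfn.quadruple_mem (hμ : ℵ₀ ≤ μ) (hf : Tm A f) (hg : Tm A g) (hk : Tm A k) (hl : Tm A l)
    (hh : Tm A h) :
    Dfn A fun v => pair (f v).1 (pair (g v).1 (pair (k v).1 (l v).1)) ∈ (h v).1 := by
  refine Dfn.congr (R := fun v => ∃ x : HSet (Order.succ μ), x.1 = pair (k v).1 (l v).1 ∧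
    pair (f v).1 (pair (g v).1 x.1) ∈ (h v).1) (Dfn.ex ((Dfn.eq_pair hμ hk.lift hl.lift
      (Tm.var _)).and (Dfn.triple_mem hμ hf.lift hg.lift (Tm.var _) hh.lift))) fun v => ?_
  constructor
  · intro he
    exact ⟨⟨_, HSet.pair hμ (k v).2 (l v).2⟩, rfl, he⟩
  · rintro ⟨x, hx, he⟩
    rwa [← hx]

end Succ
end Definability

/-! ### Elementary submodels of `H(μ⁺)` -/

theorem HSet.toZFSet_mem {μ : Cardinal.{u}} {o : Ordinal.{u}} (h : o.card ≤ μ) :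
    toZFSet o ∈ HSet (Order.succ μ) := by
  rw [mem_HSet_succ]
  refine (card_mono (trcl_subset (T := toZFSet o) (fun _ h => h) fun y hy => ?_)).trans ?_
  · exact (isOrdinal_toZFSet o).subset_of_mem hy
  · rwa [card_toZFSet]

/-- The elements of `Y` as elements of `H(κ)`. -/
def params (Y : ZFSet.{u}) (κ : Cardinal.{u}) : Set (HSet κ) := {x | x.1 ∈ Y}

namespace IsElemSub

variable {Y : ZFSet.{u}} {κ μ : Cardinal.{u}}

theorem mem_HSet (hY : IsElemSub Y κ) {x : ZFSet.{u}} (hx : x ∈ Y) : x ∈ HSet κ := by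
  obtain ⟨S, hS⟩ := hY
  exact ((hS x).1 hx).1

theorem exists_mem (hY : IsElemSub Y κ) {ι : Type*} [Finite ι] {R : (ι → HSet κ) → Prop}
    (h : Dfn (params Y κ) R) (hex : ∃ v, R v) : ∃ v, R v ∧ ∀ i, (v i).1 ∈ Y := by
  obtain ⟨S, hS⟩ := hY
  have hSY : params Y κ = (S : Set (HSet κ)) := by
    ext x
    refine (hS x.1).trans ?_
    exact ⟨fun ⟨_, h⟩ => h, fun h => ⟨x.2, h⟩⟩
  rw [hSY] at h
  obtain ⟨v, hv, hvS⟩ := exists_mem_of_dfn S h hex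
  exact ⟨v, hv, fun i => (hS _).2 ⟨(v i).2, hvS i⟩⟩

/-- Elementarity yields some witness in `Y`, and uniqueness leaves no choice: objects definable from
parameters in `Y` lie in `Y`. -/
theorem mem_of_unique (hY : IsElemSub Y κ) {R : HSet κ → Prop}
    (h : Dfn (params Y κ) fun v : Unit → HSet κ => R (v ())) {x : ZFSet.{u}} (hx : x ∈ HSet κ)
    (hR : R ⟨x, hx⟩) (hu : ∀ y, R y → y.1 = x) : x ∈ Y := by
  obtain ⟨v, hv, hm⟩ := hY.exists_mem h ⟨fun _ => ⟨x, hx⟩, hR⟩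
  rw [← hu _ hv]
  exact hm ()

theorem empty_mem (hY : IsElemSub Y (Order.succ μ)) : ∅ ∈ Y := by
  have h0 : (∅ : ZFSet.{u}) ∈ HSet (Order.succ μ) := by
    rw [← toZFSet_zero]
    exact HSet.toZFSet_mem (by simp)
  refine hY.mem_of_unique (R := fun x => ∀ t : HSet (Order.succ μ), ¬ t.1 ∈ x.1) ?_ h0 ?_ ?_
  · exact Dfn.all (Dfn.not (Dfn.mem (.var _) (.var _)))
  · exact fun t => notMem_empty _
  · intro y h
    rw [eq_empty]
    exact fun t ht => h ⟨t, HSet.of_mem y.2 ht⟩ ht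

theorem insert_self_mem (hY : IsElemSub Y (Order.succ μ)) (hμ : ℵ₀ ≤ μ) {x : ZFSet.{u}}
    (hx : x ∈ Y) : insert x x ∈ Y := by
  have hxH := hY.mem_HSet hx
  have hx' : (⟨x, hxH⟩ : HSet (Order.succ μ)) ∈ params Y (Order.succ μ) := hx
  have h0 : insert x x ∈ HSet (Order.succ μ) := by
    rw [insert_eq]
    exact HSet.union hμ (HSet.singleton hμ hxH) hxH
  refine hY.mem_of_unique (R := fun y => ∀ t : HSet (Order.succ μ), t.1 ∈ y.1 ↔
    t.1 = (⟨x, hxH⟩ : HSet (Order.succ μ)).1 ∨ t.1 ∈ (⟨x, hxH⟩ : HSet (Order.succ μ)).1)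
    ?_ h0 ?_ ?_
  · exact Dfn.all (Dfn.iff (Dfn.mem (.var _) (.var _))
      (Dfn.or (Dfn.eq (.var _) (.const hx')) (Dfn.mem (.var _) (.const hx'))))
  · exact fun t => mem_insert_iff
  · intro y h
    ext t
    rw [mem_insert_iff]
    constructor
    · exact fun ht => (h ⟨t, HSet.of_mem y.2 ht⟩).1 ht
    · intro ht
      refine (h ⟨t, ?_⟩).2 ht
      rcases ht with rfl | ht
      · exact hxH
      · exact HSet.of_mem hxH ht

theorem value_mem (hY : IsElemSub Y (Order.succ μ)) (hμ : ℵ₀ ≤ μ) {f n y : ZFSet.{u}}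
    (hf : f ∈ Y) (hn : n ∈ Y) (hy : pair n y ∈ f) (hu : ∀ y', pair n y' ∈ f → y' = y) :
    y ∈ Y := by
  have hyH : y ∈ HSet (Order.succ μ) := by
    refine HSet.of_mem (HSet.of_mem (HSet.of_mem (hY.mem_HSet hf) hy) (y := {n, y}) ?_) ?_ <;>
    simp [pair]
  refine hY.mem_of_unique (R := fun z => pair (⟨n, hY.mem_HSet hn⟩ : HSet (Order.succ μ)).1 z.1 ∈
    (⟨f, hY.mem_HSet hf⟩ : HSet (Order.succ μ)).1) ?_ hyH hy fun z hz => hu _ hz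
  exact Dfn.pair_mem hμ (.const hn) (.var _) (.const hf)

/-- A countable element of an elementary submodel is a subset of it. -/
theorem subset_of_countable (hY : IsElemSub Y (Order.succ μ)) (hμ : ℵ₀ ≤ μ) {x : ZFSet.{u}}
    (hx : x ∈ Y) (hc : (x : Set ZFSet.{u}).Countable) : x ⊆ Y := by
  have hxH := hY.mem_HSet hx
  have hx' : (⟨x, hxH⟩ : HSet (Order.succ μ)) ∈ params Y (Order.succ μ) := hx
  obtain ⟨code, hcode⟩ := Set.countable_iff_exists_injOn.1 hc
  have hω : toZFSet ω ∈ HSet (Order.succ μ) := HSet.toZFSet_mem (by simpa using hμ)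
  set f : ZFSet.{u} := range fun y : {y // y ∈ x} => pair (toZFSet (code y.val : Ordinal.{u})) y.val
    with hf
  have hmem : ∀ n y, pair n y ∈ f ↔ y ∈ x ∧ n = toZFSet (code y : Ordinal.{u}) := by
    intro n y
    rw [hf, mem_range]
    constructor
    · rintro ⟨⟨z, hz⟩, he⟩
      obtain ⟨rfl, rfl⟩ := pair_inj.1 he
      exact ⟨hz, rfl⟩
    · rintro ⟨hy, rfl⟩
      exact ⟨⟨y, hy⟩, rfl⟩
  have hcω : ∀ y, toZFSet (code y : Ordinal.{u}) ∈ toZFSet (ω : Ordinal.{u}) := fun y =>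
    toZFSet_mem_toZFSet_iff.2 (natCast_lt_omega0 _)
  have hfH : f ∈ HSet (Order.succ μ) := by
    refine HSet.of_subset (HSet.prod hμ hω hxH) fun z hz => ?_
    obtain ⟨⟨y, hy⟩, rfl⟩ := mem_range.1 hz
    exact pair_mem_prod.2 ⟨hcω y, hy⟩
  -- The set ω is reflected together with an enumeration of `x`. In the formula, `v true` is a set
  -- each of whose elements is empty or the successor of another of its elements, and `v false` is a
  -- single-valued relation through which elements of `v true` reach every element of `x`.
  obtain ⟨v, ⟨h1, h2, h3⟩, hvY⟩ := hY.exists_mem (ι := Bool)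
    (R := fun v => (∀ n : HSet (Order.succ μ), n.1 ∈ (v true).1 →
        (∀ t : HSet (Order.succ μ), ¬ t.1 ∈ n.1) ∨ ∃ m : HSet (Order.succ μ), m.1 ∈ (v true).1 ∧
          ∀ t : HSet (Order.succ μ), t.1 ∈ n.1 ↔ t.1 = m.1 ∨ t.1 ∈ m.1) ∧
      (∀ y : HSet (Order.succ μ), y.1 ∈ (⟨x, hxH⟩ : HSet (Order.succ μ)).1 →
        ∃ n : HSet (Order.succ μ), n.1 ∈ (v true).1 ∧ pair n.1 y.1 ∈ (v false).1) ∧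
      ∀ n y y' : HSet (Order.succ μ), pair n.1 y.1 ∈ (v false).1 → pair n.1 y'.1 ∈ (v false).1 →
        y.1 = y'.1)
    (by
      repeat' first
        | with_reducible exact Tm.var _ | with_reducible exact Tm.const hx'
        | apply Dfn.pair_mem hμ | apply Dfn.mem | apply Dfn.eq | apply Dfn.all | apply Dfn.ex
        | apply Dfn.and | apply Dfn.or | apply Dfn.iff | apply Dfn.not | apply Dfn.imp)
    ⟨fun b => if b then ⟨_, hω⟩ else ⟨f, hfH⟩, by
      refine ⟨fun n hn => ?_, fun y hy => ?_, fun n y y' hy hy' => ?_⟩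
      · obtain ⟨k, hk, hkn⟩ := mem_toZFSet_iff.1 hn
        obtain ⟨k, rfl⟩ := lt_omega0.1 hk
        cases k with
        | zero =>
          left
          intro t
          rw [← hkn]
          simp
        | succ k =>
          right
          refine ⟨⟨toZFSet (k : Ordinal.{u}), HSet.toZFSet_mem ?_⟩, ?_, fun t => ?_⟩
          · simpa using Cardinal.natCast_lt_aleph0.le.trans hμ
          · exact toZFSet_mem_toZFSet_iff.2 (natCast_lt_omega0 _)
          · rw [← hkn, Nat.cast_succ, toZFSet_add_one, mem_insert_iff]
      · exact ⟨⟨_, HSet.of_mem hω (hcω y.1)⟩, hcω y.1, (hmem _ _).2 ⟨hy, rfl⟩⟩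
      · obtain ⟨a1, a2⟩ := (hmem _ _).1 hy
        obtain ⟨b1, b2⟩ := (hmem _ _).1 hy'
        refine hcode a1 b1 ?_
        have := toZFSet_injective (a2.symm.trans b2)
        exact_mod_cast this⟩
  -- By ∈-induction every element of `v true` is obtained from the empty set by successors, hence is
  -- in `Y`; the values of `v false` at such elements are then in `Y` too.
  have hn : ∀ n : ZFSet.{u}, n ∈ (v true).1 → n ∈ Y := by
    intro n
    induction n using ZFSet.inductionOn with
    | h n ih =>
      intro hnw
      have hnH := HSet.of_mem (v true).2 hnw
      rcases h1 ⟨n, hnH⟩ hnw with h | ⟨m, hm, h⟩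
      · have : n = ∅ := (eq_empty n).2 fun t ht => h ⟨t, HSet.of_mem hnH ht⟩ ht
        rw [this]
        exact hY.empty_mem
      · have hmn : m.1 ∈ n := (h m).2 (.inl rfl)
        have : n = insert m.1 m.1 := by
          ext t
          rw [mem_insert_iff]
          constructor
          · exact fun ht => (h ⟨t, HSet.of_mem hnH ht⟩).1 ht
          · intro ht
            refine (h ⟨t, ?_⟩).2 ht
            rcases ht with rfl | ht
            · exact m.2
            · exact HSet.of_mem m.2 ht
        rw [this]
        exact hY.insert_self_mem hμ (ih m.1 hmn hm)
  intro y hy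
  obtain ⟨n, hnw, hny⟩ := h2 ⟨y, HSet.of_mem hxH hy⟩ hy
  refine hY.value_mem hμ (hvY false) (hn _ hnw) hny fun y' hy' => ?_
  refine h3 n ⟨y', ?_⟩ ⟨y, HSet.of_mem hxH hy⟩ hy' hny
  refine HSet.of_mem (HSet.of_mem (HSet.of_mem (v false).2 hy') (y := {n.1, y'}) ?_) ?_ <;>
  simp [pair]

end IsElemSub

/-! ### Coding the forcing relation of an iteration by a set

Below, `D` is a dense open subset of the last forcing notion, `LE` is a set of triples `(β, d, s)`
with the meaning `d ↾ β ≤ s ↾ β`, and `X` is a set of quadruples `(β, x, τ, d)` with the meaning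
`d ↾ β ⊩ x̌ = τ`, where `d ∈ D`. -/

/-- `d ↾ β ⊩ ž ∈ a`, expressed by `LE` and `X`. -/
def MemForm (D LE X β a z d : ZFSet.{u}) : Prop :=
  ∀ q ∈ D, pair β (pair q d) ∈ LE → ∃ r ∈ D, pair β (pair r q) ∈ LE ∧
    ∃ τ t, pair τ t ∈ a ∧ pair β (pair r t) ∈ LE ∧ pair β (pair z (pair τ r)) ∈ X

/-- The recursion for `X`. -/
def EqForm (D LE X β x τ d : ZFSet.{u}) : Prop :=
  (∀ y ∈ x, MemForm D LE X β τ y d) ∧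
  ∀ σ t, pair σ t ∈ τ → ∀ q ∈ D, pair β (pair q d) ∈ LE → pair β (pair q t) ∈ LE →
    ∃ r ∈ D, pair β (pair r q) ∈ LE ∧ ∃ y ∈ x, pair β (pair y (pair σ r)) ∈ X

/-- The recursion for `LE`. -/
def LeForm (D Z LE X β d s : ZFSet.{u}) : Prop :=
  ∀ b a, pair b a ∈ s → b ∈ β → ∀ b' a', pair b' a' ∈ d → b' = b → ∀ z ∈ Z, ∀ q ∈ D,
    pair b (pair q d) ∈ LE → MemForm D LE X b a z q → MemForm D LE X b a' z q

/-- The sets `LE` and `X` satisfy the recursions, on a domain given by a set `PC` of pairs `(β, s)`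
with the meaning `s ↾ β ∈ P_β`, a set `N` of pairs `(β, τ)` with the meaning that `τ` is a
`P_β`-name, and a transitive set `T`. -/
def IsCode (D p Z l PC N LE X T : ZFSet.{u}) : Prop :=
  (∀ β s, pair β s ∈ PC → ∀ b a, pair b a ∈ s → b ∈ β → pair b a ∈ N) ∧
  (∀ β a, pair β a ∈ N → ∀ σ s, pair σ s ∈ a → pair β σ ∈ N ∧ pair β s ∈ PC) ∧
  (∀ d ∈ D, pair l d ∈ PC) ∧ pair l p ∈ PC ∧
  (∀ β s, pair β s ∈ PC → ∀ b ∈ β, pair b s ∈ PC) ∧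
  (∀ x ∈ T, ∀ y ∈ x, y ∈ T) ∧ (∀ z ∈ Z, z ∈ T) ∧
  (∀ d ∈ D, ∀ β s, pair β s ∈ PC → (pair β (pair d s) ∈ LE ↔ LeForm D Z LE X β d s)) ∧
  (∀ x ∈ T, ∀ d ∈ D, ∀ β τ, pair β τ ∈ N →
    (pair β (pair x (pair τ d)) ∈ X ↔ EqForm D LE X β x τ d))

/-- All conditions attached to a check name are the largest one and drop out. What remains is the
recursion copied by `EqForm`, in which the left-hand sets decrease along ∈. -/
theorem ForcingNotion.forcesEq_check_iff {P : ForcingNotion.{u}} (hP : P.IsPreorder)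
    {x τ p : ZFSet.{u}} : P.ForcesEq (P.check x) τ p ↔
      (∀ y ∈ x, P.ForcesMem (P.check y) τ p) ∧
      ∀ σ t, pair σ t ∈ τ → ∀ q ∈ P.carrier, P.Le q p → P.Le q t →
        ∃ r ∈ P.carrier, P.Le r q ∧ ∃ y ∈ x, P.ForcesEq (P.check y) σ r := by
  rw [ForcesEq]
  constructor
  · rintro ⟨h1, h2⟩
    refine ⟨fun y hy q hq hqp => ?_, fun σ t ht q hq hqp hqt => ?_⟩
    · exact h1 _ _ (mem_check.2 ⟨y, hy, rfl⟩) q hq hqp (hP.le_one q hq)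
    · obtain ⟨r, hr, hrq, σ', s, hs, -, he⟩ := h2 σ t ht q hq hqp hqt
      obtain ⟨y, hy, hye⟩ := mem_check.1 hs
      rw [(pair_inj.1 hye).1] at he
      exact ⟨r, hr, hrq, y, hy, he⟩
  · rintro ⟨h1, h2⟩
    refine ⟨fun σ s hs q hq hqp _ => ?_, fun σ t ht q hq hqp hqt => ?_⟩
    · obtain ⟨y, hy, hye⟩ := mem_check.1 hs
      rw [(pair_inj.1 hye).1]
      exact h1 y hy q hq hqp
    · obtain ⟨r, hr, hrq, y, hy, he⟩ := h2 σ t ht q hq hqp hqt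
      exact ⟨r, hr, hrq, _, _, mem_check.2 ⟨y, hy, rfl⟩, hP.le_one r hr, he⟩

theorem pair_mem_restrict {s a : ZFSet.{u}} {b β : Ordinal.{u}} :
    pair (toZFSet b) a ∈ restrict s β ↔ pair (toZFSet b) a ∈ s ∧ b < β := by
  rw [restrict, mem_sep]
  refine and_congr_right fun _ => ⟨?_, fun h => ⟨b, h, a, rfl⟩⟩
  rintro ⟨ξ, hξ, c, he⟩
  rwa [toZFSet_injective (pair_inj.1 he).1]

theorem restrict_restrict {s : ZFSet.{u}} {b β : Ordinal.{u}} (h : b ≤ β) :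
    restrict (restrict s β) b = restrict s b := by
  ext z
  simp only [restrict, mem_sep]
  constructor
  · rintro ⟨⟨h1, -⟩, h2⟩
    exact ⟨h1, h2⟩
  · rintro ⟨h1, ξ, hξ, c, rfl⟩
    exact ⟨⟨h1, ξ, hξ.trans_le h, c, rfl⟩, ξ, hξ, c, rfl⟩

/-- The sets `LE` and `X` are correct at `β`. -/
structure IterSeq.CodeAt (q : IterSeq.{u}) (D PC N LE X T : ZFSet.{u}) (β : Ordinal.{u}) :
    Prop where
  names : ∀ a, pair (toZFSet β) a ∈ N → ∀ σ s, pair σ s ∈ a →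
    pair (toZFSet β) σ ∈ N ∧ pair (toZFSet β) s ∈ PC
  conds : ∀ d ∈ D, pair (toZFSet β) d ∈ PC
  le_iff : ∀ d ∈ D, ∀ s, pair (toZFSet β) s ∈ PC → restrict s β ∈ (q.P β).carrier →
    (pair (toZFSet β) (pair d s) ∈ LE ↔ (q.P β).Le (restrict d β) (restrict s β))
  eq_iff : ∀ x ∈ T, ∀ τ, pair (toZFSet β) τ ∈ N → (q.P β).IsName τ → ∀ d ∈ D,
    (pair (toZFSet β) (pair x (pair τ d)) ∈ X ↔
      (q.P β).ForcesEq ((q.P β).check x) τ (restrict d β))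

namespace IsIteration

variable {C : Ordinal.{u} → ℕ → Ordinal.{u}} {F : (ℕ → Bool) → Option Bool} {q : IterSeq.{u}}
  {D PC N LE X T : ZFSet.{u}} {β : Ordinal.{u}} {d : ZFSet.{u}}

/-- An extension of `d ↾ β` glued to `d` is an extension of `d`, hence in the open set `D`. So `D`
can replace `P_β` as the range of quantifiers over extensions of `d ↾ β`. -/
theorem ball_iff (hq : IsIteration C F q) (hD : (q.P q.len).IsDenseOpen D) (hβ : β ≤ q.len)
    (hd : d ∈ D) {ψ : ZFSet.{u} → Prop} :
    (∀ t ∈ (q.P β).carrier, (q.P β).Le t (restrict d β) → ψ t) ↔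
      ∀ t ∈ D, (q.P β).Le (restrict t β) (restrict d β) → ψ (restrict t β) := by
  constructor
  · exact fun h t ht hle => h _ (hq.restrict_mem le_rfl hβ (hD.1 ht)) hle
  · intro h t _ hle
    obtain ⟨t', h1, h2, -⟩ := hq.exists_le_of_le_restrict (hD.1 hd) hβ hle
    rw [← h2]
    refine h t' (hD.2.2 d hd t' (hq.left_mem le_rfl h1).1 h1) ?_
    rwa [h2]

theorem bex_iff (hq : IsIteration C F q) (hD : (q.P q.len).IsDenseOpen D) (hβ : β ≤ q.len)
    (hd : d ∈ D) {ψ : ZFSet.{u} → Prop} :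
    (∃ t ∈ (q.P β).carrier, (q.P β).Le t (restrict d β) ∧ ψ t) ↔
      ∃ t ∈ D, (q.P β).Le (restrict t β) (restrict d β) ∧ ψ (restrict t β) := by
  have := (hq.ball_iff hD hβ hd (ψ := fun t => ¬ ψ t)).not
  push Not at this
  exact this

/-- The correctness of `LE` at `β`, and of `X` for the single set `z`, enter as separate hypotheses
because the lemma is needed inside the inductions that establish `CodeAt`. -/
theorem memForm_iff (hq : IsIteration C F q) (hD : (q.P q.len).IsDenseOpen D) (hβ : β ≤ q.len)
    (hnames : ∀ a, pair (toZFSet β) a ∈ N → ∀ σ s, pair σ s ∈ a →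
      pair (toZFSet β) σ ∈ N ∧ pair (toZFSet β) s ∈ PC)
    (hconds : ∀ d ∈ D, pair (toZFSet β) d ∈ PC)
    (hle : ∀ d ∈ D, ∀ s, pair (toZFSet β) s ∈ PC → restrict s β ∈ (q.P β).carrier →
      (pair (toZFSet β) (pair d s) ∈ LE ↔ (q.P β).Le (restrict d β) (restrict s β)))
    {z : ZFSet.{u}}
    (heq : ∀ τ, pair (toZFSet β) τ ∈ N → (q.P β).IsName τ → ∀ d ∈ D,
      (pair (toZFSet β) (pair z (pair τ d)) ∈ X ↔
        (q.P β).ForcesEq ((q.P β).check z) τ (restrict d β)))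
    {a : ZFSet.{u}} (ha : pair (toZFSet β) a ∈ N) (han : (q.P β).IsName a) (hd : d ∈ D) :
    MemForm D LE X (toZFSet β) a z d ↔
      (q.P β).ForcesMem ((q.P β).check z) a (restrict d β) := by
  rw [ForcingNotion.ForcesMem, ForcingNotion.DenseBelow, hq.ball_iff hD hβ hd, MemForm]
  have hmem : ∀ d ∈ D, restrict d β ∈ (q.P β).carrier := fun d hd =>
    hq.restrict_mem le_rfl hβ (hD.1 hd)
  refine forall₂_congr fun t ht => ?_
  rw [hle t ht d (hconds d hd) (hmem d hd), hq.bex_iff hD hβ ht]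
  refine imp_congr_right fun _ => exists_congr fun r => and_congr_right fun hr => ?_
  rw [hle r hr t (hconds t ht) (hmem t ht)]
  refine and_congr_right fun _ => exists₂_congr fun τ s => and_congr_right fun hs => ?_
  obtain ⟨h1, h2⟩ := hnames a ha τ s hs
  obtain ⟨h3, h4⟩ := han.of_pair_mem hs
  have h5 := hq.restrict_self hβ h4
  have h6 := hle r hr s h2 (by rwa [h5])
  rw [h5] at h6
  rw [h6, heq τ h1 h3 r hr]

theorem eqForm_iff (hq : IsIteration C F q) (hD : (q.P q.len).IsDenseOpen D) (hβ : β ≤ q.len)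
    (hnames : ∀ a, pair (toZFSet β) a ∈ N → ∀ σ s, pair σ s ∈ a →
      pair (toZFSet β) σ ∈ N ∧ pair (toZFSet β) s ∈ PC)
    (hconds : ∀ d ∈ D, pair (toZFSet β) d ∈ PC)
    (hle : ∀ d ∈ D, ∀ s, pair (toZFSet β) s ∈ PC → restrict s β ∈ (q.P β).carrier →
      (pair (toZFSet β) (pair d s) ∈ LE ↔ (q.P β).Le (restrict d β) (restrict s β)))
    {x : ZFSet.{u}}
    (heq : ∀ y ∈ x, ∀ τ, pair (toZFSet β) τ ∈ N → (q.P β).IsName τ → ∀ d ∈ D,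
      (pair (toZFSet β) (pair y (pair τ d)) ∈ X ↔
        (q.P β).ForcesEq ((q.P β).check y) τ (restrict d β)))
    {τ : ZFSet.{u}} (hτ : pair (toZFSet β) τ ∈ N) (hτn : (q.P β).IsName τ) (hd : d ∈ D) :
    EqForm D LE X (toZFSet β) x τ d ↔
      (q.P β).ForcesEq ((q.P β).check x) τ (restrict d β) := by
  have hmem : ∀ d ∈ D, restrict d β ∈ (q.P β).carrier := fun d hd =>
    hq.restrict_mem le_rfl hβ (hD.1 hd)
  rw [ForcingNotion.forcesEq_check_iff (hq.isPreorder hβ), EqForm]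
  refine and_congr (forall₂_congr fun y hy => ?_) (forall₃_congr fun σ t ht => ?_)
  · exact memForm_iff hq hD hβ hnames hconds hle (heq y hy) hτ hτn hd
  · obtain ⟨h1, h2⟩ := hnames τ hτ σ t ht
    obtain ⟨h3, h4⟩ := hτn.of_pair_mem ht
    have h5 := hq.restrict_self hβ h4
    rw [hq.ball_iff hD hβ hd]
    refine forall₂_congr fun r hr => ?_
    have h6 := hle r hr t h2 (by rwa [h5])
    rw [h5] at h6
    rw [hle r hr d (hconds d hd) (hmem d hd), h6, hq.bex_iff hD hβ hr]
    refine imp_congr_right fun _ => imp_congr_right fun _ => exists_congr fun s =>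
      and_congr_right fun hs => ?_
    rw [hle s hs r (hconds r hr) (hmem r hr)]
    refine and_congr_right fun _ => exists_congr fun y => and_congr_right fun hy => ?_
    exact heq y hy σ h1 h3 s hs

theorem _root_.CondTree.IterSeq.CodeAt.memForm_iff (h : q.CodeAt D PC N LE X T β)
    (hq : IsIteration C F q) (hD : (q.P q.len).IsDenseOpen D) (hβ : β ≤ q.len)
    {z : ZFSet.{u}} (hz : z ∈ T) {a : ZFSet.{u}} (ha : pair (toZFSet β) a ∈ N)
    (han : (q.P β).IsName a) (hd : d ∈ D) :
    MemForm D LE X (toZFSet β) a z d ↔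
      (q.P β).ForcesMem ((q.P β).check z) a (restrict d β) :=
  hq.memForm_iff hD hβ h.names h.conds h.le_iff (h.eq_iff z hz) ha han hd

/-- The order of `P_β` is determined by the forced values. -/
theorem le_iff_values (hq : IsIteration C F q) (hD : (q.P q.len).IsDenseOpen D) (hβ : β ≤ q.len)
    (hd : d ∈ D) {s : ZFSet.{u}} (hs : s ∈ (q.P β).carrier) :
    (q.P β).Le (restrict d β) s ↔ ∀ b < β, ∀ z ∈ timesTwo (toZFSet ω₁), ∀ t ∈ D,
      (q.P b).Le (restrict t b) (restrict d b) →
      (q.P b).ForcesMem ((q.P b).check z) (fn s b) (restrict t b) →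
      (q.P b).ForcesMem ((q.P b).check z) (fn d b) (restrict t b) := by
  have hdc := hD.1 hd
  have hdm := hq.restrict_mem le_rfl hβ hdc
  have hfn : ∀ b < β, fn (restrict d β) b = fn d b := fun b hb => by
    rw [hq.restrict_eq le_rfl hβ hdc, fn_seqCode _ hb]
  constructor
  · intro h b hb z _ t ht hle hf
    have hP := hq.isPreorder (hb.le.trans hβ)
    have := ((hq.le_iff' hβ).1 h).2.2 b hb
    rw [restrict_restrict hb.le, hfn b hb] at this
    exact this _ (ForcingNotion.isName_check hP _) _ (hP.left _ _ hle) hle hf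
  · intro h
    suffices H : ∀ c ≤ β, (q.P c).Le (restrict d c) (restrict s c) by
      have := H β le_rfl
      rwa [hq.restrict_self hβ hs] at this
    intro c hc
    induction c using WellFoundedLT.induction with
    | ind c ih =>
      have hcl := hc.trans hβ
      have hsc := hq.restrict_mem hβ hc hs
      refine (hq.le_iff' hcl).2 ⟨hq.restrict_mem le_rfl hcl hdc, hsc, fun b hb => ?_⟩
      have hbβ := hb.trans_le hc
      have hbl := hbβ.le.trans hβ
      have hP := hq.isPreorder hbl
      have hle := ih b hb hbβ.le
      rw [hq.restrict_eq hβ hc hs, fn_seqCode _ hb, hq.restrict_eq le_rfl hcl hdc, fn_seqCode _ hb,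
        ← hq.restrict_eq le_rfl hcl hdc, restrict_restrict hb.le]
      -- By induction `d ↾ b` is below `s ↾ b`, so it forces `s(b)` to be a function on a countable
      -- ordinal, for which inclusion can be tested on values.
      refine ForcingNotion.ForcesFun.subset_of_values (A := toZFSet ω₁) hP ?_ ?_
      · refine ForcingNotion.DenseBelow.imp hP ((hq.coord hβ hs hbβ).2.mono hP hle) ?_
        rintro t - ⟨δ, hδ, hf, -⟩
        exact ⟨toZFSet δ, toZFSet_subset_toZFSet_iff.2 hδ.le, hf⟩
      · intro x hx v t ht hv
        obtain ⟨t', h1, h2, -⟩ := hq.exists_le_of_le_restrict hdc hbl ht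
        have ht' := hD.2.2 d hd t' (hq.left_mem le_rfl h1).1 h1
        rw [← h2] at hv ht ⊢
        exact h b hbβ _ (ForcingNotion.mem_timesTwo.2 ⟨x, hx, v, rfl⟩) t' ht' ht hv

/-- This is `le_iff_values` spelled out in the code. Only `LE` and `X` at coordinates below `β`
occur, which makes the definition of `LE` a recursion. -/
theorem leForm_iff (hq : IsIteration C F q) (hD : (q.P q.len).IsDenseOpen D) (hβ : β ≤ q.len)
    (hT : ∀ z ∈ timesTwo (toZFSet ω₁), z ∈ T) (hcode : ∀ b < β, q.CodeAt D PC N LE X T b)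
    (hPC : ∀ s, pair (toZFSet β) s ∈ PC → ∀ b a, pair b a ∈ s → b ∈ toZFSet β → pair b a ∈ N)
    (hconds : ∀ d ∈ D, pair (toZFSet β) d ∈ PC)
    (hd : d ∈ D) {s : ZFSet.{u}} (hs : pair (toZFSet β) s ∈ PC)
    (hsc : restrict s β ∈ (q.P β).carrier) :
    LeForm D (timesTwo (toZFSet ω₁)) LE X (toZFSet β) d s ↔
      (q.P β).Le (restrict d β) (restrict s β) := by
  rw [hq.le_iff_values hD hβ hd hsc]
  have hdc := hD.1 hd
  have hmem : ∀ b < β, ∀ a, pair (toZFSet b) a ∈ s ↔ a = fn (restrict s β) b := fun b hb a => by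
    rw [← (pair_mem_restrict (s := s) (β := β)).trans (and_iff_left hb)]
    conv_lhs => rw [hq.eq_seqCode hβ hsc]
    rw [pair_mem_seqCode, and_iff_right hb]
  have hmem' : ∀ b < β, ∀ a, pair (toZFSet b) a ∈ d ↔ a = fn d b := fun b hb a => by
    conv_lhs => rw [hq.eq_seqCode le_rfl hdc]
    rw [pair_mem_seqCode, and_iff_right (hb.trans_le hβ)]
  have key : ∀ b < β, ∀ z ∈ timesTwo (toZFSet ω₁), ∀ t ∈ D,
      (pair (toZFSet b) (pair t d) ∈ LE ↔ (q.P b).Le (restrict t b) (restrict d b)) ∧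
      (MemForm D LE X (toZFSet b) (fn (restrict s β) b) z t ↔
        (q.P b).ForcesMem ((q.P b).check z) (fn (restrict s β) b) (restrict t b)) ∧
      (MemForm D LE X (toZFSet b) (fn d b) z t ↔
        (q.P b).ForcesMem ((q.P b).check z) (fn d b) (restrict t b)) := by
    intro b hb z hz t ht
    have hbl := hb.le.trans hβ
    have hbβ := toZFSet_mem_toZFSet_iff.2 hb
    have hc := hcode b hb
    refine ⟨hc.le_iff t ht d (hc.conds d hd) (hq.restrict_mem le_rfl hbl hdc),
      hc.memForm_iff hq hD hbl (hT z hz) (hPC s hs _ _ ((hmem b hb _).2 rfl) hbβ)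
        (hq.coord hβ hsc hb).1 ht,
      hc.memForm_iff hq hD hbl (hT z hz) (hPC d (hconds d hd) _ _ ((hmem' b hb _).2 rfl) hbβ)
        (hq.coord le_rfl hdc (hb.trans_le hβ)).1 ht⟩
  constructor
  · intro h b hb z hz t ht hle hf
    obtain ⟨k1, k2, k3⟩ := key b hb z hz t ht
    exact k3.1 (h _ _ ((hmem b hb _).2 rfl) (toZFSet_mem_toZFSet_iff.2 hb) _ _
      ((hmem' b hb _).2 rfl) rfl z hz t ht (k1.2 hle) (k2.2 hf))
  · intro h b' a ha hb' b'' a' ha' he z hz t ht hle hf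
    subst he
    obtain ⟨b, hb, rfl⟩ := mem_toZFSet_iff.1 hb'
    obtain ⟨k1, k2, k3⟩ := key b hb z hz t ht
    obtain rfl := (hmem b hb _).1 ha
    obtain rfl := (hmem' b hb _).1 ha'
    exact k3.2 (h b hb z hz t ht (k1.1 hle) (k2.1 hf))

/-- The recursions determine `LE` and `X`. -/
theorem codeAt (hq : IsIteration C F q) (hD : (q.P q.len).IsDenseOpen D) {p : ZFSet.{u}}
    (h : IsCode D p (timesTwo (toZFSet ω₁)) (toZFSet q.len) PC N LE X T) (hβ : β ≤ q.len) :
    q.CodeAt D PC N LE X T β := by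
  obtain ⟨h1, h2, h3, -, h5, h6, h7, h8, h9⟩ := h
  induction β using WellFoundedLT.induction with
  | ind β ih =>
    have hnames := h2 (toZFSet β)
    have hconds : ∀ d ∈ D, pair (toZFSet β) d ∈ PC := by
      intro d hd
      rcases hβ.eq_or_lt with rfl | hlt
      · exact h3 d hd
      · exact h5 _ _ (h3 d hd) _ (toZFSet_mem_toZFSet_iff.2 hlt)
    -- `LE` at `β` is determined by the code below `β`. It is needed for `X` at `β`, which is then
    -- determined by ∈-induction on the first argument.
    have hle : ∀ d ∈ D, ∀ s, pair (toZFSet β) s ∈ PC → restrict s β ∈ (q.P β).carrier →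
        (pair (toZFSet β) (pair d s) ∈ LE ↔ (q.P β).Le (restrict d β) (restrict s β)) := by
      intro d hd s hs hsc
      rw [h8 d hd _ s hs]
      exact hq.leForm_iff hD hβ h7 (fun b hb => ih b hb (hb.le.trans hβ)) (h1 _) hconds hd hs hsc
    refine ⟨hnames, hconds, hle, ?_⟩
    intro x
    induction x using ZFSet.inductionOn with
    | h x ihx =>
      intro hx τ hτ hτn d hd
      rw [h9 x hx d hd _ τ hτ]
      exact hq.eqForm_iff hD hβ hnames hconds hle (fun y hy => ihx y hy (h6 x hx y hy)) hτ hτn hd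

end IsIteration

/-! ### Definability of the recursions -/

section

variable {κ : Cardinal.{u}} {A : Set (HSet κ)} {ι : Type*}

/-- The substituted terms are introduced as quantified variables with equations. It thus suffices to
check a long formula such as `MemForm` once, with distinct variables in all its places. -/
theorem Dfn.subst {J : Type*} [Finite J] {R : (J → HSet κ) → Prop} (h : Dfn A R)
    {f : J → (ι → HSet κ) → HSet κ} (hf : ∀ j, Tm A (f j)) : Dfn A fun v => R fun j => f j v := by
  have h1 : Dfn A fun w : ι ⊕ J → HSet κ => R fun j => w (.inr j) :=
    Set.Definable.preimage_comp (fun j => Sum.inr j) h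
  have h2 : Dfn A fun w : ι ⊕ J → HSet κ => ∀ j, (w (.inr j)).1 = (f j fun i => w (.inl i)).1 := by
    refine Dfn.forall_finite fun j => Dfn.eq (Tm.var _) ?_
    rcases hf j with ⟨i, hi⟩ | ⟨a, ha, hi⟩ <;> rw [hi]
    · exact Tm.var _
    · exact Tm.const ha
  refine Dfn.congr (Set.Definable.exists_of_finite (h2.and h1)) fun v => ?_
  constructor
  · exact fun hv => ⟨fun j => f j v, fun j => rfl, hv⟩
  · rintro ⟨x, hx, hR⟩
    have : x = fun j => f j v := funext fun j => Subtype.ext (hx j)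
    rw [← this]
    exact hR

theorem Dfn.ball {f : (ι → HSet κ) → HSet κ} {R : (ι → HSet κ) → ZFSet.{u} → Prop} (hf : Tm A f)
    (h : Dfn A fun w : ι ⊕ Unit → HSet κ => R (fun i => w (.inl i)) (w (.inr ())).1) :
    Dfn A fun v => ∀ x ∈ (f v).1, R v x := by
  refine Dfn.congr (R := fun v => ∀ x : HSet κ, x.1 ∈ (f v).1 → R v x.1)
    (Dfn.all ((Dfn.mem (Tm.var _) hf.lift).imp h)) fun v => ?_
  exact ⟨fun H x hx => H x.1 hx, fun H x hx => H ⟨x, HSet.of_mem (f v).2 hx⟩ hx⟩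

theorem Dfn.bex {f : (ι → HSet κ) → HSet κ} {R : (ι → HSet κ) → ZFSet.{u} → Prop} (hf : Tm A f)
    (h : Dfn A fun w : ι ⊕ Unit → HSet κ => R (fun i => w (.inl i)) (w (.inr ())).1) :
    Dfn A fun v => ∃ x ∈ (f v).1, R v x := by
  refine (Dfn.not (Dfn.ball (R := fun v x => ¬ R v x) hf h.not)).congr fun v => ?_
  push Not
  exact Iff.rfl

theorem HSet.of_pair_mem {x y z : ZFSet.{u}} (hz : z ∈ HSet κ) (h : ZFSet.pair x y ∈ z) :
    x ∈ HSet κ ∧ y ∈ HSet κ := by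
  have h1 : ({x, y} : ZFSet.{u}) ∈ HSet κ := HSet.of_mem (HSet.of_mem hz h) (by simp [ZFSet.pair])
  exact ⟨HSet.of_mem h1 (by simp), HSet.of_mem h1 (by simp)⟩

end

section

variable {μ : Cardinal.{u}} {A : Set (HSet (Order.succ μ))} {ι : Type*}
  {f : (ι → HSet (Order.succ μ)) → HSet (Order.succ μ)}
  {R : (ι → HSet (Order.succ μ)) → ZFSet.{u} → ZFSet.{u} → Prop}

theorem Dfn.pall (hμ : ℵ₀ ≤ μ) (hf : Tm A f)
    (h : Dfn A fun w : (ι ⊕ Unit) ⊕ Unit → HSet (Order.succ μ) =>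
      R (fun i => w (.inl (.inl i))) (w (.inl (.inr ()))).1 (w (.inr ())).1) :
    Dfn A fun v => ∀ x y, pair x y ∈ (f v).1 → R v x y := by
  refine Dfn.congr (R := fun v => ∀ x y : HSet (Order.succ μ), pair x.1 y.1 ∈ (f v).1 →
    R v x.1 y.1) (Dfn.all (Dfn.all ((Dfn.pair_mem hμ (Tm.var _) (Tm.var _) hf.lift.lift).imp h)))
    fun v => ?_
  refine ⟨fun H x y hx => H x.1 y.1 hx, fun H x y hx => ?_⟩
  have := HSet.of_pair_mem (f v).2 hx
  exact H ⟨x, this.1⟩ ⟨y, this.2⟩ hx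

theorem Dfn.pex (hμ : ℵ₀ ≤ μ) (hf : Tm A f)
    (h : Dfn A fun w : (ι ⊕ Unit) ⊕ Unit → HSet (Order.succ μ) =>
      R (fun i => w (.inl (.inl i))) (w (.inl (.inr ()))).1 (w (.inr ())).1) :
    Dfn A fun v => ∃ x y, pair x y ∈ (f v).1 ∧ R v x y := by
  refine (Dfn.not (Dfn.pall (R := fun v x y => ¬ R v x y) hμ hf h.not)).congr fun v => ?_
  push Not
  exact Iff.rfl

variable {D LE X β a z d : (ι → HSet (Order.succ μ)) → HSet (Order.succ μ)}

theorem Dfn.memForm (hμ : ℵ₀ ≤ μ) (hD : Tm A D) (hLE : Tm A LE) (hX : Tm A X) (hβ : Tm A β)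
    (ha : Tm A a) (hz : Tm A z) (hd : Tm A d) : Dfn A fun v =>
      MemForm (D v).1 (LE v).1 (X v).1 (β v).1 (a v).1 (z v).1 (d v).1 := by
  refine Dfn.subst (R := fun v : Fin 7 → HSet (Order.succ μ) => MemForm (v 0).1 (v 1).1 (v 2).1
    (v 3).1 (v 4).1 (v 5).1 (v 6).1) (f := ![D, LE, X, β, a, z, d]) ?_ ?_
  · unfold MemForm
    repeat' first
      | with_reducible exact Tm.var _ | with_reducible apply Dfn.quadruple_mem hμ | with_reducible apply Dfn.triple_mem hμ
      | with_reducible apply Dfn.pex hμ | with_reducible apply Dfn.bex | with_reducible apply Dfn.ball | with_reducible apply Dfn.and | with_reducible apply Dfn.imp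
  · intro j
    fin_cases j <;> assumption

theorem Dfn.isCode (hμ : ℵ₀ ≤ μ) {D p Z l : HSet (Order.succ μ)} (hD : D ∈ A) (hp : p ∈ A)
    (hZ : Z ∈ A) (hl : l ∈ A) : Dfn A fun v : Fin 5 → HSet (Order.succ μ) =>
      IsCode D.1 p.1 Z.1 l.1 (v 0).1 (v 1).1 (v 2).1 (v 3).1 (v 4).1 := by
  unfold IsCode LeForm EqForm
  repeat' first
    | with_reducible exact Tm.var _ | with_reducible exact Tm.const hD
    | with_reducible exact Tm.const hp | with_reducible exact Tm.const hZ
    | with_reducible exact Tm.const hl | with_reducible apply Dfn.memForm hμ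
    | with_reducible apply Dfn.quadruple_mem hμ | with_reducible apply Dfn.triple_mem hμ
    | with_reducible apply Dfn.pair_mem hμ | with_reducible apply Dfn.mem | with_reducible apply Dfn.eq
    | with_reducible apply Dfn.pall hμ | with_reducible apply Dfn.bex | with_reducible apply Dfn.ball
    | with_reducible apply Dfn.and | with_reducible apply Dfn.iff | with_reducible apply Dfn.imp
end

/-! ### Existence of a code -/

theorem mem_trcl_of_pair_mem {x y z w : ZFSet.{u}} (h : pair x y ∈ z) (hz : z ∈ trcl w) :
    x ∈ trcl w ∧ y ∈ trcl w := by
  have h1 : ({x, y} : ZFSet.{u}) ∈ trcl w :=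
    mem_trcl_of_mem (by simp [pair]) (mem_trcl_of_mem h hz)
  exact ⟨mem_trcl_of_mem (by simp) h1, mem_trcl_of_mem (by simp) h1⟩

theorem mem_trcl_of_pair {x y w : ZFSet.{u}} (h : pair x y ∈ trcl w) :
    x ∈ trcl w ∧ y ∈ trcl w := by
  have h1 : ({x, y} : ZFSet.{u}) ∈ trcl w := mem_trcl_of_mem (by simp [pair]) h
  exact ⟨mem_trcl_of_mem (by simp) h1, mem_trcl_of_mem (by simp) h1⟩

theorem IterSeq.mem_trcl_code {q : IterSeq.{u}} {β : Ordinal.{u}} (hβ : β ≤ q.len) :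
    toZFSet β ∈ trcl q.code ∧ (q.P β).carrier ∈ trcl q.code := by
  have h1 : seqCode (Order.succ q.len) (fun α => (q.P α).code) ∈ trcl q.code :=
    mem_trcl_of_mem (y := {seqCode (Order.succ q.len) fun α => (q.P α).code}) (by simp)
      (subset_trcl _ (by simp [IterSeq.code, pair]))
  have h2 : pair (toZFSet β) (q.P β).code ∈ seqCode (Order.succ q.len) fun α => (q.P α).code :=
    pair_mem_seqCode.2 ⟨Order.lt_succ_iff.2 hβ, rfl⟩
  obtain ⟨h3, h4⟩ := mem_trcl_of_pair_mem h2 h1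
  exact ⟨h3, (mem_trcl_of_pair h4).1⟩

/-- The true order and the true forcing of equalities, cut down to the transitive closures of `q`
and of ω₁ × 2, satisfy the recursions. They are subsets of products of elements of `H(μ⁺)` and so
belong to it. -/
theorem IsIteration.exists_isCode {C : Ordinal.{u} → ℕ → Ordinal.{u}}
    {F : (ℕ → Bool) → Option Bool} {q : IterSeq.{u}} {D p : ZFSet.{u}} (hq : IsIteration C F q)
    (hD : (q.P q.len).IsDenseOpen D) (hp : p ∈ (q.P q.len).carrier) {μ : Cardinal.{u}}
    (hμ : ℵ₀ ≤ μ) (hqH : q.code ∈ HSet (Order.succ μ))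
    (hZ : timesTwo (toZFSet ω₁) ∈ HSet (Order.succ μ)) :
    ∃ v : Fin 5 → HSet (Order.succ μ), IsCode D p (timesTwo (toZFSet ω₁)) (toZFSet q.len)
      (v 0).1 (v 1).1 (v 2).1 (v 3).1 (v 4).1 := by
  set U := trcl q.code with hU
  set T := trcl (timesTwo (toZFSet ω₁)) with hT
  have hUH : U ∈ HSet (Order.succ μ) := HSet.trcl_mem hqH
  have hTH : T ∈ HSet (Order.succ μ) := HSet.trcl_mem hZ
  set PC := (prod U U).sep fun z => ∃ b ≤ q.len, ∃ s, z = pair (toZFSet b) s ∧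
    restrict s b ∈ (q.P b).carrier with hPC
  set N := (prod U U).sep fun z => ∃ b ≤ q.len, ∃ s, z = pair (toZFSet b) s ∧
    (q.P b).IsName s with hN
  set LE := (prod U (prod U U)).sep fun z => ∃ b ≤ q.len, ∃ d s,
    z = pair (toZFSet b) (pair d s) ∧ (q.P b).Le (restrict d b) (restrict s b) with hLE
  set X := (prod U (prod T (prod U U))).sep fun z => ∃ b ≤ q.len, ∃ x τ d,
    z = pair (toZFSet b) (pair x (pair τ d)) ∧
      (q.P b).ForcesEq ((q.P b).check x) τ (restrict d b) with hX
  have memPC : ∀ β s, pair β s ∈ PC ↔ s ∈ U ∧ ∃ b ≤ q.len, β = toZFSet b ∧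
      restrict s b ∈ (q.P b).carrier := by
    intro β s
    rw [hPC, mem_sep, pair_mem_prod]
    constructor
    · rintro ⟨⟨-, h1⟩, b, hb, s', he, h2⟩
      obtain ⟨rfl, rfl⟩ := pair_inj.1 he
      exact ⟨h1, b, hb, rfl, h2⟩
    · rintro ⟨h1, b, hb, rfl, h2⟩
      exact ⟨⟨(IterSeq.mem_trcl_code hb).1, h1⟩, b, hb, s, rfl, h2⟩
  have memN : ∀ β s, pair β s ∈ N ↔ s ∈ U ∧ ∃ b ≤ q.len, β = toZFSet b ∧ (q.P b).IsName s := by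
    intro β s
    rw [hN, mem_sep, pair_mem_prod]
    constructor
    · rintro ⟨⟨-, h1⟩, b, hb, s', he, h2⟩
      obtain ⟨rfl, rfl⟩ := pair_inj.1 he
      exact ⟨h1, b, hb, rfl, h2⟩
    · rintro ⟨h1, b, hb, rfl, h2⟩
      exact ⟨⟨(IterSeq.mem_trcl_code hb).1, h1⟩, b, hb, s, rfl, h2⟩
  have memLE : ∀ b ≤ q.len, ∀ d ∈ U, ∀ s ∈ U, (pair (toZFSet b) (pair d s) ∈ LE ↔
      (q.P b).Le (restrict d b) (restrict s b)) := by
    intro b hb d hd s hs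
    rw [hLE, mem_sep, pair_mem_prod, pair_mem_prod]
    constructor
    · rintro ⟨-, b', hb', d', s', he, h⟩
      obtain ⟨h1, h2⟩ := pair_inj.1 he
      obtain ⟨rfl, rfl⟩ := pair_inj.1 h2
      rwa [toZFSet_injective h1]
    · exact fun h => ⟨⟨(IterSeq.mem_trcl_code hb).1, hd, hs⟩, b, hb, d, s, rfl, h⟩
  have memX : ∀ b ≤ q.len, ∀ x ∈ T, ∀ τ ∈ U, ∀ d ∈ U,
      (pair (toZFSet b) (pair x (pair τ d)) ∈ X ↔
        (q.P b).ForcesEq ((q.P b).check x) τ (restrict d b)) := by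
    intro b hb x hx τ hτ d hd
    rw [hX, mem_sep, pair_mem_prod, pair_mem_prod, pair_mem_prod]
    constructor
    · rintro ⟨-, b', hb', x', τ', d', he, h⟩
      obtain ⟨h1, h2⟩ := pair_inj.1 he
      obtain ⟨rfl, h3⟩ := pair_inj.1 h2
      obtain ⟨rfl, rfl⟩ := pair_inj.1 h3
      rwa [toZFSet_injective h1]
    · exact fun h => ⟨⟨(IterSeq.mem_trcl_code hb).1, hx, hτ, hd⟩, b, hb, x, τ, d, rfl, h⟩
  have hcarU : ∀ b ≤ q.len, ∀ s ∈ (q.P b).carrier, s ∈ U := fun b hb s hs =>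
    mem_trcl_of_mem hs (IterSeq.mem_trcl_code hb).2
  have hDU : ∀ d ∈ D, d ∈ U := fun d hd => hcarU _ le_rfl _ (hD.1 hd)
  have c1 : ∀ β s, pair β s ∈ PC → ∀ b a, pair b a ∈ s → b ∈ β → pair b a ∈ N := by
    intro β s hs b' a ha hb'
    obtain ⟨hsU, β, hβ, rfl, hr⟩ := (memPC _ _).1 hs
    obtain ⟨b, hb, rfl⟩ := mem_toZFSet_iff.1 hb'
    have h1 := pair_mem_restrict.2 ⟨ha, hb⟩
    rw [hq.eq_seqCode hβ hr, pair_mem_seqCode] at h1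
    refine (memN _ _).2 ⟨(mem_trcl_of_pair_mem ha hsU).2, b, hb.le.trans hβ, rfl, ?_⟩
    rw [h1.2]
    exact (hq.coord hβ hr hb).1
  have c2 : ∀ β a, pair β a ∈ N → ∀ σ s, pair σ s ∈ a → pair β σ ∈ N ∧ pair β s ∈ PC := by
    intro β a ha σ s hs
    obtain ⟨haU, β, hβ, rfl, hn⟩ := (memN _ _).1 ha
    obtain ⟨h1, h2⟩ := hn.of_pair_mem hs
    obtain ⟨h3, h4⟩ := mem_trcl_of_pair_mem hs haU
    refine ⟨(memN _ _).2 ⟨h3, β, hβ, rfl, h1⟩, (memPC _ _).2 ⟨h4, β, hβ, rfl, ?_⟩⟩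
    rwa [hq.restrict_self hβ h2]
  have c34 : ∀ d ∈ (q.P q.len).carrier, pair (toZFSet q.len) d ∈ PC := fun d hd =>
    (memPC _ _).2 ⟨hcarU _ le_rfl _ hd, q.len, le_rfl, rfl, by rwa [hq.restrict_self le_rfl hd]⟩
  have c5 : ∀ β s, pair β s ∈ PC → ∀ b ∈ β, pair b s ∈ PC := by
    intro β s hs b' hb'
    obtain ⟨hsU, β, hβ, rfl, hr⟩ := (memPC _ _).1 hs
    obtain ⟨b, hb, rfl⟩ := mem_toZFSet_iff.1 hb'
    refine (memPC _ _).2 ⟨hsU, b, hb.le.trans hβ, rfl, ?_⟩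
    have := hq.restrict_mem hβ hb.le hr
    rwa [restrict_restrict hb.le] at this
  have hcode : ∀ β ≤ q.len, q.CodeAt D PC N LE X T β := by
    intro β hβ
    refine ⟨c2 _, fun d hd => ?_, ?_, ?_⟩
    · rcases hβ.eq_or_lt with rfl | hlt
      · exact c34 d (hD.1 hd)
      · exact c5 _ _ (c34 d (hD.1 hd)) _ (toZFSet_mem_toZFSet_iff.2 hlt)
    · exact fun d hd s hs _ => memLE β hβ d (hDU d hd) s ((memPC _ _).1 hs).1
    · exact fun x hx τ hτ _ d hd => memX β hβ x hx τ ((memN _ _).1 hτ).1 d (hDU d hd)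
  have hZT : ∀ z ∈ timesTwo (toZFSet ω₁), z ∈ T := fun z hz => subset_trcl _ hz
  refine ⟨![⟨PC, HSet.of_subset (HSet.prod hμ hUH hUH) sep_subset⟩,
    ⟨N, HSet.of_subset (HSet.prod hμ hUH hUH) sep_subset⟩,
    ⟨LE, HSet.of_subset (HSet.prod hμ hUH (HSet.prod hμ hUH hUH)) sep_subset⟩,
    ⟨X, HSet.of_subset (HSet.prod hμ hUH (HSet.prod hμ hTH (HSet.prod hμ hUH hUH)))
      sep_subset⟩, ⟨T, hTH⟩], ?_⟩
  refine ⟨c1, c2, fun d hd => c34 d (hD.1 hd), c34 p hp, c5,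
    fun x hx y hy => mem_trcl_of_mem hy hx, hZT, ?_, ?_⟩
  · intro d hd β' s hs
    obtain ⟨hsU, β, hβ, rfl, hr⟩ := (memPC _ _).1 hs
    refine (memLE β hβ d (hDU d hd) s hsU).trans (hq.leForm_iff hD hβ hZT
      (fun b hb => hcode b (hb.le.trans hβ)) (c1 _) (hcode β hβ).conds hd hs hr).symm
  · intro x hx d hd β' τ hτ
    obtain ⟨hτU, β, hβ, rfl, hn⟩ := (memN _ _).1 hτ
    have hc := hcode β hβ
    refine (hc.eq_iff x hx τ hτ hn d hd).trans (hq.eqForm_iff hD hβ hc.names hc.conds hc.le_iff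
      (fun y hy => hc.eq_iff y (mem_trcl_of_mem hy hx)) hτ hn hd).symm

/-! ### Consequences of suitability -/

namespace IsElemSub

variable {Y : ZFSet.{u}} {κ μ : Cardinal.{u}}

theorem mem_of_forall_mem_iff (hY : IsElemSub Y κ) {R : HSet κ → Prop}
    (h : Dfn (params Y κ) fun v : Unit ⊕ Unit → HSet κ => R (v (.inr ()))) {x : ZFSet.{u}}
    (hx : x ∈ HSet κ) (hR : ∀ t : HSet κ, t.1 ∈ x ↔ R t) : x ∈ Y := by
  refine hY.mem_of_unique (R := fun y => ∀ t : HSet κ, t.1 ∈ y.1 ↔ R t)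
    (Dfn.all (Dfn.iff (Dfn.mem (.var _) (.var _)) h)) hx hR fun y hy => ?_
  ext t
  constructor
  · exact fun ht => (hR ⟨t, HSet.of_mem y.2 ht⟩).2 ((hy _).1 ht)
  · exact fun ht => (hy ⟨t, HSet.of_mem hx ht⟩).2 ((hR _).1 ht)

theorem pair_mem (hY : IsElemSub Y (Order.succ μ)) (hμ : ℵ₀ ≤ μ) {x y : ZFSet.{u}} (hx : x ∈ Y)
    (hy : y ∈ Y) : pair x y ∈ Y := by
  have hxH := hY.mem_HSet hx
  have hyH := hY.mem_HSet hy
  refine hY.mem_of_unique (R := fun z => z.1 = pair (⟨x, hxH⟩ : HSet (Order.succ μ)).1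
    (⟨y, hyH⟩ : HSet (Order.succ μ)).1) ?_ (HSet.pair hμ hxH hyH) rfl fun _ h => h
  exact Dfn.eq_pair hμ (.const hx) (.const hy) (.var _)

theorem bit_mem (hY : IsElemSub Y (Order.succ μ)) (hμ : ℵ₀ ≤ μ) (b : Bool) : bit b ∈ Y := by
  have h0 := hY.empty_mem
  cases b
  · exact h0
  · have := hY.insert_self_mem hμ h0
    simpa [bit] using this

theorem timesTwo_mem (hY : IsElemSub Y (Order.succ μ)) (hμ : ℵ₀ ≤ μ) {x : ZFSet.{u}}
    (hx : x ∈ Y) : timesTwo x ∈ Y := by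
  have hxH := hY.mem_HSet hx
  have hb := fun b => hY.bit_mem hμ b
  have hbH := fun b => hY.mem_HSet (hb b)
  refine hY.mem_of_forall_mem_iff (R := fun t => ∃ y ∈ (⟨x, hxH⟩ : HSet (Order.succ μ)).1,
    t.1 = pair y (⟨_, hbH false⟩ : HSet (Order.succ μ)).1 ∨
    t.1 = pair y (⟨_, hbH true⟩ : HSet (Order.succ μ)).1) ?_ ?_ ?_
  · exact Dfn.bex (.const hx) (Dfn.or (Dfn.eq_pair hμ (.var _) (.const (hb false)) (.var _))
      (Dfn.eq_pair hμ (.var _) (.const (hb true)) (.var _)))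
  · refine HSet.prod hμ hxH (HSet.pair_set hμ (hbH false) ?_)
    simpa [bit] using hbH true
  · intro t
    rw [ForcingNotion.mem_timesTwo]
    refine exists_congr fun y => and_congr_right fun _ => ?_
    rw [Bool.exists_bool]

/-- The countable ordinals in a countable elementary submodel form an initial segment. -/
theorem toZFSet_mem_of_lt (hY : IsElemSub Y (Order.succ μ)) (hμ : ℵ₀ ≤ μ) {ξ η : Ordinal.{u}}
    (hη : toZFSet η ∈ Y) (hω : η < ω₁) (h : ξ < η) : toZFSet ξ ∈ Y := by
  refine hY.subset_of_countable hμ hη ?_ (toZFSet_mem_toZFSet_iff.2 h)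
  refine ((countable_Iic_of_lt_omega_one hω).image toZFSet).mono fun x hx => ?_
  obtain ⟨ζ, hζ, rfl⟩ := mem_toZFSet_iff.1 hx
  exact ⟨ζ, hζ.le, rfl⟩

end IsElemSub

/-- Each countable ordinal ξ is below the countable limit ξ + ω, so ω₁ is the union of the domain of
the ladder system. This gives ω₁ ∈ Y_0, where only the ladder system is assumed. -/
theorem mem_omega_one_iff_ladderCode (C : Ordinal.{u} → ℕ → Ordinal.{u}) {x : ZFSet.{u}} :
    x ∈ toZFSet ω₁ ↔ ∃ η c, pair η c ∈ ladderCode C ∧ x ∈ η := by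
  constructor
  · intro hx
    obtain ⟨ξ, hξ, rfl⟩ := mem_toZFSet_iff.1 hx
    have hlt : ξ + ω < ω₁ := isPrincipal_add_omega 1 hξ (by simp)
    have hη : ξ + ω ∈ Lim := ⟨hlt, isSuccLimit_add ξ isSuccLimit_omega0⟩
    refine ⟨toZFSet (ξ + ω), _, mem_range.2 ⟨⟨⟨ξ + ω, hlt⟩, hη⟩, rfl⟩, ?_⟩
    exact toZFSet_mem_toZFSet_iff.2 (lt_add_of_pos_right ξ omega0_pos)
  · rintro ⟨η', c, h, hx⟩
    obtain ⟨⟨η, hη⟩, he⟩ := mem_range.1 h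
    obtain ⟨rfl, -⟩ := pair_inj.1 he
    obtain ⟨ξ, hξ, rfl⟩ := mem_toZFSet_iff.1 hx
    exact toZFSet_mem_toZFSet_iff.2 (hξ.trans hη.1)

namespace DataSeq

variable (S : DataSeq.{u})

/-- `2^{|q|}`, so that `χ₁ = μ⁺`. -/
noncomputable def μ : Cardinal.{u} := 2 ^ S.q.size

variable {S}

namespace IsSuitable

theorem elem (hS : S.IsSuitable) (k : ℕ) : IsElemSub (S.Y k) (Order.succ S.μ) := hS.Y_elem k

theorem aleph_one_le (hS : S.IsSuitable) : ℵ₁ ≤ S.μ := by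
  have h1 := mem_HSet_succ.1 ((hS.elem 0).mem_HSet hS.C_mem_Y)
  refine le_trans ?_ h1
  have h2 : toZFSet ω₁ ⊆ trcl (ladderCode S.C) := by
    intro x hx
    obtain ⟨η, c, h, hx⟩ := (mem_omega_one_iff_ladderCode S.C).1 hx
    exact mem_trcl_of_mem hx (mem_trcl_of_pair (subset_trcl _ h)).1
  have := card_mono h2
  rwa [card_toZFSet, card_omega] at this

theorem aleph0_le (hS : S.IsSuitable) : ℵ₀ ≤ S.μ := aleph0_lt_aleph_one.le.trans hS.aleph_one_le

theorem Y_mono (hS : S.IsSuitable) : Monotone fun k => (S.Y k : Set ZFSet.{u}) :=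
  monotone_nat_of_le_succ fun k =>
    (hS.elem (k + 1)).subset_of_countable hS.aleph0_le (hS.Y_chain k) (hS.Y_countable k)

theorem mem_Y (hS : S.IsSuitable) {k l : ℕ} (h : k ≤ l) {x : ZFSet.{u}} (hx : x ∈ S.Y k) :
    x ∈ S.Y l := hS.Y_mono h hx

theorem omega_one_mem_HSet (hS : S.IsSuitable) : toZFSet ω₁ ∈ HSet (Order.succ S.μ) :=
  HSet.toZFSet_mem (by simpa using hS.aleph_one_le)

theorem omega_one_mem (hS : S.IsSuitable) : toZFSet ω₁ ∈ S.Y 0 := by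
  have hC := hS.C_mem_Y
  refine (hS.elem 0).mem_of_forall_mem_iff (R := fun t => ∃ η c,
    pair η c ∈ (⟨_, (hS.elem 0).mem_HSet hC⟩ : HSet (Order.succ S.μ)).1 ∧ t.1 ∈ η) ?_
    hS.omega_one_mem_HSet fun t => mem_omega_one_iff_ladderCode S.C
  exact Dfn.pex hS.aleph0_le (.const hC) (Dfn.mem (.var _) (.var _))

theorem code_mem_HSet (_ : S.IsSuitable) : S.q.code ∈ HSet (Order.succ S.μ) :=
  mem_HSet_succ.2 (Cardinal.cantor S.q.size).le

/-- Although `q` need not be in Y_0, its length is the domain of the condition `p`, which is. -/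
theorem len_mem (hS : S.IsSuitable) : toZFSet S.q.len ∈ S.Y 0 := by
  have hp := hS.p_mem_Y
  refine (hS.elem 0).mem_of_forall_mem_iff (R := fun t => ∃ b a,
    pair b a ∈ (⟨_, (hS.elem 0).mem_HSet hp⟩ : HSet (Order.succ S.μ)).1 ∧ t.1 = b) ?_
    (HSet.of_mem (HSet.trcl_mem hS.code_mem_HSet) (IterSeq.mem_trcl_code le_rfl).1) fun t => ?_
  · exact Dfn.pex hS.aleph0_le (.const hp) (Dfn.eq (.var _) (.var _))
  · have hpe := hS.iteration.eq_seqCode le_rfl hS.p_mem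
    constructor
    · intro h
      obtain ⟨b, hb, he⟩ := mem_toZFSet_iff.1 h
      refine ⟨_, fn S.p b, ?_, he.symm⟩
      rw [Subtype.coe_mk, hpe]
      exact pair_mem_seqCode.2 ⟨hb, by rw [← hpe]⟩
    · rintro ⟨b', a, h, he⟩
      rw [Subtype.coe_mk, hpe] at h
      obtain ⟨b, hb, he'⟩ := mem_seqCode.1 h
      obtain ⟨rfl, -⟩ := pair_inj.1 he'
      rw [he]
      exact toZFSet_mem_toZFSet_iff.2 hb

theorem denseOpen (hS : S.IsSuitable) (k : ℕ) : (S.q.P S.q.len).IsDenseOpen (S.D k) :=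
  ((hS.D_lists _).1 ⟨k, rfl⟩).2

/-- Elementarity of Y_0 applied to the five-place relation `IsCode`. By `codeAt` whatever sets are
found there are correct, even if they are not the ones built in `exists_isCode`. -/
theorem exists_code (hS : S.IsSuitable) : ∃ PC ∈ S.Y 0, ∃ N ∈ S.Y 0, ∃ LE ∈ S.Y 0, ∃ X ∈ S.Y 0,
    ∃ T ∈ S.Y 0, IsCode (S.D 0) S.p (timesTwo (toZFSet ω₁)) (toZFSet S.q.len) PC N LE X T := by
  have hY := hS.elem 0
  have hμ := hS.aleph0_le
  have hZ := hY.timesTwo_mem hμ hS.omega_one_mem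
  have hl := hS.len_mem
  have hp := hS.p_mem_Y
  have hD := hS.D_mem_Y 0
  obtain ⟨v, hv, hm⟩ := hY.exists_mem (Dfn.isCode hμ (D := ⟨_, hY.mem_HSet hD⟩)
    (p := ⟨_, hY.mem_HSet hp⟩) (Z := ⟨_, hY.mem_HSet hZ⟩) (l := ⟨_, hY.mem_HSet hl⟩) hD hp hZ hl)
    (hS.iteration.exists_isCode (hS.denseOpen 0) hS.p_mem hμ hS.code_mem_HSet (hY.mem_HSet hZ))
  exact ⟨_, hm 0, _, hm 1, _, hm 2, _, hm 3, _, hm 4, hv⟩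

theorem mem_X_iff (hS : S.IsSuitable) {ξ : Ordinal.{u}} (hξ : ξ < ω₁) :
    toZFSet ξ ∈ S.X ↔ ∃ k, toZFSet ξ ∈ S.Y k := by
  rw [← hS.Y_union]
  exact (and_iff_left (HSet.of_mem hS.omega_one_mem_HSet (toZFSet_mem_toZFSet_iff.2 hξ))).symm

/-- The countable ordinals in each Y_k form an initial segment, so the first one missed by X bounds
exactly those in the union. -/
theorem lt_γ_iff (hS : S.IsSuitable) {ξ : Ordinal.{u}} :
    ξ < S.γ ↔ ξ < ω₁ ∧ ∃ k, toZFSet ξ ∈ S.Y k := by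
  have hne : {ξ | ¬ (ξ < ω₁ ∧ toZFSet ξ ∈ S.X)}.Nonempty := ⟨ω₁, fun h => lt_irrefl _ h.1⟩
  constructor
  · intro h
    have := notMem_of_lt_csInf' h
    rw [Set.mem_ofPred_eq, not_not] at this
    exact ⟨this.1, (hS.mem_X_iff this.1).1 this.2⟩
  · rintro ⟨h1, k, hk⟩
    by_contra hlt
    rcases (not_lt.1 hlt).eq_or_lt with he | hlt
    · refine csInf_mem hne ?_
      rw [← he] at h1 hk
      exact ⟨h1, (hS.mem_X_iff h1).2 ⟨k, hk⟩⟩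
    · refine csInf_mem hne ⟨hlt.trans h1, (hS.mem_X_iff (hlt.trans h1)).2 ⟨k, ?_⟩⟩
      exact (hS.elem k).toZFSet_mem_of_lt hS.aleph0_le hk h1 hlt

theorem γ_lt (hS : S.IsSuitable) : S.γ < ω₁ := by
  by_contra h
  have h1 : (Set.Iio (ω₁ : Ordinal.{u})).Countable := by
    refine Set.MapsTo.countable_of_injOn (f := toZFSet) (t := (S.X : Set ZFSet.{u}))
      (fun ξ hξ => ?_) toZFSet_injective.injOn hS.X_countable
    exact (hS.mem_X_iff hξ).2 (hS.lt_γ_iff.1 (lt_of_lt_of_le hξ (not_lt.1 h))).2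
  rw [← Cardinal.le_aleph0_iff_set_countable, Cardinal.mk_Iio_ordinal, Cardinal.lift_le_aleph0,
    card_omega] at h1
  exact absurd h1 (not_le.2 aleph0_lt_aleph_one)

theorem γ_mem_Lim (hS : S.IsSuitable) : S.γ ∈ Lim := by
  refine ⟨hS.γ_lt, isSuccLimit_iff.2 ⟨?_, ?_⟩⟩
  · refine ne_of_gt (hS.lt_γ_iff.2 ⟨omega_pos 1, 0, ?_⟩)
    rw [toZFSet_zero]
    exact (hS.elem 0).empty_mem
  · refine Order.isSuccPrelimit_of_succ_lt fun ξ hξ => ?_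
    obtain ⟨h1, k, hk⟩ := hS.lt_γ_iff.1 hξ
    refine hS.lt_γ_iff.2 ⟨(isSuccLimit_omega 1).succ_lt h1, k, ?_⟩
    rw [Order.succ_eq_add_one, toZFSet_add_one]
    exact (hS.elem k).insert_self_mem hS.aleph0_le hk

theorem C_strictMono (hS : S.IsSuitable) : StrictMono (S.C S.γ) :=
  (hS.ladder _ hS.γ_mem_Lim).1

theorem C_lt (hS : S.IsSuitable) (n : ℕ) : S.C S.γ n < ω₁ :=
  ((hS.ladder _ hS.γ_mem_Lim).2.1 n).trans hS.γ_lt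

/-- The intersection of C_γ with Y_k is an initial segment of C_γ, and a proper one by `Y_ladder`;
so its size m_k is also the index of the first point of C_γ outside Y_k. -/
theorem lt_m_iff (hS : S.IsSuitable) {k n : ℕ} : n < S.m k ↔ toZFSet (S.C S.γ n) ∈ S.Y k := by
  have hdown : ∀ n n', n' ≤ n → toZFSet (S.C S.γ n) ∈ S.Y k → toZFSet (S.C S.γ n') ∈ S.Y k := by
    intro n n' h hn
    rcases h.eq_or_lt with rfl | h
    · exact hn
    · exact (hS.elem k).toZFSet_mem_of_lt hS.aleph0_le hn (hS.C_lt n) (hS.C_strictMono h)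
  have hex : ∃ n, toZFSet (S.C S.γ n) ∉ S.Y k := (hS.Y_ladder k).imp fun _ h => h.2
  classical
  have hset : {n | toZFSet (S.C S.γ n) ∈ S.Y k} = (Finset.range (Nat.find hex) : Set ℕ) := by
    ext n
    rw [Set.mem_ofPred_eq, Finset.mem_coe, Finset.mem_range]
    constructor
    · intro h
      by_contra hlt
      exact Nat.find_spec hex (hdown n _ (not_lt.1 hlt) h)
    · exact fun h => not_not.1 (Nat.find_min hex h)
  have hm : S.m k = Nat.find hex := by
    rw [DataSeq.m, hset, Set.ncard_coe_finset, Finset.card_range]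
  rw [hm, ← Finset.mem_range, ← Finset.mem_coe, ← hset]
  exact Iff.rfl

theorem m_mono (hS : S.IsSuitable) (k : ℕ) : S.m k ≤ S.m (k + 1) := by
  by_contra h
  exact lt_irrefl _ (hS.lt_m_iff.2 (hS.mem_Y k.le_succ (hS.lt_m_iff.1 (not_le.1 h))))

/-- The requirement α_{i_n} ∈ Y_k is automatic for n < k, since α_{i_n} ∈ Y_n and the models
increase. -/
theorem mem_uSet (hS : S.IsSuitable) {k : ℕ} {j : Ordinal.{u}} :
    j ∈ S.uSet k ↔ ∃ n < k, j = S.i n :=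
  exists_congr fun n => and_congr_right fun hn =>
    and_iff_left (hS.mem_Y hn.le (hS.i_mem_Y n))

theorem α_strictMono (_ : S.IsSuitable) : StrictMono S.α := by
  refine enumOrd_strictMono fun h => ?_
  obtain ⟨b, hb⟩ := h
  have := hb (show Order.succ (max b S.q.len) ∈ {ξ | toZFSet ξ ∈ S.X ∨ S.q.len ≤ ξ} from
    .inr ((le_max_right _ _).trans (Order.le_succ _)))
  exact absurd ((Order.lt_succ_of_le (le_max_left b S.q.len)).trans_le this) (lt_irrefl _)

theorem α_i_lt (hS : S.IsSuitable) (n : ℕ) : S.α (S.i n) < S.q.len :=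
  (hS.i_lists _).1 ⟨n, rfl⟩

end IsSuitable
end DataSeq

/-! ### Reflecting a family of conditions into an elementary submodel -/

/-- `d ↾ b ⊩ ž ∈ d(b)`, expressed by `LE` and `X`. -/
def ValForm (D LE X b z d : ZFSet.{u}) : Prop :=
  ∀ b' a, pair b' a ∈ d → b' = b → MemForm D LE X b a z d

/-- `d ↾ b` forces the domain of `d(b)` to be contained in `δ`, expressed by `LE` and `X`. -/
def BdForm (D Z LE X b δ d : ZFSet.{u}) : Prop :=
  ∀ b' a, pair b' a ∈ d → b' = b → ∀ x w, pair x w ∈ Z → ∀ z ∈ Z, z = pair x w → ∀ r ∈ D,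
    pair b (pair r d) ∈ LE → MemForm D LE X b a z r → x ∈ δ

namespace IsIteration

variable {C : Ordinal.{u} → ℕ → Ordinal.{u}} {F : (ℕ → Bool) → Option Bool} {q : IterSeq.{u}}
  {D p PC N LE X T d : ZFSet.{u}} {β : Ordinal.{u}}

theorem pair_mem_iff (hq : IsIteration C F q) (hd : d ∈ (q.P q.len).carrier) (hβ : β < q.len)
    {a : ZFSet.{u}} : pair (toZFSet β) a ∈ d ↔ a = fn d β := by
  conv_lhs => rw [hq.eq_seqCode le_rfl hd]
  rw [pair_mem_seqCode, and_iff_right hβ]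

theorem memForm_fn_iff (hq : IsIteration C F q) (hD : (q.P q.len).IsDenseOpen D)
    (h : IsCode D p (timesTwo (toZFSet ω₁)) (toZFSet q.len) PC N LE X T) (hβ : β < q.len)
    (hd : d ∈ D) {r z : ZFSet.{u}} (hr : r ∈ D) (hz : z ∈ timesTwo (toZFSet ω₁)) :
    MemForm D LE X (toZFSet β) (fn d β) z r ↔
      (q.P β).ForcesMem ((q.P β).check z) (fn d β) (restrict r β) := by
  have hdc := hD.1 hd
  refine (hq.codeAt hD h hβ.le).memForm_iff hq hD hβ.le (h.2.2.2.2.2.2.1 z hz) ?_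
    (hq.coord le_rfl hdc hβ).1 hr
  exact h.1 _ d (h.2.2.1 d hd) _ _ ((hq.pair_mem_iff hdc hβ).2 rfl)
    (toZFSet_mem_toZFSet_iff.2 hβ)

theorem valForm_iff (hq : IsIteration C F q) (hD : (q.P q.len).IsDenseOpen D)
    (h : IsCode D p (timesTwo (toZFSet ω₁)) (toZFSet q.len) PC N LE X T) (hβ : β < q.len)
    (hd : d ∈ D) {ξ : Ordinal.{u}} (hξ : ξ < ω₁) (v : Bool) :
    ValForm D LE X (toZFSet β) (pair (toZFSet ξ) (bit v)) d ↔ q.Val d β ξ v := by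
  have hz : pair (toZFSet ξ) (bit v) ∈ timesTwo (toZFSet ω₁) :=
    ForcingNotion.mem_timesTwo.2 ⟨_, toZFSet_mem_toZFSet_iff.2 hξ, v, rfl⟩
  refine Iff.trans ?_ (hq.memForm_fn_iff hD h hβ hd hd hz)
  constructor
  · exact fun hv => hv _ _ ((hq.pair_mem_iff (hD.1 hd) hβ).2 rfl) rfl
  · rintro hv b' a ha rfl
    rwa [(hq.pair_mem_iff (hD.1 hd) hβ).1 ha]

theorem bdForm_iff (hq : IsIteration C F q) (hD : (q.P q.len).IsDenseOpen D)
    (h : IsCode D p (timesTwo (toZFSet ω₁)) (toZFSet q.len) PC N LE X T) (hβ : β < q.len)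
    (hd : d ∈ D) {δ : Ordinal.{u}} :
    BdForm D (timesTwo (toZFSet ω₁)) LE X (toZFSet β) (toZFSet δ) d ↔ q.Bd d β δ := by
  have hdc := hD.1 hd
  have hc := hq.codeAt hD h hβ.le
  have hle : ∀ r ∈ D, (pair (toZFSet β) (pair r d) ∈ LE ↔
      (q.P β).Le (restrict r β) (restrict d β)) := fun r hr =>
    hc.le_iff r hr d (hc.conds d hd) (hq.restrict_mem le_rfl hβ.le hdc)
  constructor
  · intro hb ξ hξ v t ht hv
    obtain ⟨r, h1, rfl, -⟩ := hq.exists_le_of_le_restrict hdc hβ.le ht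
    have hr := hD.2.2 d hd r (hq.left_mem le_rfl h1).1 h1
    have hz : pair (toZFSet ξ) (bit v) ∈ timesTwo (toZFSet ω₁) :=
      ForcingNotion.mem_timesTwo.2 ⟨_, toZFSet_mem_toZFSet_iff.2 hξ, v, rfl⟩
    exact toZFSet_mem_toZFSet_iff.1 (hb _ _ ((hq.pair_mem_iff hdc hβ).2 rfl) rfl _ _ hz _ hz rfl r
      hr ((hle r hr).2 ht) ((hq.memForm_fn_iff hD h hβ hd hr hz).2 hv))
  · rintro hb b' a ha rfl x w hz z _ rfl r hr hrd hv
    obtain rfl := (hq.pair_mem_iff hdc hβ).1 ha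
    rw [hq.memForm_fn_iff hD h hβ hd hr hz] at hv
    obtain ⟨x', hx, v, he⟩ := ForcingNotion.mem_timesTwo.1 hz
    obtain ⟨rfl, rfl⟩ := pair_inj.1 he
    obtain ⟨ξ, hξ, rfl⟩ := mem_toZFSet_iff.1 hx
    exact toZFSet_mem_toZFSet_iff.2 (hb ξ hξ v _ ((hle r hr).1 hrd) hv)

end IsIteration

/-! ### Definability of the value and bound formulas -/

section

variable {μ : Cardinal.{u}} {A : Set (HSet (Order.succ μ))} {ι : Type*}
  {D Z LE X b z δ d : (ι → HSet (Order.succ μ)) → HSet (Order.succ μ)}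

theorem Dfn.valForm (hμ : ℵ₀ ≤ μ) (hD : Tm A D) (hLE : Tm A LE) (hX : Tm A X) (hb : Tm A b)
    (hz : Tm A z) (hd : Tm A d) : Dfn A fun v =>
      ValForm (D v).1 (LE v).1 (X v).1 (b v).1 (z v).1 (d v).1 := by
  refine Dfn.subst (R := fun v : Fin 6 → HSet (Order.succ μ) => ValForm (v 0).1 (v 1).1 (v 2).1
    (v 3).1 (v 4).1 (v 5).1) (f := ![D, LE, X, b, z, d]) ?_ ?_
  · unfold ValForm
    repeat' first
      | with_reducible exact Tm.var _ | with_reducible apply Dfn.memForm hμ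
      | with_reducible apply Dfn.pall hμ | with_reducible apply Dfn.eq
      | with_reducible apply Dfn.imp
  · intro j
    fin_cases j <;> assumption

theorem Dfn.bdForm (hμ : ℵ₀ ≤ μ) (hD : Tm A D) (hZ : Tm A Z) (hLE : Tm A LE) (hX : Tm A X)
    (hb : Tm A b) (hδ : Tm A δ) (hd : Tm A d) : Dfn A fun v =>
      BdForm (D v).1 (Z v).1 (LE v).1 (X v).1 (b v).1 (δ v).1 (d v).1 := by
  refine Dfn.subst (R := fun v : Fin 7 → HSet (Order.succ μ) => BdForm (v 0).1 (v 1).1 (v 2).1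
    (v 3).1 (v 4).1 (v 5).1 (v 6).1) (f := ![D, Z, LE, X, b, δ, d]) ?_ ?_
  · unfold BdForm
    repeat' first
      | with_reducible exact Tm.var _ | with_reducible apply Dfn.memForm hμ
      | with_reducible apply Dfn.triple_mem hμ | with_reducible apply Dfn.mem
      | with_reducible apply Dfn.pall hμ | with_reducible apply Dfn.ball
      | with_reducible apply Dfn.eq_pair hμ | with_reducible apply Dfn.eq
      | with_reducible apply Dfn.imp
  · intro j
    fin_cases j <;> assumption

end

/-! ### Bounds and coherent families inside Y_k -/

namespace DataSeq.IsSuitable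

variable {S : DataSeq.{u}}

/-- Being a bound is expressed by `BdForm` with parameters in Y_k, so a countable bound can be found
in Y_k. This is what places the ladder points outside Y_k beyond the domain of the condition. -/
theorem exists_bd_mem (hS : S.IsSuitable) {k : ℕ} {d : ZFSet.{u}} (hdY : d ∈ S.Y k)
    (hd : d ∈ S.D 0) {β : Ordinal.{u}} (hβ : β < S.q.len) (hβY : toZFSet β ∈ S.Y k)
    (hb : ∃ δ < ω₁, S.q.Bd d β δ) : ∃ δ < ω₁, S.q.Bd d β δ ∧ toZFSet δ ∈ S.Y k := by
  obtain ⟨PC, -, N, -, LE, hLE, X, hX, T, -, hcode⟩ := hS.exists_code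
  have hY := hS.elem k
  have hμ := hS.aleph0_le
  have hO := hS.mem_Y (Nat.zero_le k) hS.omega_one_mem
  have hZ := hY.timesTwo_mem hμ hO
  have hD := hS.mem_Y (Nat.zero_le k) (hS.D_mem_Y 0)
  replace hLE := hS.mem_Y (Nat.zero_le k) hLE
  replace hX := hS.mem_Y (Nat.zero_le k) hX
  have hform : ∀ δ, BdForm (S.D 0) (timesTwo (toZFSet ω₁)) LE X (toZFSet β) (toZFSet δ) d ↔
    S.q.Bd d β δ := fun δ => hS.iteration.bdForm_iff (hS.denseOpen 0) hcode hβ hd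
  let c : ∀ x, x ∈ S.Y k → HSet (Order.succ S.μ) := fun x hx => ⟨x, hY.mem_HSet hx⟩
  obtain ⟨v, ⟨h1, h2⟩, hv⟩ := hY.exists_mem (ι := Unit) (R := fun v => (v ()).1 ∈ (c _ hO).1 ∧
      BdForm (c _ hD).1 (c _ hZ).1 (c _ hLE).1 (c _ hX).1 (c _ hβY).1 (v ()).1 (c _ hdY).1)
    (Dfn.and (Dfn.mem (.var _) (.const hO)) (Dfn.bdForm hμ (.const hD) (.const hZ) (.const hLE)
      (.const hX) (.const hβY) (.var _) (.const hdY)))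
    (by
      obtain ⟨δ, hδ, h⟩ := hb
      have hm := toZFSet_mem_toZFSet_iff.2 hδ
      exact ⟨fun _ => ⟨toZFSet δ, HSet.of_mem (hY.mem_HSet hO) hm⟩, hm, (hform δ).2 h⟩)
  obtain ⟨δ, hδ, he⟩ := mem_toZFSet_iff.1 h1
  have hvY := hv ()
  rw [← he] at h2 hvY
  exact ⟨δ, hδ, (hform δ).1 h2, hvY⟩

/-- For finitely many indices all requirements form one relation definable over Y_k by means of the
code. The condition `S.p` is allowed among the `p i` to serve the first level; `IsCode` therefore
puts it in the domain of `LE`. -/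
theorem exists_reflect (hS : S.IsSuitable) {k : ℕ} {D : ZFSet.{u}} (hDY : D ∈ S.Y k)
    (A u : Finset Ordinal.{u}) (hA : ∀ ξ ∈ A, ξ < ω₁) (hAY : ∀ ξ ∈ A, toZFSet ξ ∈ S.Y k)
    (hu : ∀ b ∈ u, b < S.q.len) (huY : ∀ b ∈ u, toZFSet b ∈ S.Y k) {β : Ordinal.{u}}
    (hβ : β < S.q.len) (hβY : toZFSet β ∈ S.Y k) {ι : Type*} [Finite ι]
    {a : ι → Ordinal.{u} → Ordinal.{u} → Bool} {p p' : ι → ZFSet.{u}}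
    (hp : ∀ i, p i ∈ S.D 0 ∨ p i = S.p) (hpY : ∀ i, p i ∈ S.Y k) (hp' : ∀ i, p' i ∈ S.D 0)
    (hle : ∀ i, (S.q.P S.q.len).Le (p' i) (p i)) (hdone : ∀ i, S.q.Done D A u β (a i) (p' i))
    (hcoh : Coherent S.q.len u a p') :
    ∃ p'' : ι → ZFSet.{u}, (∀ i, p'' i ∈ S.Y k) ∧ (∀ i, (S.q.P S.q.len).Le (p'' i) (p i)) ∧
      (∀ i, S.q.Done D A u β (a i) (p'' i)) ∧ Coherent S.q.len u a p'' := by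
  classical
  obtain ⟨PC, -, N, -, LE, hLE, X, hX, T, -, hcode⟩ := hS.exists_code
  have hq := hS.iteration
  have hDO := hS.denseOpen 0
  have hY := hS.elem k
  have hμ := hS.aleph0_le
  have hO := hS.mem_Y (Nat.zero_le k) hS.omega_one_mem
  have hZ := hY.timesTwo_mem hμ hO
  have hD := hS.mem_Y (Nat.zero_le k) (hS.D_mem_Y 0)
  have hl := hS.mem_Y (Nat.zero_le k) hS.len_mem
  replace hLE := hS.mem_Y (Nat.zero_le k) hLE
  replace hX := hS.mem_Y (Nat.zero_le k) hX
  have hzY : ∀ ξ ∈ A, ∀ b, pair (toZFSet ξ) (bit b) ∈ S.Y k := fun ξ hξ b =>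
    hY.pair_mem hμ (hAY ξ hξ) (hY.bit_mem hμ b)
  have huβ : ∀ b ∈ insert β u, b < S.q.len := by
    simpa [hβ] using hu
  have huβY : ∀ b ∈ insert β u, toZFSet b ∈ S.Y k := by
    simpa [hβY] using huY
  have hulY : ∀ b ∈ insert S.q.len u, toZFSet b ∈ S.Y k := by
    simpa [hl] using huY
  let c : ∀ x, x ∈ S.Y k → HSet (Order.succ S.μ) := fun x hx => ⟨x, hY.mem_HSet hx⟩
  have hval : ∀ d ∈ S.D 0, ∀ b < S.q.len, ∀ ξ ∈ A, ∀ w,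
      (ValForm (S.D 0) LE X (toZFSet b) (pair (toZFSet ξ) (bit w)) d ↔ S.q.Val d b ξ w) :=
    fun d hd b hb ξ hξ w => hq.valForm_iff hDO hcode hb hd (hA ξ hξ) w
  have hbd : ∀ d ∈ S.D 0, ∀ b < S.q.len,
      ((∃ δ ∈ toZFSet ω₁, BdForm (S.D 0) (timesTwo (toZFSet ω₁)) LE X (toZFSet b) δ d) ↔
        ∃ δ < ω₁, S.q.Bd d b δ) := by
    intro d hd b hb
    constructor
    · rintro ⟨δ', hδ', h⟩
      obtain ⟨δ, hδ, rfl⟩ := mem_toZFSet_iff.1 hδ'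
      exact ⟨δ, hδ, (hq.bdForm_iff hDO hcode hb hd).1 h⟩
    · rintro ⟨δ, hδ, h⟩
      exact ⟨_, toZFSet_mem_toZFSet_iff.2 hδ, (hq.bdForm_iff hDO hcode hb hd).2 h⟩
  have hlef : ∀ i, ∀ d ∈ S.D 0, (pair (toZFSet S.q.len) (pair d (p i)) ∈ LE ↔
      (S.q.P S.q.len).Le d (p i)) := by
    intro i d hd
    have hc := hq.codeAt hDO hcode le_rfl
    have hpi := (hq.left_mem le_rfl (hle i)).2
    have hPC : pair (toZFSet S.q.len) (p i) ∈ PC := by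
      rcases hp i with h | h
      · exact hc.conds _ h
      · rw [h]
        exact hcode.2.2.2.1
    have := hc.le_iff d hd (p i) hPC (by rwa [hq.restrict_self le_rfl hpi])
    rwa [hq.restrict_self le_rfl hpi, hq.restrict_self le_rfl (hDO.1 hd)] at this
  -- Coherence is required only at the elements of `u` and at the length, because the definability
  -- argument treats these ordinals as finitely many parameters in Y_k.
  let R : (ι → HSet (Order.succ S.μ)) → Prop := fun v =>
    (∀ i, (v i).1 ∈ (c _ hD).1) ∧ (∀ i, (v i).1 ∈ (c _ hDY).1) ∧
    (∀ i, pair (c _ hl).1 (pair (v i).1 (c _ (hpY i)).1) ∈ (c _ hLE).1) ∧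
    (∀ i, ∀ b : {b // b ∈ u}, ∀ ξ : {ξ // ξ ∈ A}, ValForm (c _ hD).1 (c _ hLE).1 (c _ hX).1
      (c _ (huY b.1 b.2)).1 (c _ (hzY ξ.1 ξ.2 (a i b.1 ξ.1))).1 (v i).1) ∧
    (∀ i, ∀ ξ : {ξ // ξ ∈ A},
      ValForm (c _ hD).1 (c _ hLE).1 (c _ hX).1 (c _ hβY).1 (c _ (hzY ξ.1 ξ.2 false)).1 (v i).1 ∨
      ValForm (c _ hD).1 (c _ hLE).1 (c _ hX).1 (c _ hβY).1 (c _ (hzY ξ.1 ξ.2 true)).1 (v i).1) ∧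
    (∀ i, ∀ b : {b // b ∈ insert β u}, ∃ δ ∈ (c _ hO).1, BdForm (c _ hD).1 (c _ hZ).1 (c _ hLE).1
      (c _ hX).1 (c _ (huβY b.1 b.2)).1 δ (v i).1) ∧
    ∀ i j, ∀ β' : {b // b ∈ insert S.q.len u}, (∀ b ∈ u, b < β'.1 → a i b = a j b) →
      ∀ b x, pair b x ∈ (v i).1 → b ∈ (c _ (hulY β'.1 β'.2)).1 → pair b x ∈ (v j).1
  have hR : Dfn (params (S.Y k) (Order.succ S.μ)) R := by
    refine Dfn.and ?_ (Dfn.and ?_ (Dfn.and ?_ (Dfn.and ?_ (Dfn.and ?_ (Dfn.and ?_ ?_)))))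
    · exact Dfn.forall_finite fun i => Dfn.mem (.var _) (.const hD)
    · exact Dfn.forall_finite fun i => Dfn.mem (.var _) (.const hDY)
    · exact Dfn.forall_finite fun i =>
        Dfn.triple_mem hμ (.const hl) (.var _) (.const (hpY i)) (.const hLE)
    · exact Dfn.forall_finite fun i => Dfn.forall_finite fun b => Dfn.forall_finite fun ξ =>
        Dfn.valForm hμ (.const hD) (.const hLE) (.const hX) (.const (huY b.1 b.2))
          (.const (hzY ξ.1 ξ.2 _)) (.var _)
    · exact Dfn.forall_finite fun i => Dfn.forall_finite fun ξ => Dfn.or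
        (Dfn.valForm hμ (.const hD) (.const hLE) (.const hX) (.const hβY)
          (.const (hzY ξ.1 ξ.2 false)) (.var _))
        (Dfn.valForm hμ (.const hD) (.const hLE) (.const hX) (.const hβY)
          (.const (hzY ξ.1 ξ.2 true)) (.var _))
    · exact Dfn.forall_finite fun i => Dfn.forall_finite fun b => Dfn.bex (.const hO)
        (Dfn.bdForm hμ (.const hD) (.const hZ) (.const hLE) (.const hX)
          (.const (huβY b.1 b.2)) (.var _) (.var _))
    · exact Dfn.forall_finite fun i => Dfn.forall_finite fun j => Dfn.forall_finite fun β' =>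
        Dfn.imp (Dfn.of_prop _) (Dfn.pall hμ (.var _) (Dfn.imp
          (Dfn.mem (.var _) (.const (hulY β'.1 β'.2))) (Dfn.pair_mem hμ (.var _) (.var _) (.var _))))
  have hp'H : ∀ i, p' i ∈ HSet (Order.succ S.μ) := fun i => HSet.of_mem (hY.mem_HSet hD) (hp' i)
  obtain ⟨v, ⟨h1, h2, h3, h4, h5, h6, h7⟩, hv⟩ := hY.exists_mem hR ⟨fun i => ⟨p' i, hp'H i⟩, by
    refine ⟨hp', fun i => (hdone i).mem, fun i => (hlef i _ (hp' i)).2 (hle i),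
      fun i b ξ => (hval _ (hp' i) _ (hu _ b.2) _ ξ.2 _).2 ((hdone i).val _ b.2 _ ξ.2),
      fun i ξ => ?_, fun i b => ?_, fun i j β' hβ' b x hx hb => ?_⟩
    · obtain ⟨w, hw⟩ := (hdone i).some_val ξ.1 ξ.2
      rw [← hval _ (hp' i) _ hβ _ ξ.2] at hw
      cases w
      exacts [.inl hw, .inr hw]
    · refine (hbd _ (hp' i) _ (huβ _ b.2)).2 ((hdone i).bd _ ?_)
      exact (Finset.mem_insert.1 b.2).symm
    · have hle' : β'.1 ≤ S.q.len := by
        rcases Finset.mem_insert.1 β'.2 with h | h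
        exacts [h.le, (hu _ h).le]
      obtain ⟨b, hbβ, rfl⟩ := mem_toZFSet_iff.1 hb
      have := hcoh i j β'.1 hle' hβ'
      have h8 := (pair_mem_restrict.2 ⟨hx, hbβ⟩ : pair (toZFSet b) x ∈ restrict (p' i) β'.1)
      rw [this] at h8
      exact (pair_mem_restrict.1 h8).1⟩
  refine ⟨fun i => (v i).1, hv, fun i => (hlef i _ (h1 i)).1 (h3 i), fun i => ⟨h2 i, ?_, ?_, ?_⟩, ?_⟩
  · exact fun b hb ξ hξ => (hval _ (h1 i) b (hu b hb) ξ hξ _).1 (h4 i ⟨b, hb⟩ ⟨ξ, hξ⟩)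
  · intro ξ hξ
    rcases h5 i ⟨ξ, hξ⟩ with h | h
    exacts [⟨_, (hval _ (h1 i) β hβ ξ hξ _).1 h⟩, ⟨_, (hval _ (h1 i) β hβ ξ hξ _).1 h⟩]
  · intro b hb
    have hb' : b ∈ insert β u := Finset.mem_insert.2 hb.symm
    exact (hbd _ (h1 i) b (huβ b hb')).1 (h6 i ⟨b, hb'⟩)
  · intro i j β' hβ' hab
    -- An arbitrary `β'` is replaced by the least `b ≥ β'` in `u` or equal to the length. No element
    -- of `u` lies in [β', b), so the hypothesis is the same at `b`, and agreement below `b` gives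
    -- agreement below `β'`.
    obtain ⟨b, hb⟩ : ∃ b, Minimal (fun b => b ∈ insert S.q.len u ∧ β' ≤ b) b :=
      exists_minimal_of_wellFoundedLT _ ⟨S.q.len, Finset.mem_insert_self _ _, hβ'⟩
    have hlt : ∀ c ∈ u, c < b → c < β' := by
      intro c hc hcb
      by_contra hcβ
      exact not_le.2 hcb (hb.2 ⟨Finset.mem_insert_of_mem hc, not_lt.1 hcβ⟩ hcb.le)
    have key : ∀ i j, (∀ c ∈ u, c < β' → a i c = a j c) →
        restrict (v i).1 β' ⊆ restrict (v j).1 β' := by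
      intro i j hab z hz
      obtain ⟨hz, ξ, hξ, x, rfl⟩ := mem_sep.1 hz
      refine pair_mem_restrict.2 ⟨?_, hξ⟩
      exact h7 i j ⟨b, hb.1.1⟩ (fun c hc hcb => hab c hc (hlt c hc hcb)) _ _ hz
        (toZFSet_mem_toZFSet_iff.2 (hξ.trans_le hb.1.2))
    exact ZFSet.ext fun z => ⟨fun h => key i j hab h,
      fun h => key j i (fun c hc hcβ => (hab c hc hcβ).symm) h⟩

end DataSeq.IsSuitable

/-! ### The levels of the tree -/

/-- Any `r` below `p ↾ (β + 1)` forces at `β` that `r(β)` extends `p(β)`, so `r` is itself the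
witness that the density clause of `h_eq` asks for. -/
theorem IsIteration.forcesValue_h {C : Ordinal.{u} → ℕ → Ordinal.{u}}
    {F : (ℕ → Bool) → Option Bool} {q : IterSeq.{u}} {p : ZFSet.{u}} {β ξ : Ordinal.{u}} {v : Bool}
    (hq : IsIteration C F q) (hβ : β < q.len) (hp : p ∈ (q.P q.len).carrier) (hξ : ξ < ω₁)
    (hv : q.Val p β ξ v) :
    (q.P (Order.succ β)).ForcesValue (q.h β) (toZFSet ξ) v (restrict p (Order.succ β)) := by
  have hs := Order.succ_le_of_lt hβ
  have hsβ := Order.lt_succ β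
  have hP := hq.isPreorder hβ.le
  rw [hq.h_eq β hβ ξ hξ v _ (hq.restrict_mem le_rfl hs hp)]
  intro r hr hle
  refine ⟨r, hr, (hq.isPreorder hs).refl r hr, fn r, hq.eq_seqCode hs hr, ?_⟩
  rw [← hq.restrict_eq hs hsβ.le hr]
  have h1 := hq.le_restrict hs hsβ.le hle
  rw [restrict_restrict hsβ.le] at h1
  have h2 := ((hq.le_iff' hs).1 hle).2.2 β hsβ
  rw [hq.restrict_eq le_rfl hs hp, fn_seqCode _ hsβ] at h2
  exact (hv.mono hP h1).of_subset hP (hP.left _ _ h1) h2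

namespace DataSeq

variable (S : DataSeq.{u})

/-- The sequences `⟨s_ℓ : ℓ < n⟩`. -/
def Row (n : ℕ) : Type (u + 1) := ∀ ℓ : Fin n, S.uSet ℓ → Fin (S.m ℓ) → Bool

variable {S}

namespace Row

/-- The initial segment of length `n`. -/
def trunc {n : ℕ} (f : S.Row (n + 1)) : S.Row n := fun ℓ => f ℓ.castSucc

/-- The last entry. -/
def last {n : ℕ} (f : S.Row (n + 1)) : S.uSet n → Fin (S.m n) → Bool := f (Fin.last n)

/-- Appending an entry. -/
def snoc {n : ℕ} (f : S.Row n) (s : S.uSet n → Fin (S.m n) → Bool) : S.Row (n + 1) :=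
  Fin.snoc (α := fun ℓ : Fin (n + 1) => S.uSet ℓ → Fin (S.m ℓ) → Bool) f s

theorem trunc_snoc {n : ℕ} (f : S.Row n) (s : S.uSet n → Fin (S.m n) → Bool) :
    (f.snoc s).trunc = f :=
  Fin.init_snoc (α := fun ℓ : Fin (n + 1) => S.uSet ℓ → Fin (S.m ℓ) → Bool) _ _

theorem last_snoc {n : ℕ} (f : S.Row n) (s : S.uSet n → Fin (S.m n) → Bool) :
    (f.snoc s).last = s :=
  Fin.snoc_last (α := fun ℓ : Fin (n + 1) => S.uSet ℓ → Fin (S.m ℓ) → Bool) _ _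

end Row

/-- The properties of the nodes of length `k + 1` and of their conditions. -/
structure IsLevel (S : DataSeq.{u}) (k : ℕ) (L : Set (S.Row (k + 1)))
    (pc : S.Row (k + 1) → ZFSet.{u}) : Prop where
  finite : L.Finite
  mem : ∀ f ∈ L, pc f ∈ S.D k ∧ pc f ∈ S.Y k
  mem_zero : ∀ f ∈ L, pc f ∈ S.D 0
  val : ∀ f ∈ L, ∀ j n, S.q.Val (pc f) (S.α j.1) (S.C S.γ n.1) (f.last j n)
  bd : ∀ f ∈ L, ∀ j ∈ S.uSet k, ∃ δ < ω₁, S.q.Bd (pc f) (S.α j) δ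
  agree : ∀ f ∈ L, ∀ g ∈ L, ∀ β ≤ S.q.len, (∀ j, S.α j.1 < β → f.last j = g.last j) →
    restrict (pc f) β = restrict (pc g) β

/-- The relation between consecutive levels. -/
structure IsNextLevel (S : DataSeq.{u}) (k : ℕ) (L : Set (S.Row (k + 1)))
    (pc : S.Row (k + 1) → ZFSet.{u}) (L' : Set (S.Row (k + 2)))
    (pc' : S.Row (k + 2) → ZFSet.{u}) : Prop where
  trunc_mem : ∀ f ∈ L', f.trunc ∈ L
  le : ∀ f ∈ L', S.poset.Le (pc' f) (pc f.trunc)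
  coherent : ∀ f ∈ L', ∀ (j) (hj : j ∈ S.uSet k), ∃ hj' : j ∈ S.uSet (k + 1),
    InitSeg (f.trunc.last ⟨j, hj⟩) (f.last ⟨j, hj'⟩)
  splitting : ∀ f ∈ L, ∀ s : S.uSet k → Fin (S.m (k + 1)) → Bool,
    (∀ j, InitSeg (f.last j) (s j)) → ∃! g, g ∈ L' ∧ g.trunc = f ∧
      ∀ (j) (hj : j ∈ S.uSet k), ∃ hj' : j ∈ S.uSet (k + 1), g.last ⟨j, hj'⟩ = s ⟨j, hj⟩

namespace IsSuitable

theorem finite_uSet (hS : S.IsSuitable) (k : ℕ) : (S.uSet k).Finite := by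
  refine ((Set.finite_lt_nat k).image S.i).subset fun j hj => ?_
  obtain ⟨n, hn, rfl⟩ := hS.mem_uSet.1 hj
  exact ⟨n, hn, rfl⟩

theorem uSet_succ (hS : S.IsSuitable) {k : ℕ} {j : Ordinal.{u}} :
    j ∈ S.uSet (k + 1) ↔ j ∈ S.uSet k ∨ j = S.i k := by
  simp only [hS.mem_uSet]
  constructor
  · rintro ⟨n, hn, rfl⟩
    rcases (Nat.lt_succ_iff.1 hn).eq_or_lt with rfl | h
    exacts [.inr rfl, .inl ⟨n, h, rfl⟩]
  · rintro (⟨n, hn, rfl⟩ | rfl)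
    exacts [⟨n, hn.trans k.lt_succ_self, rfl⟩, ⟨k, k.lt_succ_self, rfl⟩]

theorem α_lt (hS : S.IsSuitable) {k : ℕ} {j : Ordinal.{u}} (hj : j ∈ S.uSet k) :
    S.α j < S.q.len := by
  obtain ⟨n, -, rfl⟩ := hS.mem_uSet.1 hj
  exact hS.α_i_lt n

theorem α_mem (_ : S.IsSuitable) {k : ℕ} {j : Ordinal.{u}} (hj : j ∈ S.uSet k) :
    toZFSet (S.α j) ∈ S.Y k := by
  obtain ⟨n, -, rfl, h⟩ := hj
  exact h

theorem exists_first_level (hS : S.IsSuitable) : ∃ pc : S.Row 1 → ZFSet.{u},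
    S.IsLevel 0 Set.univ pc ∧ ∀ f, S.poset.Le (pc f) S.p := by
  have hq := hS.iteration
  have hno : ∀ j, j ∉ S.uSet 0 := fun j hj => by
    obtain ⟨n, hn, -⟩ := hS.mem_uSet.1 hj
    exact absurd hn n.not_lt_zero
  have hsub : ∀ f g : S.Row 1, f = g := fun f g => by
    funext ℓ j
    obtain rfl : ℓ = 0 := Subsingleton.elim _ _
    exact absurd j.2 (hno _)
  obtain ⟨p', h1, h2⟩ := hq.exists_family hS.ladder hS.dense (hS.denseOpen 0) ∅ (by simp) ∅
    (by simp) (hS.α_i_lt 0) (ι := Unit) (a := fun _ _ _ => false) (p := fun _ => S.p)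
    (fun _ => hS.p_mem) (fun _ _ _ _ _ => rfl) (by simp)
  obtain ⟨p'', h3, h4, h5, -⟩ := hS.exists_reflect (hS.D_mem_Y 0) ∅ ∅ (by simp) (by simp)
    (by simp) (by simp) (hS.α_i_lt 0) (hS.i_mem_Y 0) (p := fun _ => S.p) (fun _ => .inr rfl)
    (fun _ => hS.p_mem_Y) (fun i => (h1 i).2.mem) (fun i => (h1 i).1) (fun i => (h1 i).2) h2
  refine ⟨fun _ => p'' (), ⟨?_, fun _ _ => ⟨(h5 ()).mem, h3 ()⟩, fun _ _ => (h5 ()).mem, ?_, ?_,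
    fun _ _ _ _ _ _ _ => rfl⟩, fun _ => h4 ()⟩
  · have : Subsingleton (S.Row 1) := ⟨hsub⟩
    exact Set.toFinite _
  · exact fun f _ j => absurd j.2 (hno _)
  · exact fun f _ j hj => absurd hj (hno _)

/-- The old conditions, repeated once for each prescribed `s`, form a coherent family ready for the
new values. `exists_family` extends them and `exists_reflect` moves the result into Y_{k+1}. -/
theorem exists_next_level (hS : S.IsSuitable) {k : ℕ} {L : Set (S.Row (k + 1))}
    {pc : S.Row (k + 1) → ZFSet.{u}} (hL : S.IsLevel k L pc) :
    ∃ L' pc', S.IsLevel (k + 1) L' pc' ∧ S.IsNextLevel k L pc L' pc' := by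
  classical
  have hq := hS.iteration
  have hαi := hS.α_strictMono.injective
  have hCi := hS.C_strictMono.injective
  have hfinu := hS.finite_uSet k
  have : Finite (S.uSet k) := hfinu
  have : Finite L := hL.finite
  let ι := {σ : L × (S.uSet k → Fin (S.m (k + 1)) → Bool) //
    ∀ j, InitSeg (Row.last σ.1.1 j) (σ.2 j)}
  -- The prescription `s` is transferred to actual coordinates and ladder points; this loses nothing
  -- since both enumerations are injective. The value elsewhere is `false`.
  let a : ι → Ordinal.{u} → Ordinal.{u} → Bool := fun σ b ξ =>
    decide (∃ j n, S.α (Subtype.val j) = b ∧ S.C S.γ (Fin.val n) = ξ ∧ σ.1.2 j n = true)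
  have ha : ∀ (σ : ι) (j : S.uSet k) (n : Fin (S.m (k + 1))),
      a σ (S.α j.1) (S.C S.γ n.1) = σ.1.2 j n := by
    intro σ j n
    refine Bool.eq_iff_iff.2 (decide_eq_true_iff.trans ⟨?_, fun h => ⟨j, n, rfl, rfl, h⟩⟩)
    rintro ⟨j', n', h1, h2, h3⟩
    rwa [Subtype.ext (hαi h1), Fin.ext (hCi h2)] at h3
  have ha' : ∀ (σ τ : ι) (j : S.uSet k), a σ (S.α j.1) = a τ (S.α j.1) ↔ σ.1.2 j = τ.1.2 j := by
    intro σ τ j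
    constructor
    · intro h
      funext n
      rw [← ha, ← ha, h]
    · intro h
      funext ξ
      refine Bool.eq_iff_iff.2 (decide_eq_true_iff.trans (Iff.trans ?_ decide_eq_true_iff.symm))
      constructor <;> rintro ⟨j', n', h1, h2, h3⟩ <;> refine ⟨j', n', h1, h2, ?_⟩ <;>
      obtain rfl := Subtype.ext (hαi h1)
      · rwa [← h]
      · rwa [h]
  let A := (Finset.range (S.m (k + 1))).image (S.C S.γ)
  let u := hfinu.toFinset.image S.α
  have hA : ∀ ξ ∈ A, ∃ n < S.m (k + 1), S.C S.γ n = ξ := by simp [A]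
  have hu : ∀ b, b ∈ u ↔ ∃ j ∈ S.uSet k, S.α j = b := by simp [u]
  have hA1 : ∀ ξ ∈ A, ξ < ω₁ := by
    intro ξ hξ
    obtain ⟨n, -, rfl⟩ := hA ξ hξ
    exact hS.C_lt n
  have hA2 : ∀ ξ ∈ A, toZFSet ξ ∈ S.Y (k + 1) := by
    intro ξ hξ
    obtain ⟨n, hn, rfl⟩ := hA ξ hξ
    exact hS.lt_m_iff.1 hn
  have hA3 : ∀ n : Fin (S.m (k + 1)), S.C S.γ n ∈ A := fun n =>
    Finset.mem_image_of_mem _ (Finset.mem_range.2 n.2)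
  have hu1 : ∀ b ∈ u, b < S.q.len := by
    intro b hb
    obtain ⟨j, hj, rfl⟩ := (hu b).1 hb
    exact hS.α_lt hj
  have hu2 : ∀ b ∈ u, toZFSet b ∈ S.Y (k + 1) := by
    intro b hb
    obtain ⟨j, hj, rfl⟩ := (hu b).1 hb
    exact hS.mem_Y k.le_succ (hS.α_mem hj)
  have hcar : ∀ σ : ι, pc σ.1.1.1 ∈ (S.q.P S.q.len).carrier := fun σ =>
    (hS.denseOpen 0).1 (hL.mem_zero _ σ.1.1.2)
  have hcoh : Coherent S.q.len u a fun σ => pc σ.1.1.1 := by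
    intro σ τ β hβ h
    refine hL.agree _ σ.1.1.2 _ τ.1.1.2 β hβ fun j hj => ?_
    -- Agreement of the new values implies agreement of the old ones, which are their initial
    -- segments; so the coherence of the old level applies.
    have := (ha' σ τ j).1 (h _ ((hu _).2 ⟨j.1, j.2, rfl⟩) hj)
    funext n
    rw [(σ.2 j).2 n.1 n.2 (n.2.trans_le (hS.m_mono k)), this,
      (τ.2 j).2 n.1 n.2 (n.2.trans_le (hS.m_mono k))]
  have hready : ∀ σ : ι, ∀ b ∈ u, S.q.Ready A (pc σ.1.1.1) b (a σ b) := by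
    intro σ b hb
    obtain ⟨j, hj, rfl⟩ := (hu b).1 hb
    -- The bound lies in Y_k, so a ladder point below it lies in Y_k as well and has index less than
    -- m_k. There the old condition forces the value given by the old node, which `s` extends.
    obtain ⟨δ, hδ, hbd, hδY⟩ := hS.exists_bd_mem (hL.mem _ σ.1.1.2).2 (hL.mem_zero _ σ.1.1.2)
      (hS.α_lt hj) (hS.α_mem hj) (hL.bd _ σ.1.1.2 j hj)
    refine ⟨δ, hbd, fun ξ hξ hlt => ?_⟩
    obtain ⟨n, hn, rfl⟩ := hA ξ hξ
    have hnk : n < S.m k :=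
      hS.lt_m_iff.2 ((hS.elem k).toZFSet_mem_of_lt hS.aleph0_le hδY hδ hlt)
    have := hL.val _ σ.1.1.2 ⟨j, hj⟩ ⟨n, hnk⟩
    rw [(σ.2 ⟨j, hj⟩).2 n hnk hn, ← ha] at this
    exact this
  have hβ := hS.α_i_lt k
  obtain ⟨p', h1, h2⟩ := hq.exists_family hS.ladder hS.dense (hS.denseOpen (k + 1)) A hA1 u hu1 hβ
    hcar hcoh hready
  obtain ⟨p, hpY, hple, hpd, hpc⟩ := hS.exists_reflect (hS.D_mem_Y (k + 1)) A u hA1 hA2 hu1 hu2 hβ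
    (hS.mem_Y k.le_succ (hS.i_mem_Y k)) (fun σ => .inl (hL.mem_zero _ σ.1.1.2))
    (fun σ => hS.mem_Y k.le_succ (hL.mem _ σ.1.1.2).2)
    (fun σ => (hS.denseOpen 0).2.2 _ (hL.mem_zero _ σ.1.1.2) _ (hq.left_mem le_rfl (h1 σ).1).1
      (h1 σ).1) (fun σ => (h1 σ).1) (fun σ => (h1 σ).2) h2
  -- At the new coordinate α_{i_k} nothing is prescribed: the values that the condition happens to
  -- decide are recorded as the entry of the node.
  choose w hw using fun (σ : ι) (n : Fin (S.m (k + 1))) => (hpd σ).some_val _ (hA3 n)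
  let s' : ι → S.uSet (k + 1) → Fin (S.m (k + 1)) → Bool := fun σ j =>
    if h : j.1 ∈ S.uSet k then σ.1.2 ⟨j.1, h⟩ else w σ
  have hs' : ∀ (σ : ι) (j) (hj : j ∈ S.uSet k) (hj' : j ∈ S.uSet (k + 1)),
      s' σ ⟨j, hj'⟩ = σ.1.2 ⟨j, hj⟩ := fun σ j hj hj' => dif_pos hj
  let node : ι → S.Row (k + 2) := fun σ => Row.snoc σ.1.1.1 (s' σ)
  have hsub : ∀ {j}, j ∈ S.uSet k → j ∈ S.uSet (k + 1) := fun hj => hS.uSet_succ.2 (.inl hj)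
  have hlast : ∀ σ, (node σ).last = s' σ := fun σ => Row.last_snoc _ _
  have htrunc : ∀ σ, (node σ).trunc = σ.1.1.1 := fun σ => Row.trunc_snoc _ _
  have hinj : Function.Injective node := by
    intro σ τ h
    refine Subtype.ext (Prod.ext (Subtype.ext ?_) (funext fun j => ?_))
    · rw [← htrunc, ← htrunc, h]
    · rw [← hs' σ j.1 j.2 (hsub j.2), ← hs' τ j.1 j.2 (hsub j.2), ← hlast, ← hlast, h]
  have hpc' : ∀ σ, Function.extend node p (fun _ => ∅) (node σ) = p σ := fun σ =>
    hinj.extend_apply _ _ _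
  refine ⟨Set.range node, Function.extend node p fun _ => ∅, ⟨Set.finite_range node, ?_, ?_, ?_, ?_,
    ?_⟩, ⟨?_, ?_, ?_, ?_⟩⟩
  · rintro _ ⟨σ, rfl⟩
    rw [hpc']
    exact ⟨(hpd σ).mem, hpY σ⟩
  · rintro _ ⟨σ, rfl⟩
    rw [hpc']
    exact (hS.denseOpen 0).2.2 _ (hL.mem_zero _ σ.1.1.2) _ (hq.left_mem le_rfl (hple σ)).1 (hple σ)
  · rintro _ ⟨σ, rfl⟩ j n
    rw [hpc', hlast]
    by_cases hj : j.1 ∈ S.uSet k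
    · rw [hs' σ j.1 hj j.2, ← ha]
      exact (hpd σ).val _ ((hu _).2 ⟨j.1, hj, rfl⟩) _ (hA3 n)
    · have : s' σ j = w σ := dif_neg hj
      rw [this, (hS.uSet_succ.1 j.2).resolve_left hj]
      exact hw σ n
  · rintro _ ⟨σ, rfl⟩ j hj
    rw [hpc']
    refine (hpd σ).bd _ ((hS.uSet_succ.1 hj).imp (fun h => (hu _).2 ⟨j, h, rfl⟩) fun h => ?_)
    rw [h]
  · rintro _ ⟨σ, rfl⟩ _ ⟨τ, rfl⟩ β hβ h
    rw [hpc', hpc']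
    refine hpc σ τ β hβ fun b hb hlt => ?_
    obtain ⟨j, hj, rfl⟩ := (hu b).1 hb
    have := h ⟨j, hsub hj⟩ hlt
    rw [hlast, hlast, hs' σ j hj, hs' τ j hj] at this
    exact (ha' σ τ ⟨j, hj⟩).2 this
  · rintro _ ⟨σ, rfl⟩
    rw [htrunc]
    exact σ.1.1.2
  · rintro _ ⟨σ, rfl⟩
    rw [htrunc, hpc']
    exact hple σ
  · rintro _ ⟨σ, rfl⟩ j hj
    refine ⟨hsub hj, ?_⟩
    rw [htrunc, hlast, hs' σ j hj]
    exact σ.2 ⟨j, hj⟩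
  · intro f hf s hs
    refine ⟨node ⟨(⟨f, hf⟩, s), hs⟩, ⟨⟨_, rfl⟩, htrunc _, fun j hj => ⟨hsub hj, ?_⟩⟩, ?_⟩
    · rw [hlast, hs' _ j hj]
    · rintro _ ⟨⟨σ, rfl⟩, h1, h2⟩
      congr 1
      refine Subtype.ext (Prod.ext (Subtype.ext ?_) (funext fun j => ?_))
      · rw [← htrunc, h1]
      · obtain ⟨hj', h⟩ := h2 j.1 j.2
        rwa [hlast, hs' σ j.1 j.2] at h

end IsSuitable
end DataSeq

/-! ### The condition tree -/

namespace DataSeq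

variable {S : DataSeq.{u}}

theorem Node.IsInitial.eq_or_trunc {n : ℕ} {f : S.Row (n + 1)} {ρ : S.Node}
    (h : ρ.IsInitial ⟨n + 1, f⟩) : ρ = ⟨n + 1, f⟩ ∨ ρ.IsInitial ⟨n, f.trunc⟩ := by
  obtain ⟨m, g⟩ := ρ
  obtain ⟨h1, h2⟩ := h
  rcases (show m ≤ n + 1 from h1).eq_or_lt with rfl | hlt
  · left
    congr 1
    funext ℓ
    exact h2 ℓ.1 ℓ.2 ℓ.2
  · exact .inr ⟨Nat.lt_succ_iff.1 hlt, fun ℓ h3 h4 => h2 ℓ h3 (Nat.lt_succ_of_lt h4)⟩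

theorem Node.isInitial_trunc {n : ℕ} (f : S.Row (n + 1)) :
    Node.IsInitial (S := S) ⟨n, f.trunc⟩ ⟨n + 1, f⟩ :=
  ⟨n.le_succ, fun _ _ _ => rfl⟩

theorem Node.IsInitial.trunc_eq {n : ℕ} {f : S.Row n} {g : S.Row (n + 1)}
    (h : Node.IsInitial (S := S) ⟨n, f⟩ ⟨n + 1, g⟩) : g.trunc = f := by
  funext ℓ
  exact (h.2 ℓ.1 ℓ.2 (Nat.lt_succ_of_lt ℓ.2)).symm

/-- The nodes of length `n`, for given levels. -/
def rows (L : ∀ k, Set (S.Row (k + 1))) : ∀ n, Set (S.Row n)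
  | 0 => Set.univ
  | k + 1 => L k

/-- The conditions of the nodes of length `n`, for given levels. -/
def conds (pc : ∀ k, S.Row (k + 1) → ZFSet.{u}) : ∀ n, S.Row n → ZFSet.{u}
  | 0 => fun _ => S.p
  | k + 1 => pc k

/-- The construction relates consecutive levels only; the clauses about arbitrary initial segments
follow by induction along truncation. -/
theorem IsSuitable.isConditionTree (hS : S.IsSuitable) {L : ∀ k, Set (S.Row (k + 1))}
    {pc : ∀ k, S.Row (k + 1) → ZFSet.{u}} (hL : ∀ k, S.IsLevel k (L k) (pc k))
    (hnext : ∀ k, S.IsNextLevel k (L k) (pc k) (L (k + 1)) (pc (k + 1)))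
    (hroot : L 0 = Set.univ) (hp : ∀ f, S.poset.Le (pc 0 f) S.p) :
    S.IsConditionTree {ρ | ρ.2 ∈ rows L ρ.1} fun ρ => conds pc ρ.1 ρ.2 := by
  have hq := hS.iteration
  have hP := hq.isPreorder le_rfl
  have hno : ∀ j, j ∉ S.uSet 0 := fun j hj => by
    obtain ⟨n, hn, -⟩ := hS.mem_uSet.1 hj
    exact absurd hn n.not_lt_zero
  have htrunc : ∀ n, ∀ f ∈ rows L (n + 1), f.trunc ∈ rows L n := by
    intro n f hf
    cases n with
    | zero => exact Set.mem_univ _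
    | succ k => exact (hnext k).trunc_mem f hf
  have hle : ∀ n, ∀ f ∈ rows L (n + 1),
      S.poset.Le (conds pc (n + 1) f) (conds pc n f.trunc) := by
    intro n f hf
    cases n with
    | zero => exact hp f
    | succ k => exact (hnext k).le f hf
  have hcar : ∀ n, ∀ f ∈ rows L n, conds pc n f ∈ S.poset.carrier := by
    intro n f hf
    cases n with
    | zero => exact hS.p_mem
    | succ k => exact (hS.denseOpen 0).1 ((hL k).mem_zero f hf)
  have hne : ({ρ | ρ.2 ∈ rows L ρ.1} : Set S.Node).Nonempty := by
    refine ⟨⟨0, fun ℓ => ℓ.elim0⟩, ?_⟩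
    trivial
  refine ⟨hne, ?_, ?_, ?_, ?_, ?_, ?_, ?_, ?_, ?_, ?_⟩
  · rintro ⟨n, f⟩ hf ρ' hρ
    induction n with
    | zero =>
      obtain ⟨m, g⟩ := ρ'
      obtain rfl : m = 0 := Nat.le_zero.1 hρ.1
      trivial
    | succ n ih =>
      rcases hρ.eq_or_trunc with rfl | h
      · exact hf
      · exact ih (Row.trunc f) (htrunc n f hf) h
  · rintro ⟨n, f⟩ -
    refine ((hL n).finite.image fun g => (⟨n + 1, g⟩ : S.Node)).subset ?_
    rintro ⟨m, g⟩ ⟨hg, -, hm⟩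
    obtain rfl : m = n + 1 := hm
    exact ⟨g, hg, rfl⟩
  · refine ⟨⟨1, fun _ _ _ => false⟩, ⟨?_, rfl⟩, ?_⟩
    · change _ ∈ L 0
      rw [hroot]
      exact Set.mem_univ _
    · rintro ⟨m, g⟩ ⟨-, hm⟩
      obtain rfl : m = 1 := hm
      congr 1
      funext ℓ j
      obtain rfl : ℓ = 0 := Subsingleton.elim _ _
      exact absurd j.2 (hno _)
  · rintro ⟨n, f⟩ hf ℓ h j hj
    induction n with
    | zero => exact absurd h (Nat.not_lt_zero _)
    | succ n ih =>
      rcases (Nat.lt_succ_iff.1 h).eq_or_lt with rfl | hlt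
      · exact (hnext ℓ).coherent f hf j hj
      · exact ih (Row.trunc f) (htrunc n f hf) hlt
  · rintro ⟨n, f⟩ hf k hk s hs
    obtain rfl : n = k + 1 := hk
    obtain ⟨g, ⟨h1, h2, h3⟩, hu⟩ := (hnext k).splitting f hf s hs
    refine ⟨⟨k + 2, g⟩, ⟨h1, ?_, rfl, h3⟩, ?_⟩
    · rw [← h2]
      exact Node.isInitial_trunc g
    · rintro ⟨m, g'⟩ ⟨h4, h5, hm, h6⟩
      obtain rfl : m = k + 2 := hm
      rw [hu g' ⟨h4, h5.trunc_eq, h6⟩]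
  · rintro ⟨n, f⟩ - hn
    obtain rfl : n = 0 := hn
    rfl
  · rintro ⟨n, f⟩ hf k hk
    obtain rfl : n = k + 1 := hk
    exact (hL k).mem f hf
  · rintro ρ₁ - ⟨n, f⟩ hf h
    induction n with
    | zero =>
      obtain ⟨m, g⟩ := ρ₁
      obtain rfl : m = 0 := Nat.le_zero.1 h.1
      exact hP.refl _ hS.p_mem
    | succ n ih =>
      rcases h.eq_or_trunc with rfl | h
      · exact hP.refl _ (hcar _ f hf)
      · exact hP.trans _ _ _ (hle n f hf) (ih (Row.trunc f) (htrunc n f hf) h)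
  · rintro ⟨n, f⟩ hf k hk j hj i
    obtain rfl : n = k + 1 := hk
    exact hq.forcesValue_h (hS.α_lt hj) (hcar _ f hf) (hS.C_lt _) ((hL k).val f hf ⟨j, hj⟩ i)
  · rintro j hj ⟨n, f⟩ hf ⟨m, g⟩ hg hm h
    obtain rfl : n = m := hm
    cases n with
    | zero => rfl
    | succ k =>
      -- The levels satisfy more than clause 8 asks: agreement of the last entries at coordinates
      -- strictly below α_j already suffices.
      exact (hL k).agree f hf g hg _ hj.le fun i hi =>
        h k k.lt_succ_self k.lt_succ_self i.1 i.2 hi.le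

theorem IsSuitable.exists_conditionTree (hS : S.IsSuitable) :
    ∃ (T : Set S.Node) (pc : S.Node → ZFSet.{u}), S.IsConditionTree T pc := by
  obtain ⟨pc₀, h0, hp⟩ := hS.exists_first_level
  -- The next level is chosen as a total function of an arbitrary pair, so that the recursion below
  -- carries no proofs; validity is added afterwards by induction.
  choose! L' pc' hL' hnext using fun (k : ℕ) (x : Set (S.Row (k + 1)) × (S.Row (k + 1) → ZFSet.{u}))
    (h : S.IsLevel k x.1 x.2) => hS.exists_next_level h
  let x : ∀ k, Set (S.Row (k + 1)) × (S.Row (k + 1) → ZFSet.{u}) := fun k =>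
    Nat.rec (motive := fun k => Set (S.Row (k + 1)) × (S.Row (k + 1) → ZFSet.{u}))
      (Set.univ, pc₀) (fun k y => (L' k y, pc' k y)) k
  have hx : ∀ k, S.IsLevel k (x k).1 (x k).2 := by
    intro k
    induction k with
    | zero => exact h0
    | succ k ih => exact hL' k (x k) ih
  exact ⟨_, _, hS.isConditionTree hx (fun k => hnext k (x k) (hx k)) rfl hp⟩

end DataSeq
end CondTree

theorem mainTheorem8 (S : CondTree.DataSeq.{u}) (hS : S.IsSuitable) :
    ∃ (T : Set S.Node) (pc : S.Node → ZFSet.{u}), S.IsConditionTree T pc :=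
  hS.exists_conditionTree
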